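/- All graphs are finite and may have loops (a loop contributes $2$ to the degree of its vertex) and parallel edges. A *circuit* is a connected $2$-regular graph, a *tree* is a connected graph without circuits, and a *cycle* is a graph in which every vertex has even degree (it may be disconnected, have isolated vertices, or be empty). A graph $G$ is *$2$-edge-connected* if it is connected and stays connected after the deletion of any single edge (so $K_1$ is allowed). A graph $G$ *decomposes* into subgraphs $T$ and $C$ if $E(T)\cap E(C)=\emptyset$ and $E(T)\cup E(C)=E(G)$. A *cycle double cover (CDC)* of $G$ is a finite family of subgraphs of $G$, each of them a cycle (repetitions and empty cycles are allowed), such that every edge of $G$ lies in exactly two members of the family; a *$k$-CDC* is a CDC with exactly $k$ members. A graph $G$ is *contractible* to a graph $H$ if $G/F\cong H$ for some $F\subseteq E(G)$, where in $G/F$ each component of $(V(G),F)$ is contracted to a single vertex, the edges of $F$ are removed, and all edges of $E(G)\setminus F$ are kept (including loops and parallel edges). **Theorem 3.4.** Let $G$ be a $2$-edge-connected graph that decomposes into a tree $T$ and a cycle $C$ with $k\le 3$ components (isolated vertices of $C$ count as components). Then $G$ has a CDC $\mathcal S$ with $C\in\mathcal S$. In particular: 1. If $k\le 2$, then $G$ has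 a $5$-CDC $\mathcal S$ with $C\in\mathcal S$. 2. If $k=3$ and $G$ is not contractible to the Petersen graph, then $G$ has a $5$-CDC $\mathcal S$ with $C\in\mathcal S$. If $k=3$ and $G$ is contractible to the Petersen graph, then $G$ has a $6$-CDC $\mathcal S$ with $C\in\mathcal S$. -/

import Mathlib

/-!
Multigraphs are Mathlib's `Graph α β` (loops and parallel edges allowed), and subgraphs are
compared by `≤`.
-/

open scoped Graph

universe u v w

namespace Graph

/-- The degree of the vertex `x`; a loop counts twice. -/
noncomputable def degree {α : Type u} {β : Type v} (G : Graph α β) (x : α) : ℕ :=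
  {e | G.IsNonloopAt e x}.ncard + 2 * {e | G.IsLoopAt e x}.ncard

/-- The set of vertices that can be reached from `x` by walking along edges. For a vertex `x` of
`G` this is the vertex set of the component of `G` that contains `x`. -/
def component {α : Type u} {β : Type v} (G : Graph α β) (x : α) : Set α :=
  {y | Relation.ReflTransGen G.Adj x y}

/-- The number of components of a finite graph (isolated vertices are components too). -/
noncomputable def numComponents {α : Type u} {β : Type v} (G : Graph α β) : ℕ :=
  (G.component '' V(G)).ncard

/-- A connected graph; it has at least one vertex. -/
def IsConnected {α : Type u} {β : Type v} (G : Graph α β) : Prop :=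
  V(G).Nonempty ∧ ∀ x ∈ V(G), ∀ y ∈ V(G), y ∈ G.component x

/-- A graph that is connected and stays connected when any single edge is deleted. -/
def IsTwoEdgeConnected {α : Type u} {β : Type v} (G : Graph α β) : Prop :=
  G.IsConnected ∧ ∀ e ∈ E(G), (G.deleteEdges {e}).IsConnected

/-- A circuit is a connected 2-regular graph; one loop, or two parallel edges, with their ends
form a circuit. -/
def IsCircuit {α : Type u} {β : Type v} (G : Graph α β) : Prop :=
  G.IsConnected ∧ ∀ x ∈ V(G), G.degree x = 2

/-- A cycle is a graph all of whose vertices have even degree. It may be disconnected, have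
isolated vertices, or be empty. -/
def IsCycle {α : Type u} {β : Type v} (G : Graph α β) : Prop :=
  ∀ x ∈ V(G), Even (G.degree x)

/-- A (finite) tree is a connected graph without circuits. -/
def IsTree {α : Type u} {β : Type v} (G : Graph α β) : Prop :=
  G.IsConnected ∧ ∀ D : Graph α β, D ≤ G → ¬ D.IsCircuit

/-- `G` decomposes into the two subgraphs `T` and `C`: they are edge-disjoint and cover `E(G)`. -/
structure IsDecomposition {α : Type u} {β : Type v} (G T C : Graph α β) : Prop where
  left_le : T ≤ G
  right_le : C ≤ G
  disjoint : Disjoint E(T) E(C)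
  cover : E(T) ∪ E(C) = E(G)

/-- The family `S` of subgraphs of `G` is a cycle double cover: every member is a cycle and every
edge of `G` lies in exactly two members, counted with multiplicity (indices). -/
structure IsCDC {α : Type u} {β : Type v} {ι : Type w} (G : Graph α β) (S : ι → Graph α β) :
    Prop where
  le : ∀ i, S i ≤ G
  isCycle : ∀ i, (S i).IsCycle
  double : ∀ e ∈ E(G), {i | e ∈ E(S i)}.ncard = 2

/-- `G` has a `k`-CDC (a cycle double cover with `k` members) that contains `C`. -/
def HasCDCContaining {α : Type u} {β : Type v} (G : Graph α β) (k : ℕ) (C : Graph α β) : Prop :=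
  ∃ S : Fin k → Graph α β, G.IsCDC S ∧ ∃ i, S i = C

/-- The contraction `G / F` of a set `F` of edges: the components of the spanning subgraph
`(V(G), F)` become the vertices, the edges in `F` are removed, and all other edges are kept
(so that loops and parallel edges may arise). -/
def contract {α : Type u} {β : Type v} (G : Graph α β) (F : Set β) : Graph (Set α) β :=
  (G.deleteEdges F).map (G.restrict F).component

/-- Isomorphism of multigraphs. -/
def IsIsomorphic {α : Type u} {β : Type v} {α' : Type*} {β' : Type*}
    (G : Graph α β) (H : Graph α' β') : Prop :=
  ∃ (φ : V(G) ≃ V(H)) (ψ : E(G) ≃ E(H)), ∀ (e : E(G)) (x y : V(G)),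
    G.IsLink e x y ↔ H.IsLink (ψ e) (φ x) (φ y)

/-- `G` is contractible to `H`: contracting some set of edges of `G` yields `H`, up to
isomorphism. -/
def IsContractibleTo {α : Type u} {β : Type v} {α' : Type*} {β' : Type*}
    (G : Graph α β) (H : Graph α' β') : Prop :=
  ∃ F ⊆ E(G), (G.contract F).IsIsomorphic H

/-- The Petersen graph as a simple graph: its vertices are the 2-element subsets of a 5-element
set, and two of them are adjacent when they are disjoint. -/
def petersenSimple : SimpleGraph {s : Finset (Fin 5) // s.card = 2} where
  Adj s t := Disjoint s.1 t.1
  symm := ⟨fun _ _ h => h.symm⟩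
  loopless := ⟨fun s h => by
    have h0 : s.1 = ∅ := by simpa using h
    have h2 := s.2
    rw [h0] at h2
    simp at h2⟩

/-- The Petersen graph as a multigraph. -/
def petersen : Graph {s : Finset (Fin 5) // s.card = 2}
    (Sym2 {s : Finset (Fin 5) // s.card = 2}) :=
  Graph.ofSimpleGraph petersenSimple

end Graph

/-! Contract every component of $C$ to a point. The result is connected and bridgeless. The at most
three points that come from $C$ form a feedback vertex set `X`, because the remaining vertices span
a part of the tree. Flows take values in the Klein four-group, so orientations play no role. Three
facts carry the proof.

First, the contraction has a nowhere-zero flow, or it contracts further to the Petersen graph and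
has a flow that vanishes on a single Petersen edge `e₀` and otherwise only on edges in series with
it (`Feedback.flowOrPetersen`). Circuits of length at most four and vertices of degree two can be
contracted, since flows lift back with control over their zeros. When no such reduction is left,
counting edges against the forest off `X` shows that the graph is a single vertex or the Petersen
graph (`Irreducible.exists_equiv`).

Second, a flow of the contraction extends to a flow `f` of $G$ whose zeros on $C$ are under control.
Label the edges of $C$ along an Eulerian tour of each component so that the label changes exactly
once at each vertex, by the boundary that has to be compensated (`exists_euler_labelling`). At a
vertex off the tree there is no change, so the zeros of `f` on $C$ have even degree there. The tree
is connected, so these zeros extend by tree edges to an even set `σ` (`TreeCycle.exists_even`). If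
`f` has no zero off $C$, then $C$, `σ` and the sets `func w ∘ f + σ + C` for the three nonzero `w`
form a cover with five members (`TreeCycle.hasCover_five`).

Third, in the Petersen case one wants `σ` to avoid `e₀`, and an even set `δ` through `e₀` whose
other edges lie in `σ` or are zeros of `f` off $C$. Replacing `σ` by the two members `σ + δ` and `δ`
then gives a cover with six members (`TreeCycle.hasCover_six`). To find them, the labels of $C$ over
a vertex `x i` may be translated by a constant. This changes `σ` on the three Petersen edges at `x
i` in any prescribed way of even parity (`PetersenFibers.exists_modification`). A suitable
prescription makes `σ` trace a circuit of length eight with `e₀` as a chord, and `δ` is an arc of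
this circuit closed by `e₀` (`PetersenFibers.hasCover_six`).

A multigraph is encoded by the two maps `s t : E → V`. A contraction composes them with a map of
vertices and keeps the edge type. Contracted edges stay as loops, which boundaries of exponent two
do not see. -/

namespace EdgeEnds

noncomputable section

open scoped Classical

/-! ### Links, reachability, boundaries and flows -/

variable {V W E M N : Type*}

/-- The edge `e` joins `a` and `b`, where a multigraph is given by the ends `s e`, `t e` of its
edges. -/
def Link (s t : E → V) (e : E) (a b : V) : Prop :=
  (s e = a ∧ t e = b) ∨ (s e = b ∧ t e = a)

lemma Link.symm {s t : E → V} {e : E} {a b : V} (h : Link s t e a b) : Link s t e b a :=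
  Or.symm h

lemma link_self (s t : E → V) (e : E) : Link s t e (s e) (t e) := Or.inl ⟨rfl, rfl⟩

/-- Reachability along edges that satisfy `R`. -/
def Reach (s t : E → V) (R : E → Prop) : V → V → Prop :=
  Relation.ReflTransGen fun a b => ∃ e, R e ∧ Link s t e a b

lemma Reach.symm {s t : E → V} {R : E → Prop} {a b : V} (h : Reach s t R a b) :
    Reach s t R b a := by
  induction h with
  | refl => exact .refl
  | tail _ hbc ih =>
    obtain ⟨e, he, hl⟩ := hbc
    exact .head ⟨e, he, hl.symm⟩ ih

lemma Reach.mono {s t : E → V} {R R' : E → Prop} (h : ∀ e, R e → R' e) {a b : V}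
    (hab : Reach s t R a b) : Reach s t R' a b :=
  Relation.ReflTransGen.mono (fun _ _ ⟨e, he, hl⟩ => ⟨e, h e he, hl⟩) _ _ hab

lemma Reach.trans {s t : E → V} {R : E → Prop} {a b c : V}
    (h : Reach s t R a b) (h' : Reach s t R b c) : Reach s t R a c :=
  Relation.ReflTransGen.trans h h'

lemma Reach.of_link {s t : E → V} {R : E → Prop} {a b : V} {e : E} (he : R e)
    (h : Link s t e a b) : Reach s t R a b :=
  Relation.ReflTransGen.single ⟨e, he, h⟩

/-- A set that is closed along `R`-edges and contains `a` contains all that is reachable. -/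
lemma Reach.mem_of_closed {s t : E → V} {R : E → Prop} {A : Set V}
    (hA : ∀ e, R e → (s e ∈ A ↔ t e ∈ A)) {a b : V} (h : Reach s t R a b) : a ∈ A ↔ b ∈ A := by
  induction h with
  | refl => rfl
  | tail _ hbc ih =>
    obtain ⟨e, he, hl⟩ := hbc
    rw [ih]
    rcases hl with ⟨rfl, rfl⟩ | ⟨rfl, rfl⟩
    · exact hA e he
    · exact (hA e he).symm

variable [Fintype E]

/-- The boundary of an edge function: the sum of its values at the edges at `v`, loops counted
twice. -/
def bdry [AddCommMonoid M] (s t : E → V) (f : E → M) (v : V) : M :=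
  ∑ e, ((if s e = v then f e else 0) + (if t e = v then f e else 0))

/-- Over a group of exponent two: a flow. -/
def IsFlow [AddCommMonoid M] (s t : E → V) (f : E → M) : Prop := ∀ v, bdry s t f v = 0

section Basic
variable [AddCommMonoid M] (s t : E → V)

lemma bdry_add (f g : E → M) (v : V) :
    bdry s t (f + g) v = bdry s t f v + bdry s t g v := by
  simp only [bdry, ← Finset.sum_add_distrib]
  refine Finset.sum_congr rfl fun e _ => ?_
  simp only [Pi.add_apply]
  split_ifs <;> simp [add_add_add_comm]

lemma bdry_zero (v : V) : bdry s t (0 : E → M) v = 0 := by simp [bdry]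

lemma bdry_map [AddCommMonoid N] (φ : M →+ N) (f : E → M) (v : V) :
    bdry s t (fun e => φ (f e)) v = φ (bdry s t f v) := by
  simp only [bdry, map_sum, map_add]
  refine Finset.sum_congr rfl fun e _ => ?_
  split_ifs <;> simp

lemma bdry_sum {ι : Type*} (A : Finset ι) (f : ι → E → M) (v : V) :
    bdry s t (fun e => ∑ i ∈ A, f i e) v = ∑ i ∈ A, bdry s t (f i) v := by
  induction A using Finset.induction_on with
  | empty => simp [bdry]
  | insert i A hi ih =>
    rw [Finset.sum_insert hi, ← ih, ← bdry_add]
    congr 1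
    funext e
    simp [Finset.sum_insert hi]

lemma IsFlow.add {s t : E → V} {f g : E → M} (hf : IsFlow s t f) (hg : IsFlow s t g) :
    IsFlow s t (f + g) := fun v => by rw [bdry_add, hf v, hg v, add_zero]

lemma IsFlow.map {s t : E → V} [AddCommMonoid N] (φ : M →+ N) {f : E → M} (hf : IsFlow s t f) :
    IsFlow s t (fun e => φ (f e)) := fun v => by rw [bdry_map, hf v, map_zero]

lemma sum_bdry (f : E → M) (A : Finset V) :
    ∑ v ∈ A, bdry s t f v =
      ∑ e, ((if s e ∈ A then f e else 0) + (if t e ∈ A then f e else 0)) := by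
  simp only [bdry]
  rw [Finset.sum_comm]
  refine Finset.sum_congr rfl fun e _ => ?_
  rw [Finset.sum_add_distrib, Finset.sum_ite_eq, Finset.sum_ite_eq]

lemma bdry_comp [Fintype V] (μ : V → W) (f : E → M) (x : W) :
    bdry (μ ∘ s) (μ ∘ t) f x = ∑ v with μ v = x, bdry s t f v := by
  rw [sum_bdry]
  simp [bdry]

lemma IsFlow.comp [Fintype V] {s t : E → V} {f : E → M} (hf : IsFlow s t f) (μ : V → W) :
    IsFlow (μ ∘ s) (μ ∘ t) f := fun x => by
  rw [bdry_comp]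
  exact Finset.sum_eq_zero fun v _ => hf v

lemma bdry_single {s t : E → V} {e : E} {a b : V} (h : Link s t e a b) (c : M) (v : V) :
    bdry s t (Pi.single e c) v = (if v = a then c else 0) + (if v = b then c else 0) := by
  rw [bdry, Finset.sum_eq_single e]
  · rcases h with ⟨rfl, rfl⟩ | ⟨rfl, rfl⟩
    · simp [eq_comm]
    · rw [add_comm]; simp [eq_comm]
  · intro e' _ hne
    simp [Pi.single_eq_of_ne hne]
  · simp

end Basic

/-! ### Exponent two: cuts and prescribed boundaries -/

section CharTwo
variable [AddCommGroup M] [Module (ZMod 2) M]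

lemma eq_of_add_eq_zero_two {x y : M} (h : x + y = 0) : x = y := by
  have := ZModModule.add_self y
  calc x = x + (y + y) := by rw [this, add_zero]
    _ = y := by rw [← add_assoc, h, zero_add]

/-- An edge with both ends in `A` is counted twice and cancels, so only the cut is left. The parity
arguments for cuts rest on this. -/
lemma sum_bdry_cut (s t : E → V) (f : E → M) (A : Finset V) :
    ∑ v ∈ A, bdry s t f v = ∑ e with ¬ (s e ∈ A ↔ t e ∈ A), f e := by
  rw [sum_bdry, Finset.sum_filter]
  refine Finset.sum_congr rfl fun e _ => ?_
  by_cases h1 : s e ∈ A <;> by_cases h2 : t e ∈ A <;> simp [h1, h2, ZModModule.add_self]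

lemma sum_bdry_univ [Fintype V] (s t : E → V) (f : E → M) : ∑ v, bdry s t f v = 0 := by
  rw [sum_bdry_cut]; simp

lemma IsFlow.cut {s t : E → V} {f : E → M} (hf : IsFlow s t f) (A : Finset V) :
    ∑ e with ¬ (s e ∈ A ↔ t e ∈ A), f e = 0 := by
  rw [← sum_bdry_cut]
  exact Finset.sum_eq_zero fun v _ => hf v

/-- A loop enters the boundary of its vertex twice and cancels. Hence contracted edges may keep
arbitrary values. -/
lemma bdry_congr_nonloop {s t : E → V} {f g : E → M} (h : ∀ e, s e ≠ t e → f e = g e) (v : V) :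
    bdry s t f v = bdry s t g v := by
  refine Finset.sum_congr rfl fun e _ => ?_
  by_cases he : s e = t e
  · simp only [he]
    split_ifs <;> simp [ZModModule.add_self]
  · rw [h e he]

lemma bdry_smul (s t : E → V) (g : E → ZMod 2) (c : M) (v : V) :
    bdry s t (fun e => g e • c) v = bdry s t g v • c :=
  bdry_map s t ((LinearMap.toSpanSingleton (ZMod 2) M c).toAddMonoidHom) g v

lemma Reach.exists_join {s t : E → V} {R : E → Prop} {a b : V} (h : Reach s t R a b) :
    ∃ g : E → ZMod 2, (∀ e, ¬ R e → g e = 0) ∧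
      ∀ v, bdry s t g v = (if v = a then 1 else 0) + (if v = b then 1 else 0) := by
  induction h with
  | refl => exact ⟨0, fun _ _ => rfl, fun v => by rw [bdry_zero, ZModModule.add_self]⟩
  | @tail b c _ hbc ih =>
    obtain ⟨e, he, hl⟩ := hbc
    obtain ⟨g, hg, hb⟩ := ih
    refine ⟨g + Pi.single e 1, fun e' he' => ?_, fun v => ?_⟩
    · have : e' ≠ e := by rintro rfl; exact he' he
      simp [hg e' he', Pi.single_eq_of_ne this]
    · rw [bdry_add, hb, bdry_single hl, add_add_add_comm, ← add_assoc, add_assoc (if v = a then 1 else 0)]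
      rw [show ((if v = b then 1 else 0) + ((if v = b then 1 else 0) : ZMod 2)) = 0 from
        ZModModule.add_self _]
      simp

/-- In a set of pairwise reachable vertices every boundary of total zero is realized. -/
lemma exists_bdry_eq {s t : E → V} {R : E → Prop} {A : Finset V}
    (hA : ∀ a ∈ A, ∀ b ∈ A, Reach s t R a b) (b : V → M) (hb : ∀ v ∉ A, b v = 0)
    (hsum : ∑ v ∈ A, b v = 0) :
    ∃ g : E → M, (∀ e, ¬ R e → g e = 0) ∧ ∀ v, bdry s t g v = b v := by
  rcases A.eq_empty_or_nonempty with rfl | ⟨a, ha⟩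
  · exact ⟨0, fun _ _ => rfl, fun v => by rw [bdry_zero, hb v (by simp)]⟩
  have : ∀ v : V, ∃ g : E → ZMod 2, (∀ e, ¬ R e → g e = 0) ∧ (v ∈ A →
      ∀ u, bdry s t g u = (if u = a then 1 else 0) + (if u = v then 1 else 0)) := by
    intro v
    by_cases hv : v ∈ A
    · obtain ⟨g, h1, h2⟩ := (hA a ha v hv).exists_join
      exact ⟨g, h1, fun _ => h2⟩
    · exact ⟨0, fun _ _ => rfl, fun h => absurd h hv⟩
  choose g hg hg' using this
  -- Send `b v` from the base vertex `a` to each `v` along the chosen path. What accumulates at the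
  -- start `a` is the total sum, which is zero.
  refine ⟨fun e => ∑ v ∈ A, g v e • b v, fun e he => ?_, fun u => ?_⟩
  · exact Finset.sum_eq_zero fun v _ => by rw [hg v e he, zero_smul]
  · rw [bdry_sum]
    calc ∑ v ∈ A, bdry s t (fun e => g v e • b v) u
        = ∑ v ∈ A, ((if u = a then b v else 0) + (if u = v then b v else 0)) := by
          refine Finset.sum_congr rfl fun v hv => ?_
          rw [bdry_smul, hg' v hv, add_smul]
          split_ifs <;> simp
      _ = b u := by
          rw [Finset.sum_add_distrib, Finset.sum_ite_eq]
          have : ∑ v ∈ A, (if u = a then b v else 0) = 0 := by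
            split_ifs
            · exact hsum
            · simp
          rw [this, zero_add]
          split_ifs with h
          · rfl
          · exact (hb u h).symm

/-- From a vertex with nonzero boundary one reaches another such vertex. -/
lemma exists_reach_of_bdry_ne_zero [Fintype V] (s t : E → V) (f : E → M) (a : V)
    (ha : bdry s t f a ≠ 0) :
    ∃ b ≠ a, Reach s t (fun e => f e ≠ 0) a b ∧ bdry s t f b ≠ 0 := by
  by_contra! hcon
  -- No edge of the support leaves the set `A` of vertices reached from `a`, so the boundary sums to
  -- zero over `A`. Its value at `a` cannot be the only nonzero term.
  set A : Finset V := Finset.univ.filter fun b => Reach s t (fun e => f e ≠ 0) a b with hAdef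
  have hsum : ∑ v ∈ A, bdry s t f v = bdry s t f a := by
    refine Finset.sum_eq_single a (fun b hb hne => hcon b hne ?_) (fun h => ?_)
    · simpa [hAdef] using hb
    · exact absurd (show a ∈ A by simp [hAdef]; exact .refl) h
  rw [sum_bdry_cut, Finset.sum_eq_zero] at hsum
  · exact ha hsum.symm
  · intro e he
    simp only [hAdef, Finset.mem_filter, Finset.mem_univ, true_and] at he
    by_contra hne
    exact he ⟨fun h => h.trans (.of_link hne (link_self s t e)),
      fun h => h.trans (.of_link hne (link_self s t e).symm)⟩

end CharTwo

end

end EdgeEnds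

/-! ### Extending Klein four-group flows over circuits of length at most four -/

namespace EdgeEnds

/-- The Klein four-group. -/
abbrev K4 := ZMod 2 × ZMod 2

namespace K4

lemma exists_avoid_two (a b : K4) : ∃ y : K4, y ≠ 0 ∧ y + a ≠ 0 ∧ y + b ≠ 0 := by
  revert a b; decide

-- The excluded values `0, a, a + b, a + b + c` leave no choice only if they are pairwise distinct.
-- This is the forbidden case, in which `c = a`.
set_option synthInstance.maxSize 1000 in
lemma exists_avoid_three (a b c : K4) (h : ¬ (a ≠ 0 ∧ b ≠ 0 ∧ a ≠ b ∧ c = a)) :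
    ∃ y : K4, y ≠ 0 ∧ y + a ≠ 0 ∧ y + a + b ≠ 0 ∧ y + a + b + c ≠ 0 := by
  revert h b c; revert a; decide

lemma add_cross (x y : K4) : x + y + (y + x) = 0 := by revert x y; decide

/-- For `w ≠ 0`, the functional on the Klein four-group with kernel `{0, w}`. -/
def func (w : K4) : K4 →+ ZMod 2 :=
  AddMonoidHom.coprod (AddMonoidHom.mulLeft w.2) (AddMonoidHom.mulLeft w.1)

lemma func_eq (w x : K4) : func w x = w.2 * x.1 + w.1 * x.2 := rfl

lemma func_add_ne_zero (x y : K4) (hx : x ≠ 0) (hy : y ≠ 0) (hxy : x ≠ y) :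
    func (x + y) y ≠ 0 := by
  simp only [func_eq]; revert x y; decide

/-- Values outside the kernel `{0, r}` of `func r` are interchanged by adding `r`, so they stay
nonzero. This makes a Kempe switch harmless. -/
lemma add_smul_eq_zero_iff (r x : K4) (c : ZMod 2) (h : func r x ≠ 0) :
    x + c • r = 0 ↔ x = 0 := by
  simp only [func_eq] at h; revert r x c; decide

end K4

noncomputable section

open scoped Classical

variable {V W W' E : Type*} [Fintype E]

/-- Two edges that lie in the same even edge sets. -/
def Series (s t : E → V) (e e' : E) : Prop :=
  ∀ g : E → ZMod 2, IsFlow s t g → g e = g e'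

lemma Series.trans {s t : E → V} {e e' e'' : E} (h : Series s t e e') (h' : Series s t e' e'') :
    Series s t e e'' := fun g hg => (h g hg).trans (h' g hg)

/-- Even sets stay even when vertices are identified, so every even set here is already tested in
the contraction. -/
lemma Series.comap [Fintype V] {s t : E → V} {e e' : E} {μ : V → W}
    (h : Series (μ ∘ s) (μ ∘ t) e e') : Series s t e e' := fun g hg => h g (hg.comp μ)

lemma Series.eq_K4 {s t : E → V} {e e' : E} (h : Series s t e e') {f : E → K4}
    (hf : IsFlow s t f) : f e = f e' :=
  Prod.ext (h _ (hf.map (AddMonoidHom.fst _ _))) (h _ (hf.map (AddMonoidHom.snd _ _)))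

/-- Every function that is balanced outside `Q` and vanishes on `K` extends to a flow that is
nowhere zero on `K`, without a change of the zero set outside `K`. -/
def Extends (s t : E → V) (Q : Finset V) (K : Finset E) : Prop :=
  ∀ f₀ : E → K4, (∀ e ∈ K, f₀ e = 0) → (∀ v ∉ Q, bdry s t f₀ v = 0) →
    ∃ f : E → K4, IsFlow s t f ∧ (∀ e ∉ K, f e = 0 ↔ f₀ e = 0) ∧ ∀ e ∈ K, f e ≠ 0

lemma sum_bdry_eq_zero_of_balanced [Fintype V] {s t : E → V} {Q : Finset V} {f : E → K4}
    (h : ∀ v ∉ Q, bdry s t f v = 0) : ∑ v ∈ Q, bdry s t f v = 0 := by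
  rw [← sum_bdry_univ s t f]
  exact Finset.sum_subset (Finset.subset_univ _) fun v _ hv => h v hv

/-- The value `y` of one edge determines the other. Each edge rules out one value of `y`, and two
edges cannot rule out all four. -/
lemma extends_digon [Fintype V] {s t : E → V} {a b : V} {e₁ e₂ : E} (hab : a ≠ b) (he : e₁ ≠ e₂)
    (h₁ : Link s t e₁ a b) (h₂ : Link s t e₂ a b) : Extends s t {a, b} {e₁, e₂} := by
  intro f₀ hK hQ
  have hsum := sum_bdry_eq_zero_of_balanced hQ
  rw [Finset.sum_pair hab] at hsum
  obtain ⟨y, hy0, hy1, -⟩ := K4.exists_avoid_two (bdry s t f₀ a) 0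
  have hK1 := hK e₁ (by simp)
  have hK2 := hK e₂ (by simp)
  refine ⟨f₀ + Pi.single e₁ y + Pi.single e₂ (y + bdry s t f₀ a), fun v => ?_, fun e he' => ?_,
    fun e he' => ?_⟩
  · rw [bdry_add, bdry_add, bdry_single h₁, bdry_single h₂]
    by_cases hva : v = a
    · subst hva
      simp only [if_true, if_neg hab, add_zero]
      exact K4.add_cross _ _
    · by_cases hvb : v = b
      · subst hvb
        simp only [if_true, if_neg hva, zero_add]
        rw [eq_of_add_eq_zero_two hsum]
        exact K4.add_cross _ _
      · simp [hva, hvb, hQ v (by simp [hva, hvb])]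
  · simp only [Finset.mem_insert, Finset.mem_singleton, not_or] at he'
    simp [Pi.single_eq_of_ne he'.1, Pi.single_eq_of_ne he'.2]
  · simp only [Finset.mem_insert, Finset.mem_singleton] at he'
    rcases he' with rfl | rfl
    · simpa [hK1, Pi.single_eq_of_ne he] using hy0
    · simpa [hK2, Pi.single_eq_of_ne he.symm] using hy1

/-- Balance determines the values from the value `y` of one edge. Three edges rule out at most three
of the four choices of `y`. -/
lemma extends_triangle [Fintype V] {s t : E → V} {a b c : V} {e₁ e₂ e₃ : E}
    (hab : a ≠ b) (hbc : b ≠ c) (hac : a ≠ c)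
    (h₁ : Link s t e₁ a b) (h₂ : Link s t e₂ b c) (h₃ : Link s t e₃ c a)
    (h12 : e₁ ≠ e₂) (h23 : e₂ ≠ e₃) (h13 : e₁ ≠ e₃) :
    Extends s t {a, b, c} {e₁, e₂, e₃} := by
  intro f₀ hK hQ
  have hsum := sum_bdry_eq_zero_of_balanced hQ
  rw [Finset.sum_insert (by simp [hab, hac]), Finset.sum_pair hbc] at hsum
  obtain ⟨y, hy0, hy1, hy2⟩ := K4.exists_avoid_two (bdry s t f₀ b) (bdry s t f₀ a)
  have hK1 := hK e₁ (by simp)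
  have hK2 := hK e₂ (by simp)
  have hK3 := hK e₃ (by simp)
  refine ⟨f₀ + Pi.single e₁ y + Pi.single e₂ (y + bdry s t f₀ b) +
    Pi.single e₃ (y + bdry s t f₀ a), fun v => ?_, fun e he' => ?_, fun e he' => ?_⟩
  · rw [bdry_add, bdry_add, bdry_add, bdry_single h₁, bdry_single h₂, bdry_single h₃]
    by_cases hva : v = a
    · subst hva
      simp only [if_true, if_neg hab, if_neg hac, add_zero, zero_add]
      exact K4.add_cross _ _
    by_cases hvb : v = b
    · subst hvb
      simp only [if_true, if_neg hva, if_neg hbc, zero_add, add_zero]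
      exact K4.add_cross _ _
    by_cases hvc : v = c
    · subst hvc
      simp only [if_true, if_neg hva, if_neg hvb, zero_add, add_zero]
      revert hsum
      generalize bdry s t f₀ v = x1
      generalize bdry s t f₀ b = x2
      generalize bdry s t f₀ a = x3
      clear hy0 hy1 hy2
      revert x1 x2 x3 y; decide
    · simp [hva, hvb, hvc, hQ v (by simp [hva, hvb, hvc])]
  · simp only [Finset.mem_insert, Finset.mem_singleton, not_or] at he'
    simp [Pi.single_eq_of_ne he'.1, Pi.single_eq_of_ne he'.2.1, Pi.single_eq_of_ne he'.2.2]
  · simp only [Finset.mem_insert, Finset.mem_singleton] at he'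
    rcases he' with rfl | rfl | rfl
    · simpa [hK1, Pi.single_eq_of_ne h12, Pi.single_eq_of_ne h13] using hy0
    · simpa [hK2, Pi.single_eq_of_ne h12.symm, Pi.single_eq_of_ne h23] using hy1
    · simpa [hK3, Pi.single_eq_of_ne h23.symm, Pi.single_eq_of_ne h13.symm] using hy2

/-- A Kempe switch: a function whose boundary alternates between two values `p`, `q` around four
vertices can be changed, without a change of its zero set, so that this is no longer so. -/
lemma exists_kempe_switch [Fintype V] {s t : E → V} {a b c d : V}
    (hab : a ≠ b) (hac : a ≠ c) (had : a ≠ d) (hbd' : b ≠ d)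
    (f₀ : E → K4) (hQ : ∀ v ∉ ({a, b, c, d} : Finset V), bdry s t f₀ v = 0)
    (hb0 : bdry s t f₀ b ≠ 0) (hc0 : bdry s t f₀ c ≠ 0)
    (hbc : bdry s t f₀ b ≠ bdry s t f₀ c) (hbd : bdry s t f₀ d = bdry s t f₀ b)
    (ha : bdry s t f₀ a = bdry s t f₀ c) :
    ∃ f₁ : E → K4, (∀ e, f₁ e = 0 ↔ f₀ e = 0) ∧
      (∀ v ∉ ({a, b, c, d} : Finset V), bdry s t f₁ v = 0) ∧
      ¬ (bdry s t f₁ b ≠ 0 ∧ bdry s t f₁ c ≠ 0 ∧ bdry s t f₁ b ≠ bdry s t f₁ c ∧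
        bdry s t f₁ d = bdry s t f₁ b) := by
  -- `func r` kills `0` and `r`, so it singles out the edges with one of the other two values. The
  -- chain of such edges from `a` must end at another of the four vertices, and `r` is added along
  -- it.
  set r : K4 := bdry s t f₀ b + bdry s t f₀ c with hr
  have hr0 : r ≠ 0 := fun h => hbc (eq_of_add_eq_zero_two h)
  obtain ⟨v, hva, hreach, hvne⟩ :=
    exists_reach_of_bdry_ne_zero s t (fun e => K4.func r (f₀ e)) a (by
      rw [bdry_map, ha]; exact K4.func_add_ne_zero _ _ hb0 hc0 hbc)
  have hvQ : v ∈ ({a, b, c, d} : Finset V) := by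
    by_contra hv
    rw [bdry_map, hQ v hv, map_zero] at hvne
    exact hvne rfl
  obtain ⟨g, hg0, hg⟩ := hreach.exists_join
  have hbd₁ : ∀ u, bdry s t (f₀ + fun e => g e • r) u =
      bdry s t f₀ u + ((if u = a then 1 else 0) + (if u = v then 1 else 0) : ZMod 2) • r := by
    intro u; rw [bdry_add, bdry_smul, hg]
  refine ⟨f₀ + fun e => g e • r, fun e => ?_, fun u hu => ?_, ?_⟩
  · by_cases h : K4.func r (f₀ e) = 0
    · simp [hg0 e (by simpa using h)]
    · exact K4.add_smul_eq_zero_iff _ _ _ h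
  · rw [hbd₁, hQ u hu]
    have h1 : u ≠ a := by rintro rfl; simp at hu
    have h2 : u ≠ v := by rintro rfl; exact hu hvQ
    simp [h1, h2]
  · simp only [hbd₁, hbd, if_neg hab.symm, if_neg hac.symm, if_neg had.symm, zero_add]
    -- If the chain ends at `b` or `d`, the boundaries of `b` and `d` become different. If it ends
    -- at `c`, those of `b` and `c` become equal.
    have hv' : v = b ∨ v = c ∨ v = d := by simpa [hva] using hvQ
    have hr' := hr0
    rw [hr] at hr' ⊢
    rintro ⟨-, -, h3, h4⟩
    rcases hv' with rfl | rfl | rfl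
    · rw [if_pos rfl, if_neg hbd'.symm, zero_smul, one_smul, add_zero] at h4
      exact hr' (by simpa using h4.symm)
    · have hne : b ≠ v := fun h => hbc (by rw [h])
      rw [if_pos rfl, if_neg hne, zero_smul, one_smul, add_zero, ← add_assoc, add_right_comm,
        ZModModule.add_self, zero_add] at h3
      exact h3 rfl
    · rw [if_pos rfl, if_neg hbd', zero_smul, one_smul, add_zero] at h4
      exact hr' (by simpa using h4)

/-- Again one value `y` determines the others, but four edges may rule out all four values. This
happens only if the boundaries alternate between two distinct nonzero values around the circuit, and
a Kempe switch destroys that pattern. -/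
lemma extends_quad [Fintype V] {s t : E → V} {a b c d : V} {e₁ e₂ e₃ e₄ : E}
    (hab : a ≠ b) (hac : a ≠ c) (had : a ≠ d) (hbc : b ≠ c) (hbd : b ≠ d) (hcd : c ≠ d)
    (h₁ : Link s t e₁ a b) (h₂ : Link s t e₂ b c) (h₃ : Link s t e₃ c d) (h₄ : Link s t e₄ d a) :
    Extends s t {a, b, c, d} {e₁, e₂, e₃, e₄} := by
  have hne : ∀ {e e' : E} {p q p' q' : V}, Link s t e p q → Link s t e' p' q' →
      ¬ ((p = p' ∧ q = q') ∨ (p = q' ∧ q = p')) → e ≠ e' := by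
    rintro e e' p q p' q' h h' hn rfl
    rcases h with ⟨rfl, rfl⟩ | ⟨rfl, rfl⟩ <;> rcases h' with ⟨rfl, rfl⟩ | ⟨rfl, rfl⟩ <;> simp at hn
  have h12 := hne h₁ h₂ (by tauto)
  have h13 := hne h₁ h₃ (by tauto)
  have h14 := hne h₁ h₄ (by tauto)
  have h23 := hne h₂ h₃ (by tauto)
  have h24 := hne h₂ h₄ (by tauto)
  have h34 := hne h₃ h₄ (by tauto)
  intro f₀ hK hQ
  have hsumof : ∀ f : E → K4, (∀ v ∉ ({a, b, c, d} : Finset V), bdry s t f v = 0) →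
      bdry s t f a = bdry s t f b + bdry s t f c + bdry s t f d := by
    intro f hf
    have hsum := sum_bdry_eq_zero_of_balanced hf
    rw [Finset.sum_insert (by simp [hab, hac, had]), Finset.sum_insert (by simp [hbc, hbd]),
      Finset.sum_pair hcd] at hsum
    rw [eq_of_add_eq_zero_two hsum, add_assoc]
  obtain ⟨f₁, hz, hQ₁, hgood⟩ : ∃ f₁ : E → K4, (∀ e, f₁ e = 0 ↔ f₀ e = 0) ∧
      (∀ v ∉ ({a, b, c, d} : Finset V), bdry s t f₁ v = 0) ∧
      ¬ (bdry s t f₁ b ≠ 0 ∧ bdry s t f₁ c ≠ 0 ∧ bdry s t f₁ b ≠ bdry s t f₁ c ∧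
        bdry s t f₁ d = bdry s t f₁ b) := by
    by_cases hg : (bdry s t f₀ b ≠ 0 ∧ bdry s t f₀ c ≠ 0 ∧ bdry s t f₀ b ≠ bdry s t f₀ c ∧
        bdry s t f₀ d = bdry s t f₀ b)
    · obtain ⟨hb0, hc0, hbc', hbd'⟩ := hg
      refine exists_kempe_switch hab hac had hbd f₀ hQ hb0 hc0 hbc' hbd' ?_
      rw [hsumof f₀ hQ, hbd', add_right_comm, ZModModule.add_self, zero_add]
    · exact ⟨f₀, fun _ => Iff.rfl, hQ, hg⟩
  obtain ⟨y, hy0, hy1, hy2, hy3⟩ := K4.exists_avoid_three _ _ _ hgood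
  have hK1 := (hz e₁).2 (hK e₁ (by simp))
  have hK2 := (hz e₂).2 (hK e₂ (by simp))
  have hK3 := (hz e₃).2 (hK e₃ (by simp))
  have hK4 := (hz e₄).2 (hK e₄ (by simp))
  have hsum := hsumof f₁ hQ₁
  refine ⟨f₁ + Pi.single e₁ y + Pi.single e₂ (y + bdry s t f₁ b) +
    Pi.single e₃ (y + bdry s t f₁ b + bdry s t f₁ c) +
    Pi.single e₄ (y + bdry s t f₁ b + bdry s t f₁ c + bdry s t f₁ d), fun v => ?_,
    fun e he' => ?_, fun e he' => ?_⟩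
  · rw [bdry_add, bdry_add, bdry_add, bdry_add, bdry_single h₁, bdry_single h₂, bdry_single h₃,
      bdry_single h₄]
    by_cases hva : v = a
    · subst hva
      simp only [if_true, if_neg hab, if_neg hac, if_neg had, add_zero, zero_add, hsum]
      rw [show ∀ p q r : K4, p + q + r + y + (y + p + q + r) = p + q + r + y + (y + (p + q + r))
        from fun p q r => by abel]
      exact K4.add_cross _ _
    by_cases hvb : v = b
    · subst hvb
      simp only [if_true, if_neg hva, if_neg hbc, if_neg hbd, zero_add, add_zero]
      exact K4.add_cross _ _
    by_cases hvc : v = c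
    · subst hvc
      simp only [if_true, if_neg hva, if_neg hvb, if_neg hcd, zero_add, add_zero]
      exact K4.add_cross _ _
    by_cases hvd : v = d
    · subst hvd
      simp only [if_true, if_neg hva, if_neg hvb, if_neg hvc, zero_add, add_zero]
      exact K4.add_cross _ _
    · simp [hva, hvb, hvc, hvd, hQ₁ v (by simp [hva, hvb, hvc, hvd])]
  · simp only [Finset.mem_insert, Finset.mem_singleton, not_or] at he'
    simp [Pi.single_eq_of_ne he'.1, Pi.single_eq_of_ne he'.2.1, Pi.single_eq_of_ne he'.2.2.1,
      Pi.single_eq_of_ne he'.2.2.2, hz]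
  · simp only [Finset.mem_insert, Finset.mem_singleton] at he'
    rcases he' with rfl | rfl | rfl | rfl
    · simpa [hK1, Pi.single_eq_of_ne h12, Pi.single_eq_of_ne h13, Pi.single_eq_of_ne h14] using hy0
    · simpa [hK2, Pi.single_eq_of_ne h12.symm, Pi.single_eq_of_ne h23,
        Pi.single_eq_of_ne h24] using hy1
    · simpa [hK3, Pi.single_eq_of_ne h23.symm, Pi.single_eq_of_ne h13.symm,
        Pi.single_eq_of_ne h34] using hy2
    · simpa [hK4, Pi.single_eq_of_ne h24.symm, Pi.single_eq_of_ne h14.symm,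
        Pi.single_eq_of_ne h34.symm] using hy3

end

end EdgeEnds

/-! ### Irreducible graphs: counting leads to the Petersen graph -/

namespace EdgeEnds

/-- The vertices of the Petersen graph: a claw with centre `z` and leaves `m i`, a vertex `l i`
attached to `m i`, and three further vertices `x i`. -/
inductive PV : Type
  | z : PV
  | m : Fin 3 → PV
  | l : Fin 3 → PV
  | x : Fin 3 → PV
  deriving DecidableEq, Fintype

namespace PV

/-- Adjacency in the Petersen graph. -/
def Adj : PV → PV → Prop
  | z, m _ => True
  | m _, z => True
  | m i, l j => i = j
  | l i, m j => i = j
  | m i, x j => i = j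
  | x i, m j => i = j
  | l i, x j => i ≠ j
  | x i, l j => i ≠ j
  | _, _ => False

instance : DecidableRel Adj := fun a b => by
  cases a <;> cases b <;> simp only [Adj] <;> infer_instance

end PV

noncomputable section

open scoped Classical

variable {W : Type*}

/-- The properties of a graph with a feedback vertex set `X` of at most three vertices in which
none of the reductions of circuits of length at most four and of vertices of degree two applies. -/
structure Irreducible [Fintype W] (Γ : SimpleGraph W) (X : Finset W) : Prop where
  card_le : X.card ≤ 3
  triangle : ∀ a b c, Γ.Adj a b → Γ.Adj b c → ¬ Γ.Adj a c
  quad : ∀ a b c d, a ≠ c → b ≠ d → Γ.Adj a b → Γ.Adj b c → Γ.Adj c d → ¬ Γ.Adj d a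
  three_le_degree : ∀ w ∉ X, 3 ≤ (Finset.univ.filter fun u => Γ.Adj w u).card
  two_le_degree : ∀ w, 2 ≤ (Finset.univ.filter fun u => Γ.Adj w u).card
  forest : ∀ U : Finset W, U.Nonempty → Disjoint U X →
    ∑ w ∈ U, (U.filter fun u => Γ.Adj w u).card + 2 ≤ 2 * U.card

namespace Irreducible

variable {Γ : SimpleGraph W} {X : Finset W}

/-- The neighbours in `X`. -/
def nbrX (Γ : SimpleGraph W) (X : Finset W) (w : W) : Finset W := X.filter fun u => Γ.Adj w u

lemma mem_nbrX {w u : W} : u ∈ nbrX Γ X w ↔ u ∈ X ∧ Γ.Adj w u := by simp [nbrX]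

variable [Fintype W]

/-- The neighbours outside `X`. -/
def nbrF (Γ : SimpleGraph W) (X : Finset W) (w : W) : Finset W := Xᶜ.filter fun u => Γ.Adj w u

lemma mem_nbrF {w u : W} : u ∈ nbrF Γ X w ↔ u ∉ X ∧ Γ.Adj w u := by simp [nbrF]

lemma card_nbr (w : W) : (nbrX Γ X w).card + (nbrF Γ X w).card =
    (Finset.univ.filter fun u => Γ.Adj w u).card := by
  rw [← Finset.card_union_of_disjoint]
  · congr 1
    ext u
    simp only [Finset.mem_union, mem_nbrX, mem_nbrF, Finset.mem_filter, Finset.mem_univ, true_and]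
    tauto
  · rw [Finset.disjoint_left]
    intro u hu hu'
    exact (mem_nbrF.1 hu').1 (mem_nbrX.1 hu).1

lemma three_le (h : Irreducible Γ X) {w : W} (hw : w ∉ X) :
    3 ≤ (nbrX Γ X w).card + (nbrF Γ X w).card := by
  rw [card_nbr]; exact h.three_le_degree w hw

/-- Two vertices have at most one common neighbour. -/
lemma common (h : Irreducible Γ X) {w w' a b : W} (hne : w ≠ w') (ha : Γ.Adj w a)
    (ha' : Γ.Adj w' a) (hb : Γ.Adj w b) (hb' : Γ.Adj w' b) : a = b := by
  by_contra hab
  exact h.quad a w b w' hab hne ha.symm hb hb'.symm ha'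

/-- Without triangles and 4-circuits the neighbourhoods in `X` of `w` and of its neighbours outside
`X` are pairwise disjoint, and `X` has only three places. -/
lemma sum_nbrX_le (h : Irreducible Γ X) {w : W} (hw : w ∉ X) :
    (nbrX Γ X w).card + ∑ u ∈ nbrF Γ X w, (nbrX Γ X u).card ≤ 3 := by
  rw [← Finset.card_biUnion, ← Finset.card_union_of_disjoint]
  · refine le_trans (Finset.card_le_card ?_) h.card_le
    intro u hu
    simp only [Finset.mem_union, Finset.mem_biUnion, mem_nbrX] at hu
    rcases hu with hu | ⟨_, _, hu⟩ <;> exact hu.1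
  · rw [Finset.disjoint_left]
    intro u hu hu'
    simp only [Finset.mem_biUnion, mem_nbrX, mem_nbrF] at hu hu'
    obtain ⟨a, ha, hau⟩ := hu'
    exact h.triangle w a u ha.2 hau.2 hu.2
  · intro a ha b hb hab
    rw [Function.onFun, Finset.disjoint_left]
    intro u hu hu'
    simp only [Finset.mem_coe, mem_nbrX, mem_nbrF] at ha hb hu hu'
    have := h.common hab ha.2.symm hb.2.symm hu.2 hu'.2
    subst this
    exact hw hu.1

/-- A pair in `X` has at most one common neighbour, and `X` contains at most three pairs. -/
lemma sum_choose_le (h : Irreducible Γ X) :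
    ∑ w ∈ Xᶜ, (nbrX Γ X w).card.choose 2 ≤ 3 := by
  have : ∀ w, (nbrX Γ X w).card.choose 2 = ((nbrX Γ X w).powersetCard 2).card := fun w =>
    (Finset.card_powersetCard _ _).symm
  simp only [this]
  rw [← Finset.card_biUnion]
  · calc _ ≤ (X.powersetCard 2).card := by
          refine Finset.card_le_card fun S hS => ?_
          simp only [Finset.mem_biUnion, Finset.mem_powersetCard] at hS ⊢
          obtain ⟨w, _, hS, h2⟩ := hS
          exact ⟨hS.trans (Finset.filter_subset _ _), h2⟩
      _ = X.card.choose 2 := Finset.card_powersetCard _ _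
      _ ≤ Nat.choose 3 2 := Nat.choose_le_choose 2 h.card_le
      _ = 3 := by decide
  · intro a _ b _ hab
    rw [Function.onFun, Finset.disjoint_left]
    intro S hS hS'
    simp only [Finset.mem_powersetCard] at hS hS'
    obtain ⟨p, q, hpq, rfl⟩ := Finset.card_eq_two.1 hS.2
    have hp := (mem_nbrX.1 (hS.1 (by simp : p ∈ ({p, q} : Finset W)))).2
    have hq := (mem_nbrX.1 (hS.1 (by simp : q ∈ ({p, q} : Finset W)))).2
    have hp' := (mem_nbrX.1 (hS'.1 (by simp : p ∈ ({p, q} : Finset W)))).2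
    have hq' := (mem_nbrX.1 (hS'.1 (by simp : q ∈ ({p, q} : Finset W)))).2
    exact hpq (h.common hab hp hp' hq hq')

/-- The number of vertices outside `X` with `i` neighbours in `X`. -/
def num (Γ : SimpleGraph W) (X : Finset W) (i : ℕ) : ℕ :=
  (Xᶜ.filter fun w => (nbrX Γ X w).card = i).card

lemma card_nbrX_le (h : Irreducible Γ X) (w : W) : (nbrX Γ X w).card ≤ 3 :=
  (Finset.card_le_card (Finset.filter_subset _ _)).trans h.card_le

lemma num_le (h : Irreducible Γ X) : num Γ X 2 + 3 * num Γ X 3 ≤ 3 := by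
  refine le_trans (le_of_eq ?_) h.sum_choose_le
  rw [num, num, Finset.card_filter, Finset.card_filter, Finset.mul_sum, ← Finset.sum_add_distrib]
  refine Finset.sum_congr rfl fun w _ => ?_
  have := h.card_nbrX_le w
  interval_cases (nbrX Γ X w).card <;> simp [Nat.choose]

/-- Termwise, a number that is at most three equals `1`, corrected by `-1` at `0`, by `+1` at `2`
and by `+2` at `3`. -/
lemma sum_card_nbrX (h : Irreducible Γ X) :
    ∑ w ∈ Xᶜ, (nbrX Γ X w).card + num Γ X 0 = Xᶜ.card + num Γ X 2 + 2 * num Γ X 3 := by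
  rw [num, num, num, Finset.card_filter, Finset.card_filter, Finset.card_filter, Finset.mul_sum,
    Finset.card_eq_sum_ones, ← Finset.sum_add_distrib, ← Finset.sum_add_distrib,
    ← Finset.sum_add_distrib]
  refine Finset.sum_congr rfl fun w _ => ?_
  have := h.card_nbrX_le w
  interval_cases (nbrX Γ X w).card <;> simp

lemma sum_card_nbrF_le (h : Irreducible Γ X) (hne : Xᶜ.Nonempty) :
    ∑ w ∈ Xᶜ, (nbrF Γ X w).card + 2 ≤ 2 * Xᶜ.card :=
  h.forest Xᶜ hne disjoint_compl_left

/-- If outside of `X` the vertices off `S` send no edge to `S` and have at least two neighbours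
outside `X`, then there are none. -/
lemma compl_subset (h : Irreducible Γ X) (S : Finset W)
    (hS : ∀ w ∉ X, w ∉ S → 2 ≤ (nbrF Γ X w).card ∧ ∀ u ∈ nbrF Γ X w, u ∉ S) : Xᶜ ⊆ S := by
  by_contra hcon
  have hne : (Xᶜ \ S).Nonempty := by rwa [Finset.sdiff_nonempty]
  have hf := h.forest (Xᶜ \ S) hne
    (Finset.disjoint_of_subset_left Finset.sdiff_subset disjoint_compl_left)
  have : ∑ w ∈ Xᶜ \ S, 2 ≤ ∑ w ∈ Xᶜ \ S, ((Xᶜ \ S).filter fun u => Γ.Adj w u).card := by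
    refine Finset.sum_le_sum fun w hw => ?_
    simp only [Finset.mem_sdiff, Finset.mem_compl] at hw
    obtain ⟨h2, hS'⟩ := hS w hw.1 hw.2
    refine h2.trans (Finset.card_le_card fun u hu => ?_)
    have := hS' u hu
    rw [mem_nbrF] at hu
    simp [hu, this]
  rw [Finset.sum_const, smul_eq_mul] at this
  omega

/-- Degrees of at least three, set against the forest bound, give `num 0 + 2 ≤ num 2 + 2 * num 3`.
With `num_le`, a vertex `w` with three neighbours in `X` then forces `num 3 = 1` and `num 0 = num 2
= 0`. Such a `w` has no neighbour outside `X`. Other vertices outside `X` would span minimum degree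
two in a forest, so `w` is alone there and its neighbours in `X` have degree one. -/
lemma num_three (h : Irreducible Γ X) : num Γ X 3 = 0 := by
  by_contra h3
  have h1 := h.num_le
  obtain ⟨w, hw⟩ := Finset.card_pos.1 (Nat.pos_of_ne_zero h3)
  simp only [Finset.mem_filter, Finset.mem_compl] at hw
  have hsum := h.sum_card_nbrX
  have hforest := h.sum_card_nbrF_le ⟨w, by simpa using hw.1⟩
  have hdeg : ∑ w ∈ Xᶜ, 3 ≤ ∑ w ∈ Xᶜ, ((nbrX Γ X w).card + (nbrF Γ X w).card) :=
    Finset.sum_le_sum fun w hw => h.three_le (by simpa using hw)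
  rw [Finset.sum_const, smul_eq_mul, Finset.sum_add_distrib] at hdeg
  have hn0 : num Γ X 0 = 0 := by omega
  have hn2 : num Γ X 2 = 0 := by omega
  have hn3 : num Γ X 3 = 1 := by omega
  have hpos : ∀ u ∉ X, u ≠ w → (nbrX Γ X u).card = 1 := by
    intro u hu huw
    have h0 : (nbrX Γ X u).card ≠ 0 := fun hc =>
      Finset.eq_empty_iff_forall_notMem.1 (Finset.card_eq_zero.1 hn0) u
        (by simp [hu, Finset.card_eq_zero.1 hc])
    have h2 : (nbrX Γ X u).card ≠ 2 := fun hc =>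
      Finset.eq_empty_iff_forall_notMem.1 (Finset.card_eq_zero.1 hn2) u (by simp [hu, hc])
    have h3 : (nbrX Γ X u).card ≠ 3 := fun hc => by
      rw [num] at hn3
      exact huw (Finset.card_le_one.1 hn3.le u (by simp [hu, hc]) w (by simp [hw]))
    have := h.card_nbrX_le u
    omega
  have hFw : ∀ u, u ∉ X → ¬ Γ.Adj w u := by
    intro u hu hadj
    have hs := h.sum_nbrX_le hw.1
    have := Finset.single_le_sum (f := fun u => (nbrX Γ X u).card) (fun _ _ => Nat.zero_le _)
      (mem_nbrF.2 ⟨hu, hadj⟩)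
    have h1 := hpos u hu hadj.ne'
    omega
  have hF : Xᶜ ⊆ {w} := by
    refine h.compl_subset {w} fun u hu huw => ?_
    rw [Finset.mem_singleton] at huw
    have := h.three_le hu
    rw [hpos u hu huw] at this
    refine ⟨by omega, fun a ha haw => ?_⟩
    rw [Finset.mem_singleton] at haw
    subst haw
    exact hFw u hu (mem_nbrF.1 ha).2.symm
  have hX : nbrX Γ X w = X := by
    refine Finset.eq_of_subset_of_card_le (Finset.filter_subset _ _) ?_
    rw [hw.2]; exact h.card_le
  obtain ⟨x, hx⟩ : (nbrX Γ X w).Nonempty := by rw [← Finset.card_pos]; omega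
  rw [mem_nbrX] at hx
  have h2 := h.two_le_degree x
  have : (Finset.univ.filter fun u => Γ.Adj x u).card ≤ ({w} : Finset W).card := by
    refine Finset.card_le_card fun u hu => ?_
    simp only [Finset.mem_filter, Finset.mem_univ, true_and] at hu
    by_cases huX : u ∈ X
    · rw [← hX, mem_nbrX] at huX
      exact (h.triangle w x u hx.2 hu huX.2).elim
    · exact hF (by simpa using huX)
  simp at this
  omega

/-- The vertex with no neighbour in `X`, and the degrees outside `X`. -/
lemma exists_center (h : Irreducible Γ X) (hne : Xᶜ.Nonempty) :
    ∃ z ∉ X, (∀ u ∉ X, (nbrX Γ X u).card = 0 ↔ u = z) ∧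
      (∀ u ∉ X, (nbrX Γ X u).card + (nbrF Γ X u).card = 3) ∧ num Γ X 2 = 3 := by
  have h3 := h.num_three
  have h1 := h.num_le
  have hsum := h.sum_card_nbrX
  have hforest := h.sum_card_nbrF_le hne
  have hdeg : ∑ w ∈ Xᶜ, 3 ≤ ∑ w ∈ Xᶜ, ((nbrX Γ X w).card + (nbrF Γ X w).card) :=
    Finset.sum_le_sum fun w hw => h.three_le (by simpa using hw)
  have hle2 : ∀ u ∉ X, (nbrX Γ X u).card ≤ 2 := by
    intro u hu
    have h3' : (nbrX Γ X u).card ≠ 3 := fun hc =>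
      Finset.eq_empty_iff_forall_notMem.1 (Finset.card_eq_zero.1 h3) u (by simp [hu, hc])
    have := h.card_nbrX_le u
    omega
  -- A leaf of the forest; by its degree it has exactly two neighbours in `X`.
  obtain ⟨l, hlX, hl⟩ : ∃ l ∉ X, (nbrF Γ X l).card ≤ 1 := by
    by_contra! hcon
    have : ∑ w ∈ Xᶜ, 2 ≤ ∑ w ∈ Xᶜ, (nbrF Γ X w).card :=
      Finset.sum_le_sum fun w hw => hcon w (by simpa using hw)
    rw [Finset.sum_const, smul_eq_mul] at this
    omega
  have hl3 := h.three_le hlX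
  have hl2 := hle2 l hlX
  obtain ⟨u, hu⟩ : (nbrF Γ X l).Nonempty := by rw [← Finset.card_pos]; omega
  rw [mem_nbrF] at hu
  -- In `sum_nbrX_le` at `u` the leaf `l` uses up two of the three places. So `u` itself, or another
  -- neighbour of `u` in the forest, has no neighbour in `X`.
  have hn0 : num Γ X 0 ≠ 0 := by
    rw [num, Finset.card_ne_zero]
    have hs := h.sum_nbrX_le hu.1
    have hlu : l ∈ nbrF Γ X u := mem_nbrF.2 ⟨hlX, hu.2.symm⟩
    rw [← Finset.add_sum_erase _ _ hlu] at hs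
    by_cases hu0 : (nbrX Γ X u).card = 0
    · exact ⟨u, by simp [hu.1, Finset.card_eq_zero.1 hu0]⟩
    · have := h.three_le hu.1
      have h2u := hle2 u hu.1
      have hcard := Finset.card_erase_of_mem hlu
      obtain ⟨v, hv⟩ : ((nbrF Γ X u).erase l).Nonempty := by rw [← Finset.card_pos]; omega
      have hle := Finset.single_le_sum (f := fun u => (nbrX Γ X u).card)
        (fun _ _ => Nat.zero_le _) hv
      rw [Finset.mem_erase, mem_nbrF] at hv
      exact ⟨v, by simp only [Finset.mem_filter, Finset.mem_compl]; exact ⟨hv.2.1, by omega⟩⟩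
  -- With `num 0 ≥ 1` and `num 2 ≤ 3` all estimates are sharp, so the degrees outside `X` are
  -- exactly three.
  have heq : ∑ w ∈ Xᶜ, 3 = ∑ w ∈ Xᶜ, ((nbrX Γ X w).card + (nbrF Γ X w).card) := by
    refine le_antisymm hdeg ?_
    rw [Finset.sum_const, smul_eq_mul, Finset.sum_add_distrib]
    omega
  have heq' := (Finset.sum_eq_sum_iff_of_le
    fun w hw => h.three_le (w := w) (by simpa using hw)).1 heq
  rw [Finset.sum_const, smul_eq_mul, Finset.sum_add_distrib] at hdeg
  have h01 : num Γ X 0 = 1 := by omega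
  obtain ⟨z, hz⟩ := Finset.card_eq_one.1 h01
  have hzmem : ∀ u, (u ∉ X ∧ (nbrX Γ X u).card = 0) ↔ u = z := by
    intro u
    have := Finset.ext_iff.1 hz u
    rwa [Finset.mem_filter, Finset.mem_compl, Finset.mem_singleton] at this
  refine ⟨z, ((hzmem z).2 rfl).1, fun u hu => ?_, fun u hu => (heq' u (by simpa using hu)).symm,
    by omega⟩
  rw [← hzmem u]
  tauto

/-- At the forest neighbour `m` of `l` only one of the three places in `X` is left beside the two of
`l`. If `m` were `z`, its two other neighbours would need one place each. Hence `m` takes the last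
place itself, and its remaining neighbour has none, so it is `z`. -/
lemma exists_mid (h : Irreducible Γ X) {z : W} (hz : z ∉ X)
    (hz0 : ∀ u ∉ X, (nbrX Γ X u).card = 0 ↔ u = z)
    (hdeg : ∀ u ∉ X, (nbrX Γ X u).card + (nbrF Γ X u).card = 3) {l : W} (hl : l ∉ X)
    (hl2 : (nbrX Γ X l).card = 2) :
    ∃ m, m ∉ X ∧ (nbrX Γ X m).card = 1 ∧ nbrF Γ X l = {m} ∧ nbrF Γ X m = {l, z} ∧ l ≠ z := by
  have hlz : l ≠ z := fun hc => by
    have := (hz0 l hl).2 hc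
    omega
  obtain ⟨m, hm⟩ := Finset.card_eq_one.1 (show (nbrF Γ X l).card = 1 by have := hdeg l hl; omega)
  have hlm : m ∈ nbrF Γ X l := by rw [hm]; simp
  rw [mem_nbrF] at hlm
  have hml : l ∈ nbrF Γ X m := mem_nbrF.2 ⟨hl, hlm.2.symm⟩
  have hs := h.sum_nbrX_le hlm.1
  rw [← Finset.add_sum_erase _ _ hml, hl2] at hs
  have hcard := Finset.card_erase_of_mem hml
  have hdm := hdeg m hlm.1
  have hmz : m ≠ z := by
    rintro rfl
    have h0 := (hz0 m hz).2 rfl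
    have : ∑ x ∈ (nbrF Γ X m).erase l, 1 ≤ ∑ x ∈ (nbrF Γ X m).erase l, (nbrX Γ X x).card := by
      refine Finset.sum_le_sum fun x hx => ?_
      rw [Finset.mem_erase, mem_nbrF] at hx
      have := mt (hz0 x hx.2.1).1 hx.2.2.ne'
      omega
    rw [Finset.sum_const, smul_eq_mul] at this
    omega
  have hm0 := mt (hz0 m hlm.1).1 hmz
  have hm1 : (nbrX Γ X m).card = 1 := by omega
  obtain ⟨v, hv⟩ := Finset.card_eq_one.1 (show ((nbrF Γ X m).erase l).card = 1 by omega)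
  have hvm : v ∈ (nbrF Γ X m).erase l := by rw [hv]; simp
  have hvz : v = z := by
    rw [hv, Finset.sum_singleton] at hs
    rw [Finset.mem_erase, mem_nbrF] at hvm
    exact (hz0 v hvm.2.1).1 (by omega)
  subst hvz
  exact ⟨m, hlm.1, hm1, hm, by rw [← Finset.insert_erase hml, hv], hlz⟩

/-- An irreducible graph has no vertex outside `X`, or it is the Petersen graph. -/
lemma exists_equiv (h : Irreducible Γ X) (hne : Xᶜ.Nonempty) :
    ∃ φ : PV ≃ W, (∀ p q, Γ.Adj (φ p) (φ q) ↔ p.Adj q) ∧ ∀ p, φ p ∈ X ↔ ∃ i, p = .x i := by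
  obtain ⟨z, hzX, hz0, hdeg, hnum⟩ := h.exists_center hne
  set L : Finset W := Xᶜ.filter fun w => (nbrX Γ X w).card = 2 with hL
  have hLcard : L.card = 3 := hnum
  set l : Fin 3 → W := fun i => ((Finset.equivFinOfCardEq hLcard).symm i : W) with hl
  have hlinj : Function.Injective l :=
    Subtype.val_injective.comp (Finset.equivFinOfCardEq hLcard).symm.injective
  have hlL : ∀ i, l i ∈ L := fun i => ((Finset.equivFinOfCardEq hLcard).symm i).2
  have hlsurj : ∀ w ∈ L, ∃ i, l i = w := fun w hw =>
    ⟨Finset.equivFinOfCardEq hLcard ⟨w, hw⟩, by simp [hl]⟩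
  have hlX : ∀ i, l i ∉ X := fun i => by simpa using (Finset.mem_filter.1 (hlL i)).1
  have hl2 : ∀ i, (nbrX Γ X (l i)).card = 2 := fun i => (Finset.mem_filter.1 (hlL i)).2
  choose m hmX hm1 hlm hml hlz using fun i => h.exists_mid hzX hz0 hdeg (hlX i) (hl2 i)
  have hlm_adj : ∀ i, Γ.Adj (l i) (m i) := fun i =>
    (mem_nbrF.1 (show m i ∈ nbrF Γ X (l i) by rw [hlm]; simp)).2
  have hmz_adj : ∀ i, Γ.Adj (m i) z := fun i =>
    (mem_nbrF.1 (show z ∈ nbrF Γ X (m i) by rw [hml]; simp)).2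
  have hml_ne : ∀ i j, m i ≠ l j := fun i j hc => by
    have := hl2 j; rw [← hc, hm1] at this; omega
  have hmz_ne : ∀ i, m i ≠ z := fun i => (hmz_adj i).ne
  have hminj : Function.Injective m := by
    intro i j hij
    have hj : l j ∈ nbrF Γ X (m i) := by rw [hij, hml]; simp
    rw [hml, Finset.mem_insert, Finset.mem_singleton] at hj
    exact (hlinj (hj.resolve_right (hlz j))).symm
  have hmimage : nbrF Γ X z = Finset.univ.image m := by
    symm
    refine Finset.eq_of_subset_of_card_le (fun u hu => ?_) ?_
    · obtain ⟨i, -, rfl⟩ := Finset.mem_image.1 hu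
      exact mem_nbrF.2 ⟨hmX i, (hmz_adj i).symm⟩
    · rw [Finset.card_image_of_injective _ hminj, Finset.card_univ, Fintype.card_fin]
      have := hdeg z hzX
      omega
  -- Any further vertices outside `X` would send no edge to those listed and would span minimum
  -- degree two in a forest.
  have hF : ∀ w ∉ X, w = z ∨ (∃ i, w = m i) ∨ ∃ i, w = l i := by
    have := h.compl_subset ({z} ∪ Finset.univ.image m ∪ L) (fun w hw hwS => ?_)
    · intro w hw
      have hw' := this (by simpa using hw : w ∈ Xᶜ)
      simp only [Finset.mem_union, Finset.mem_singleton, Finset.mem_image, Finset.mem_univ,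
        true_and] at hw'
      rcases hw' with (hw' | ⟨i, hi⟩) | hw'
      · exact Or.inl hw'
      · exact Or.inr (Or.inl ⟨i, hi.symm⟩)
      · obtain ⟨i, hi⟩ := hlsurj w hw'
        exact Or.inr (Or.inr ⟨i, hi.symm⟩)
    · simp only [Finset.mem_union, Finset.mem_singleton, Finset.mem_image, Finset.mem_univ,
        true_and, not_or, not_exists] at hwS
      obtain ⟨⟨hwz, hwm⟩, hwL⟩ := hwS
      have h0 := mt (hz0 w hw).1 hwz
      have h2 : (nbrX Γ X w).card ≠ 2 := fun hc => hwL (by simp [hL, hw, hc])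
      have hd := hdeg w hw
      have hle : (nbrX Γ X w).card < 3 := by
        refine lt_of_le_of_ne (h.card_nbrX_le w) fun hc => ?_
        exact Finset.eq_empty_iff_forall_notMem.1 (Finset.card_eq_zero.1 h.num_three) w
          (by simp [hw, hc])
      refine ⟨by omega, fun u hu huS => ?_⟩
      rw [mem_nbrF] at hu
      have hw' : w ∈ nbrF Γ X u := mem_nbrF.2 ⟨hw, hu.2.symm⟩
      simp only [Finset.mem_union, Finset.mem_singleton, Finset.mem_image, Finset.mem_univ,
        true_and] at huS
      rcases huS with (rfl | ⟨i, rfl⟩) | huL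
      · rw [hmimage] at hw'
        obtain ⟨i, -, hi⟩ := Finset.mem_image.1 hw'
        exact hwm i hi
      · rw [hml, Finset.mem_insert, Finset.mem_singleton] at hw'
        rcases hw' with rfl | rfl
        · exact hwL (hlL i)
        · exact hwz rfl
      · obtain ⟨i, rfl⟩ := hlsurj u huL
        rw [hlm, Finset.mem_singleton] at hw'
        exact hwm i hw'.symm
  have hsub : ∀ i, nbrX Γ X (l i) ⊆ X := fun i => Finset.filter_subset _ _
  -- With two vertices in `X`, all `l i` would be adjacent to both, which gives a 4-circuit.
  have hX3 : X.card = 3 := by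
    refine le_antisymm h.card_le ?_
    by_contra hcon
    have heq : ∀ i, nbrX Γ X (l i) = X := fun i =>
      Finset.eq_of_subset_of_card_le (hsub i) (by rw [hl2]; omega)
    obtain ⟨a, b, hab, hab'⟩ := Finset.card_eq_two.1 ((heq 0) ▸ hl2 0)
    have key : ∀ i, Γ.Adj (l i) a ∧ Γ.Adj (l i) b := fun i => by
      have ha : a ∈ nbrX Γ X (l i) := by rw [heq i, hab']; simp
      have hb : b ∈ nbrX Γ X (l i) := by rw [heq i, hab']; simp
      exact ⟨(mem_nbrX.1 ha).2, (mem_nbrX.1 hb).2⟩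
    exact hab (h.common (hlinj.ne (show (0 : Fin 3) ≠ 1 by decide)) (key 0).1 (key 1).1
      (key 0).2 (key 1).2)
  -- The vertex `x i` is the only one of `X` that `l i` misses.
  have hex : ∀ i, ∃ x, X \ nbrX Γ X (l i) = {x} := fun i => by
    refine Finset.card_eq_one.1 ?_
    rw [Finset.card_sdiff_of_subset (hsub i), hl2, hX3]
  choose x hx using hex
  have hxX : ∀ i, x i ∈ X := fun i =>
    (Finset.mem_sdiff.1 (show x i ∈ X \ nbrX Γ X (l i) by rw [hx]; simp)).1
  have hlx_iff : ∀ i, ∀ y ∈ X, Γ.Adj (l i) y ↔ y ≠ x i := fun i y hy => by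
    have h1 : y ∈ X \ nbrX Γ X (l i) ↔ y = x i := by rw [hx]; simp
    rw [Finset.mem_sdiff, mem_nbrX] at h1
    tauto
  have hxinj : Function.Injective x := by
    intro i j hij
    by_contra hne
    obtain ⟨a, b, hab, hab'⟩ := Finset.card_eq_two.1 (hl2 i)
    have ha := mem_nbrX.1 (show a ∈ nbrX Γ X (l i) by rw [hab']; simp)
    have hb := mem_nbrX.1 (show b ∈ nbrX Γ X (l i) by rw [hab']; simp)
    have haj := (hlx_iff j a ha.1).2 (hij ▸ (hlx_iff i a ha.1).1 ha.2)
    have hbj := (hlx_iff j b hb.1).2 (hij ▸ (hlx_iff i b hb.1).1 hb.2)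
    exact hab (h.common (hlinj.ne hne) ha.2 haj hb.2 hbj)
  have hXimage : X = Finset.univ.image x := by
    symm
    refine Finset.eq_of_subset_of_card_le (fun u hu => ?_) ?_
    · obtain ⟨i, -, rfl⟩ := Finset.mem_image.1 hu
      exact hxX i
    · rw [Finset.card_image_of_injective _ hxinj, Finset.card_univ, Fintype.card_fin, hX3]
  have hlx : ∀ i j, Γ.Adj (l i) (x j) ↔ i ≠ j := fun i j => by
    rw [hlx_iff i _ (hxX j), hxinj.ne_iff, ne_comm]
  -- Any other neighbour of `m i` in `X` is adjacent to `l i` too and closes a triangle.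
  have hmx' : ∀ i, ∀ y ∈ X, Γ.Adj (m i) y → y = x i := fun i y hy hadj => by
    by_contra hne
    exact h.triangle (m i) (l i) y (hlm_adj i).symm ((hlx_iff i y hy).2 hne) hadj
  have hmx : ∀ i j, Γ.Adj (m i) (x j) ↔ i = j := fun i j => by
    constructor
    · intro hadj
      exact (hxinj (hmx' i _ (hxX j) hadj)).symm
    · rintro rfl
      obtain ⟨y, hy⟩ := Finset.card_eq_one.1 (hm1 i)
      have hy' := mem_nbrX.1 (show y ∈ nbrX Γ X (m i) by rw [hy]; simp)
      rw [← hmx' i y hy'.1 hy'.2]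
      exact hy'.2
  have hxx : ∀ i j, ¬ Γ.Adj (x i) (x j) := fun i j hadj => by
    have hij : i ≠ j := fun hc => hadj.ne (congrArg x hc)
    obtain ⟨k, hki, hkj⟩ :=
      (by decide : ∀ i j : Fin 3, ∃ k : Fin 3, k ≠ i ∧ k ≠ j) i j
    exact h.triangle (l k) (x i) (x j) ((hlx k i).2 hki) hadj ((hlx k j).2 hkj)
  have hzx : ∀ i, ¬ Γ.Adj z (x i) := fun i hadj => by
    have h0 := Finset.card_eq_zero.1 ((hz0 z hzX).2 rfl)
    exact Finset.eq_empty_iff_forall_notMem.1 h0 (x i) (mem_nbrX.2 ⟨hxX i, hadj⟩)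
  have hzl : ∀ i, ¬ Γ.Adj z (l i) := fun i hadj => by
    have : l i ∈ nbrF Γ X z := mem_nbrF.2 ⟨hlX i, hadj⟩
    rw [hmimage] at this
    obtain ⟨j, -, hj⟩ := Finset.mem_image.1 this
    exact hml_ne j i hj
  have hll : ∀ i j, ¬ Γ.Adj (l i) (l j) := fun i j hadj => by
    have : l j ∈ nbrF Γ X (l i) := mem_nbrF.2 ⟨hlX j, hadj⟩
    rw [hlm, Finset.mem_singleton] at this
    exact hml_ne i j this.symm
  have hmm : ∀ i j, ¬ Γ.Adj (m i) (m j) := fun i j hadj => by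
    have : m j ∈ nbrF Γ X (m i) := mem_nbrF.2 ⟨hmX j, hadj⟩
    rw [hml, Finset.mem_insert, Finset.mem_singleton] at this
    rcases this with hc | hc
    · exact hml_ne j i hc
    · exact hmz_ne j hc
  have hml_iff : ∀ i j, Γ.Adj (m i) (l j) ↔ i = j := fun i j => by
    constructor
    · intro hadj
      have : l j ∈ nbrF Γ X (m i) := mem_nbrF.2 ⟨hlX j, hadj⟩
      rw [hml, Finset.mem_insert, Finset.mem_singleton] at this
      exact (hlinj (this.resolve_right (hlz j))).symm
    · rintro rfl
      exact (hlm_adj i).symm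
  let φ : PV → W
    | .z => z
    | .m i => m i
    | .l i => l i
    | .x i => x i
  have hxne : ∀ i w, w ∉ X → x i ≠ w := fun i w hw hc => hw (hc ▸ hxX i)
  have hinj : Function.Injective φ := by
    rintro (_ | i | i | i) (_ | j | j | j) hpq <;> simp only [φ] at hpq
    · rfl
    · exact absurd hpq.symm (hmz_ne j)
    · exact absurd hpq.symm (hlz j)
    · exact absurd hpq.symm (hxne _ _ hzX)
    · exact absurd hpq (hmz_ne i)
    · rw [hminj hpq]
    · exact absurd hpq (hml_ne _ _)
    · exact absurd hpq.symm (hxne _ _ (hmX i))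
    · exact absurd hpq (hlz i)
    · exact absurd hpq.symm (hml_ne _ _)
    · rw [hlinj hpq]
    · exact absurd hpq.symm (hxne _ _ (hlX i))
    · exact absurd hpq (hxne _ _ hzX)
    · exact absurd hpq (hxne _ _ (hmX j))
    · exact absurd hpq (hxne _ _ (hlX j))
    · rw [hxinj hpq]
  have hsurj : Function.Surjective φ := by
    intro w
    by_cases hw : w ∈ X
    · rw [hXimage] at hw
      obtain ⟨i, -, rfl⟩ := Finset.mem_image.1 hw
      exact ⟨.x i, rfl⟩
    · rcases hF w hw with rfl | ⟨i, rfl⟩ | ⟨i, rfl⟩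
      · exact ⟨.z, rfl⟩
      · exact ⟨.m i, rfl⟩
      · exact ⟨.l i, rfl⟩
  have hadj : ∀ p q, Γ.Adj (φ p) (φ q) ↔ p.Adj q := by
    have hcomm := fun a b => Γ.adj_comm a b
    rintro (_ | i | i | i) (_ | j | j | j) <;>
      simp only [φ, PV.Adj, iff_false, iff_true, SimpleGraph.irrefl]
    · exact (hmz_adj j).symm
    · exact hzl j
    · exact hzx j
    · exact hmz_adj i
    · exact hmm i j
    · exact hml_iff i j
    · exact hmx i j
    · rw [hcomm]; exact hzl i
    · rw [hcomm, hml_iff, eq_comm]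
    · exact hll i j
    · exact hlx i j
    · rw [hcomm]; exact hzx i
    · rw [hcomm, hmx, eq_comm]
    · rw [hcomm, hlx, ne_comm]
    · exact hxx i j
  have hφX : ∀ p, φ p ∈ X ↔ ∃ i, p = .x i := by
    rintro (_ | i | i | i) <;> simp [φ, hzX, hmX, hlX, hxX]
  exact ⟨Equiv.ofBijective φ ⟨hinj, hsurj⟩, hadj, hφX⟩

end Irreducible

end

end EdgeEnds

/-! ### Near flows, contractions and the lifting of flows -/

namespace EdgeEnds

namespace PV

/-- A flow on the Petersen graph that vanishes exactly on the edge between `m 0` and `l 0`, as a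
function of the (ordered) pair of ends. -/
def nearFlow : PV → PV → K4
  | z, m i => ![(1, 0), (0, 1), (1, 1)] i
  | m i, z => ![(1, 0), (0, 1), (1, 1)] i
  | m i, l _ => ![(0, 0), (1, 0), (1, 0)] i
  | l i, m _ => ![(0, 0), (1, 0), (1, 0)] i
  | m i, x _ => ![(1, 0), (1, 1), (0, 1)] i
  | x i, m _ => ![(1, 0), (1, 1), (0, 1)] i
  | l i, x j => ![![(0, 0), (1, 0), (1, 0)], ![(0, 1), (0, 0), (1, 1)], ![(1, 1), (0, 1), (0, 0)]] i j
  | x j, l i => ![![(0, 0), (1, 0), (1, 0)], ![(0, 1), (0, 0), (1, 1)], ![(1, 1), (0, 1), (0, 0)]] i j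
  | _, _ => 0

lemma Adj.symm {p q : PV} (h : p.Adj q) : q.Adj p := by revert p q; decide

lemma Adj.ne {p q : PV} (h : p.Adj q) : p ≠ q := by revert p q; decide

lemma nearFlow_comm (p q : PV) (h : p.Adj q) : nearFlow p q = nearFlow q p := by
  revert p q; decide

lemma sum_nearFlow (p : PV) : ∑ q with p.Adj q, nearFlow p q = 0 := by
  revert p; decide

lemma nearFlow_eq_zero (p q : PV) (h : p.Adj q) (h0 : nearFlow p q = 0) :
    (p = m 0 ∧ q = l 0) ∨ (p = l 0 ∧ q = m 0) := by
  revert p q; decide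

end PV

noncomputable section

open scoped Classical

variable {W W' E : Type*}

/-- Consecutive edges of a path in the contraction meet in a fiber, where `hR` connects their ends.
-/
lemma Reach.lift {s t : E → W} {μ : W → W'} {R : E → Prop}
    (hR : ∀ w w', μ w = μ w' → Reach s t R w w') {w : W} {y : W'}
    (h : Reach (μ ∘ s) (μ ∘ t) R (μ w) y) : ∀ w', μ w' = y → Reach s t R w w' := by
  induction h with
  | refl => exact fun w' hw' => hR _ _ hw'.symm
  | tail _ hbc ih =>
    obtain ⟨e, he, hl⟩ := hbc
    intro w' hw'
    rcases hl with ⟨h1, h2⟩ | ⟨h1, h2⟩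
    · exact (ih (s e) h1).trans ((Reach.of_link he (link_self s t e)).trans
        (hR _ _ (h2.trans hw'.symm)))
    · exact (ih (t e) h2).trans ((Reach.of_link he (link_self s t e).symm).trans
        (hR _ _ (h1.trans hw'.symm)))

/-- The image of a vertex set under a contraction. -/
def mapSet (μ : W → W') (X : Finset W) : Finset W' := X.image μ

lemma mem_mapSet {μ : W → W'} {X : Finset W} {y : W'} : y ∈ mapSet μ X ↔ ∃ w ∈ X, μ w = y := by
  simp [mapSet]

lemma mem_mapSet_of_mem {μ : W → W'} {X : Finset W} {w : W} (h : w ∈ X) : μ w ∈ mapSet μ X :=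
  mem_mapSet.2 ⟨w, h, rfl⟩

lemma card_mapSet_le {μ : W → W'} {X : Finset W} : (mapSet μ X).card ≤ X.card :=
  Finset.card_image_le

lemma mem_univ_filter {A : Type*} [Fintype A] {p : A → Prop} {inst : DecidablePred p} {a : A} :
    a ∈ @Finset.filter A p inst Finset.univ ↔ p a := by
  simp

variable [Fintype E]

/-- A connected bridgeless graph in which `X` is a feedback vertex set of at most three vertices
(loops are ignored). -/
structure Feedback [Fintype W] (s t : E → W) (X : Finset W) : Prop where
  card_le : X.card ≤ 3
  cut : ∀ A : Finset W, A.Nonempty → A ≠ Finset.univ →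
    2 ≤ (Finset.univ.filter fun e => ¬ (s e ∈ A ↔ t e ∈ A)).card
  forest : ∀ U : Finset W, U.Nonempty → Disjoint U X →
    (Finset.univ.filter fun e => s e ≠ t e ∧ s e ∈ U ∧ t e ∈ U).card + 1 ≤ U.card

/-- The map `m` exhibits the Petersen graph as a contraction, where `X` is mapped to the vertices
`x i`. -/
structure PetersenContraction (s t : E → W) (X : Finset W) (m : W → PV) : Prop where
  conn : ∀ w w', m w = m w' → Reach s t (fun e => m (s e) = m (t e)) w w'
  edge : ∀ p q, p.Adj q → ∃! e, Link (m ∘ s) (m ∘ t) e p q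
  adj : ∀ e, m (s e) ≠ m (t e) → (m (s e)).Adj (m (t e))
  mapX : ∀ w ∈ X, ∃ i, m w = .x i
  hitX : ∀ i, ∃ w ∈ X, m w = .x i

/-- A flow that vanishes on the edge `e₀` between the fibers of `m 0` and `l 0`, on no other edge
between fibers, and otherwise only on edges in series with `e₀`. -/
structure IsNearFlow (s t : E → W) (m : W → PV) (e₀ : E) (f : E → K4) : Prop where
  link : Link (m ∘ s) (m ∘ t) e₀ (.m 0) (.l 0)
  flow : IsFlow s t f
  zero : f e₀ = 0
  eq_of_zero : ∀ e, m (s e) ≠ m (t e) → f e = 0 → e = e₀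
  series : ∀ e, s e ≠ t e → f e = 0 → Series s t e e₀

/-- A nowhere-zero flow, or a contraction to the Petersen graph with a near flow. -/
def FlowOrPetersen (s t : E → W) (X : Finset W) : Prop :=
  (∃ f : E → K4, IsFlow s t f ∧ ∀ e, s e ≠ t e → f e ≠ 0) ∨
    ∃ m e₀ f, PetersenContraction s t X m ∧ IsNearFlow s t m e₀ f

/-- Flows lift along the contraction `μ`, with control on the zeros. -/
def Lifts (s t : E → W) (μ : W → W') : Prop :=
  ∀ f' : E → K4, IsFlow (μ ∘ s) (μ ∘ t) f' → ∃ f : E → K4, IsFlow s t f ∧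
    (∀ e, μ (s e) ≠ μ (t e) → (f e = 0 ↔ f' e = 0)) ∧
    ∀ e, s e ≠ t e → μ (s e) = μ (t e) → f e = 0 →
      ∃ e₂, μ (s e₂) ≠ μ (t e₂) ∧ f' e₂ = 0 ∧ Series s t e e₂

/-- A zero that appears in the lift is in series with a zero below, and series relations pull back
and compose. So nowhere-zero flows stay nowhere zero and near flows stay near flows. -/
lemma FlowOrPetersen.of_lifts [Fintype W] {s t : E → W} {X : Finset W} {μ : W → W'}
    (hconn : ∀ w w', μ w = μ w' → Reach s t (fun e => μ (s e) = μ (t e)) w w')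
    (hlift : Lifts s t μ) (h : FlowOrPetersen (μ ∘ s) (μ ∘ t) (mapSet μ X)) :
    FlowOrPetersen s t X := by
  rcases h with ⟨f', hf', hne⟩ | ⟨m, e₀, f', hm, hf'⟩
  · obtain ⟨f, hf, h1, h2⟩ := hlift f' hf'
    refine Or.inl ⟨f, hf, fun e he h0 => ?_⟩
    by_cases hμ : μ (s e) = μ (t e)
    · obtain ⟨e₂, h3, h4, -⟩ := h2 e he hμ h0
      exact hne e₂ h3 h4
    · exact hne e hμ ((h1 e hμ).1 h0)
  · obtain ⟨f, hf, h1, h2⟩ := hlift f' hf'.flow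
    have hnl : ∀ e, m (μ (s e)) ≠ m (μ (t e)) → μ (s e) ≠ μ (t e) := fun e h h' =>
      h (congrArg m h')
    have h0 : m (μ (s e₀)) ≠ m (μ (t e₀)) := by
      rcases hf'.link with ⟨h1, h2⟩ | ⟨h1, h2⟩ <;> simp only [Function.comp] at h1 h2 <;>
        rw [h1, h2] <;> decide
    refine Or.inr ⟨m ∘ μ, e₀, f, ⟨fun w w' hww' => ?_, hm.edge, hm.adj, fun w hw => ?_,
      fun i => ?_⟩, ⟨hf'.link, hf, (h1 e₀ (hnl e₀ h0)).2 hf'.zero, fun e he hz => ?_,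
      fun e he hz => ?_⟩⟩
    · refine Reach.lift (μ := μ) (fun a b hab => ?_) (hm.conn _ _ hww') w' rfl
      exact (hconn a b hab).mono fun e he => congrArg m he
    · exact hm.mapX _ (mem_mapSet_of_mem hw)
    · obtain ⟨y, hy, hmy⟩ := hm.hitX i
      obtain ⟨w, hw, rfl⟩ := mem_mapSet.1 hy
      exact ⟨w, hw, hmy⟩
    · exact hf'.eq_of_zero e he ((h1 e (hnl e he)).1 hz)
    · by_cases hμ : μ (s e) = μ (t e)
      · obtain ⟨e₂, h3, h4, h5⟩ := h2 e he hμ hz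
        exact h5.trans (hf'.series e₂ h3 h4).comap
      · exact (hf'.series e hμ ((h1 e hμ).1 hz)).comap

/-- The contraction of the vertex set `Q` to a point. -/
def contr (Q : Finset W) (w : W) : Option {w : W // w ∉ Q} :=
  if h : w ∈ Q then none else some ⟨w, h⟩

lemma contr_eq_none {Q : Finset W} {w : W} : contr Q w = none ↔ w ∈ Q := by
  unfold contr; split_ifs with h <;> simp [h]

lemma contr_eq_iff {Q : Finset W} {w w' : W} :
    contr Q w = contr Q w' ↔ w = w' ∨ (w ∈ Q ∧ w' ∈ Q) := by
  by_cases h : w ∈ Q <;> by_cases h' : w' ∈ Q <;> simp [contr, h, h']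
  · rintro rfl; exact h' h
  · rintro rfl; exact h h'

lemma contr_surjective {Q : Finset W} (hQ : Q.Nonempty) : Function.Surjective (contr Q) := by
  rintro (_ | ⟨w, hw⟩)
  · obtain ⟨q, hq⟩ := hQ
    exact ⟨q, contr_eq_none.2 hq⟩
  · exact ⟨w, by simp [contr, hw]⟩

variable [Fintype W]

/-- The bound `hcard` says that `Q` spans at least `Q.card - 1` edges. Contracting `Q` thus removes
at least as many nonloop edges inside as vertices, and the forest inequality survives. Cuts of the
contraction are cuts of the graph. -/
lemma Feedback.contract {s t : E → W} {X Q : Finset W} (h : Feedback s t X) (hQ : Q.Nonempty)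
    (hcard : Q.card ≤ (Finset.univ.filter fun e => s e ≠ t e ∧ s e ∈ Q ∧ t e ∈ Q).card + 1) :
    Feedback (contr Q ∘ s) (contr Q ∘ t) (mapSet (contr Q) X) where
  card_le := card_mapSet_le.trans h.card_le
  cut A hA hA' := by
    have := h.cut (Finset.univ.filter fun w => contr Q w ∈ A) ?_ ?_
    · simpa using this
    · obtain ⟨a, ha⟩ := hA
      obtain ⟨w, rfl⟩ := contr_surjective hQ a
      exact ⟨w, by simpa using ha⟩
    · intro hc
      refine hA' (Finset.eq_univ_iff_forall.2 fun a => ?_)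
      obtain ⟨w, rfl⟩ := contr_surjective hQ a
      simpa using Finset.eq_univ_iff_forall.1 hc w
  forest U' hU' hdisj := by
    set U : Finset W := Finset.univ.filter fun w => contr Q w ∈ U' with hU
    have hmem : ∀ w, w ∈ U ↔ contr Q w ∈ U' := fun w => by simp [hU]
    have hne : U.Nonempty := by
      obtain ⟨a, ha⟩ := hU'
      obtain ⟨w, rfl⟩ := contr_surjective hQ a
      exact ⟨w, (hmem w).2 ha⟩
    have hf := h.forest U hne (by
      rw [Finset.disjoint_left] at hdisj ⊢
      exact fun w hw hwX => hdisj ((hmem w).1 hw) (mem_mapSet_of_mem hwX))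
    suffices key : ∀ D' : Finset E, (∀ e ∈ D', contr Q (s e) ≠ contr Q (t e) ∧
        contr Q (s e) ∈ U' ∧ contr Q (t e) ∈ U') → D'.card + 1 ≤ U'.card from
      key _ fun e he => (mem_univ_filter (p := fun e => contr Q (s e) ≠ contr Q (t e) ∧
        contr Q (s e) ∈ U' ∧ contr Q (t e) ∈ U')).1 he
    intro D' hD'
    -- If `U'` contains the contracted point, its preimage contains all of `Q`, whose inner edges
    -- are to be counted in addition. Otherwise the preimage is a copy of `U'`.
    by_cases hnone : none ∈ U'
    · have h1 : D'.card + (Finset.univ.filter fun e => s e ≠ t e ∧ s e ∈ Q ∧ t e ∈ Q).card ≤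
          (Finset.univ.filter fun e => s e ≠ t e ∧ s e ∈ U ∧ t e ∈ U).card := by
        rw [← Finset.card_union_of_disjoint]
        · refine Finset.card_le_card fun e he => ?_
          simp only [Finset.mem_union, Finset.mem_filter, Finset.mem_univ,
            true_and, hmem] at he ⊢
          rcases he with he | ⟨h1, h2, h3⟩
          · obtain ⟨h1, h2, h3⟩ := hD' e he
            exact ⟨fun hc => h1 (by rw [hc]), h2, h3⟩
          · exact ⟨h1, (contr_eq_none.2 h2).symm ▸ hnone, (contr_eq_none.2 h3).symm ▸ hnone⟩
        · rw [Finset.disjoint_left]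
          intro e he he'
          simp only [Finset.mem_filter, Finset.mem_univ, true_and] at he'
          exact (hD' e he).1 (contr_eq_iff.2 (Or.inr he'.2))
      have h2 : U.card + 1 ≤ U'.card + Q.card := by
        have h3 : (U \ Q).card ≤ (U'.erase none).card := by
          refine Finset.card_le_card_of_injOn (contr Q) (fun w hw => ?_) (fun w hw w' hw' hc => ?_)
          · simp only [Finset.coe_sdiff, Set.mem_sdiff, Finset.mem_coe] at hw
            simp only [Finset.coe_erase, Set.mem_sdiff, Finset.mem_coe, Set.mem_singleton_iff]
            exact ⟨(hmem w).1 hw.1, fun hc => hw.2 (contr_eq_none.1 hc)⟩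
          · simp only [Finset.coe_sdiff, Set.mem_sdiff, Finset.mem_coe] at hw
            exact (contr_eq_iff.1 hc).resolve_right fun hc => hw.2 hc.1
        have h4 := Finset.card_erase_of_mem hnone
        have h5 : 0 < U'.card := Finset.card_pos.2 hU'
        have h6 := Finset.le_card_sdiff Q U
        omega
      omega
    · have h1 : D'.card ≤ (Finset.univ.filter fun e => s e ≠ t e ∧ s e ∈ U ∧ t e ∈ U).card := by
        refine Finset.card_le_card fun e he => ?_
        simp only [Finset.mem_filter, Finset.mem_univ, true_and, hmem]
        exact ⟨fun hc => (hD' e he).1 (by rw [hc]), (hD' e he).2⟩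
      have h2 : U.card ≤ U'.card := by
        refine Finset.card_le_card_of_injOn (contr Q) (fun w hw => (hmem w).1 hw)
          (fun w hw w' hw' hc => ?_)
        refine (contr_eq_iff.1 hc).resolve_right fun hc => hnone ?_
        rw [← contr_eq_none.2 hc.1]
        exact (hmem w).1 hw
      omega

lemma bdry_comp_of_unique (s t : E → W) {μ : W → W'} {w : W} (hw : ∀ w', μ w' = μ w → w' = w)
    (f : E → K4) : bdry (μ ∘ s) (μ ∘ t) f (μ w) = bdry s t f w := by
  rw [bdry_comp, Finset.sum_eq_single w]
  · intro w' hw' hne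
    exact absurd (hw w' (Finset.mem_filter.1 hw').2) hne
  · simp

lemma bdry_contr (s t : E → W) {Q : Finset W} {w : W} (hw : w ∉ Q) (f : E → K4) :
    bdry (contr Q ∘ s) (contr Q ∘ t) f (contr Q w) = bdry s t f w :=
  bdry_comp_of_unique s t (fun _ h => (contr_eq_iff.1 h).resolve_right fun hc => hw hc.2) f

lemma Lifts.of_extends {s t : E → W} {Q : Finset W} {K : Finset E}
    (hK : ∀ e ∈ K, s e ∈ Q ∧ t e ∈ Q) (h : Extends s t Q K) : Lifts s t (contr Q) := by
  intro f' hf'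
  -- The value `(1, 0)` is an arbitrary nonzero one for edges within `Q` that are not in `K`. They
  -- are loops of the contraction, so the balance off `Q` is not affected.
  set f₀ : E → K4 := fun e =>
    if e ∈ K then 0 else if contr Q (s e) = contr Q (t e) then (1, 0) else f' e with hf₀
  obtain ⟨f, hf, h1, h2⟩ := h f₀ (fun e he => by simp [hf₀, he]) (fun w hw => by
    have h3 : bdry (contr Q ∘ s) (contr Q ∘ t) f₀ (contr Q w) = 0 := by
      rw [← hf' (contr Q w)]
      refine bdry_congr_nonloop (fun e he => ?_) _
      have : e ∉ K := fun hc => he (contr_eq_iff.2 (Or.inr (hK e hc)))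
      simp only [Function.comp] at he
      simp [hf₀, this, he]
    rwa [bdry_contr s t hw] at h3)
  refine ⟨f, hf, fun e he => ?_, fun e _ he' h0 => ?_⟩
  · have : e ∉ K := fun hc => he (contr_eq_iff.2 (Or.inr (hK e hc)))
    rw [h1 e this]
    simp [hf₀, this, he]
  · by_cases hc : e ∈ K
    · exact absurd h0 (h2 e hc)
    · have := (h1 e hc).1 h0
      simp [hf₀, hc, he'] at this

/-- The contraction of an edge at a vertex with only two (nonloop) edges. -/
lemma Lifts.of_degree_two {s t : E → W} {w y y' : W} {e₁ e₂ : E} (hwy : w ≠ y) (hwy' : w ≠ y')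
    (hyy' : y ≠ y') (h₁ : Link s t e₁ w y) (h₂ : Link s t e₂ w y')
    (hdeg : ∀ e, s e ≠ t e → s e = w ∨ t e = w → e = e₁ ∨ e = e₂) :
    Lifts s t (contr {w, y}) := by
  have hne : e₁ ≠ e₂ := by
    rintro rfl
    rcases h₁ with ⟨h, h'⟩ | ⟨h, h'⟩ <;> rcases h₂ with ⟨h'', h'''⟩ | ⟨h'', h'''⟩ <;> aesop
  have hcut : ∀ {M : Type} [AddCommGroup M] [Module (ZMod 2) M] (g : E → M),
      bdry s t g w = g e₁ + g e₂ := by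
    intro M _ _ g
    have := sum_bdry_cut s t g {w}
    rw [Finset.sum_singleton] at this
    rw [this, ← Finset.sum_pair hne]
    refine Finset.sum_congr ?_ fun _ _ => rfl
    ext e
    simp only [Finset.mem_filter, Finset.mem_univ, true_and, Finset.mem_singleton,
      Finset.mem_insert]
    constructor
    · intro he
      exact hdeg e (fun hc => he (by rw [hc])) (by tauto)
    · rintro (rfl | rfl)
      · rcases h₁ with ⟨h, h'⟩ | ⟨h, h'⟩ <;> rw [h, h'] <;> simp [hwy.symm]
      · rcases h₂ with ⟨h, h'⟩ | ⟨h, h'⟩ <;> rw [h, h'] <;> simp [hwy'.symm]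
  have hseries : Series s t e₁ e₂ := fun g hg => by
    have := hg w
    rw [hcut] at this
    exact eq_of_add_eq_zero_two this
  have hmem₁ : s e₁ ∈ ({w, y} : Finset W) ∧ t e₁ ∈ ({w, y} : Finset W) := by
    rcases h₁ with ⟨h, h'⟩ | ⟨h, h'⟩ <;> simp [h, h']
  have hloop₁ : contr {w, y} (s e₁) = contr {w, y} (t e₁) := contr_eq_iff.2 (Or.inr hmem₁)
  have hnl₂ : contr {w, y} (s e₂) ≠ contr {w, y} (t e₂) := by
    rw [Ne, contr_eq_iff]
    rcases h₂ with ⟨h, h'⟩ | ⟨h, h'⟩ <;> simp [h, h', hwy', hwy'.symm, hyy'.symm]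
  intro f' hf'
  set f₀ : E → K4 := fun e =>
    if e = e₁ then 0 else if contr {w, y} (s e) = contr {w, y} (t e) then (1, 0) else f' e with hf₀
  have hbal : ∀ v ∉ ({w, y} : Finset W), bdry s t f₀ v = 0 := by
    intro v hv
    have h3 : bdry (contr {w, y} ∘ s) (contr {w, y} ∘ t) f₀ (contr {w, y} v) = 0 := by
      rw [← hf' (contr {w, y} v)]
      refine bdry_congr_nonloop (fun e he => ?_) _
      have : e ≠ e₁ := by rintro rfl; exact he hloop₁
      simp only [Function.comp] at he
      simp [hf₀, this, he]
    rwa [bdry_contr s t hv] at h3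
  have hsum := sum_bdry_eq_zero_of_balanced hbal
  rw [Finset.sum_pair hwy] at hsum
  have hf₀₁ : f₀ e₁ = 0 := by simp [hf₀]
  have hf₀₂ : f₀ e₂ = f' e₂ := by simp [hf₀, hne.symm, hnl₂]
  have hbw : bdry s t f₀ w = f' e₂ := by rw [hcut, hf₀₁, hf₀₂, zero_add]
  have hby : bdry s t f₀ y = f' e₂ := by rw [← eq_of_add_eq_zero_two hsum, hbw]
  -- Balance at `w` leaves no choice for `e₁`: it gets the value of `e₂`. This may be zero, but then
  -- `e₁` is in series with the zero `e₂`.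
  refine ⟨f₀ + Pi.single e₁ (f' e₂), fun v => ?_, fun e he => ?_, fun e he he' h0 => ?_⟩
  · rw [bdry_add, bdry_single h₁]
    by_cases hvw : v = w
    · subst hvw
      rw [hbw, if_pos rfl, if_neg hwy, add_zero, ZModModule.add_self]
    · by_cases hvy : v = y
      · subst hvy
        rw [hby, if_pos rfl, if_neg hvw, zero_add, ZModModule.add_self]
      · rw [hbal v (by simp [hvw, hvy]), if_neg hvw, if_neg hvy, add_zero, add_zero]
  · have : e ≠ e₁ := by rintro rfl; exact he hloop₁
    simp [hf₀, this, he]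
  · by_cases hc : e = e₁
    · subst hc
      refine ⟨e₂, hnl₂, ?_, hseries⟩
      simpa [hf₀₁] using h0
    · simp [hf₀, hc, he'] at h0

end

end EdgeEnds

/-! ### The reductions: a nowhere-zero flow or the Petersen graph -/

namespace EdgeEnds

noncomputable section

open scoped Classical

variable {W E : Type*}

/-- The underlying simple graph. -/
def toSimple {W E : Type*} (s t : E → W) : SimpleGraph W where
  Adj u v := u ≠ v ∧ ∃ e, Link s t e u v
  symm := ⟨fun _ _ h => ⟨h.1.symm, h.2.imp fun _ he => he.symm⟩⟩
  loopless := ⟨fun _ h => h.1 rfl⟩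

lemma Link.mem {s t : E → W} {e : E} {a b : W} {Q : Finset W} (h : Link s t e a b) (ha : a ∈ Q)
    (hb : b ∈ Q) : s e ∈ Q ∧ t e ∈ Q := by
  rcases h with ⟨rfl, rfl⟩ | ⟨rfl, rfl⟩
  · exact ⟨ha, hb⟩
  · exact ⟨hb, ha⟩

lemma Link.ne {s t : E → W} {e : E} {a b : W} (h : Link s t e a b) (hab : a ≠ b) :
    s e ≠ t e := by
  rcases h with ⟨rfl, rfl⟩ | ⟨rfl, rfl⟩
  · exact hab
  · exact hab.symm

lemma Link.edge_ne {s t : E → W} {e e' : E} {a b c d : W} (h : Link s t e a b)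
    (h' : Link s t e' c d) (hne : ¬ ((a = c ∧ b = d) ∨ (a = d ∧ b = c))) : e ≠ e' := by
  rintro rfl
  rcases h with ⟨rfl, rfl⟩ | ⟨rfl, rfl⟩ <;> rcases h' with ⟨rfl, rfl⟩ | ⟨rfl, rfl⟩ <;>
    simp at hne

/-- The end of the edge `e` other than `w`. -/
def other (s t : E → W) (w : W) (e : E) : W := if s e = w then t e else s e

lemma link_other {s t : E → W} {w : W} {e : E} (h : s e = w ∨ t e = w) :
    Link s t e w (other s t w e) := by
  unfold other
  split_ifs with hs
  · exact Or.inl ⟨hs, rfl⟩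
  · exact Or.inr ⟨rfl, h.resolve_left hs⟩

variable [Fintype E]

/-- The edges at `w` that are not loops. -/
def star (s t : E → W) (w : W) : Finset E :=
  Finset.univ.filter fun e => s e ≠ t e ∧ (s e = w ∨ t e = w)

lemma mem_star {s t : E → W} {w : W} {e : E} :
    e ∈ star s t w ↔ s e ≠ t e ∧ (s e = w ∨ t e = w) := by simp [star]

lemma star_eq_cut (s t : E → W) (w : W) : star s t w =
    Finset.univ.filter fun e => ¬ (s e ∈ ({w} : Finset W) ↔ t e ∈ ({w} : Finset W)) := by
  ext e
  simp only [mem_star, Finset.mem_filter, Finset.mem_univ, true_and, Finset.mem_singleton]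
  constructor
  · rintro ⟨hne, h⟩ hc
    rcases h with h | h
    · exact hne (h.trans (hc.1 h).symm)
    · exact hne ((hc.2 h).trans h.symm)
  · intro h
    exact ⟨fun hc => h (by rw [hc]), by tauto⟩

lemma toSimple_adj_other {s t : E → W} {w : W} {e : E} (h : e ∈ star s t w) :
    (toSimple s t).Adj w (other s t w e) := by
  rw [mem_star] at h
  refine ⟨fun hc => ?_, e, link_other h.2⟩
  rcases link_other h.2 with ⟨h1, h2⟩ | ⟨h1, h2⟩
  · exact h.1 (by rw [h1, h2, ← hc])
  · exact h.1 (by rw [h1, h2, ← hc])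

lemma other_injOn {s t : E → W}
    (hdig : ∀ a b e₁ e₂, a ≠ b → Link s t e₁ a b → Link s t e₂ a b → e₁ = e₂) (w : W) :
    Set.InjOn (other s t w) (star s t w) := by
  intro e he e' he' heq
  have h1 := toSimple_adj_other he
  rw [Finset.mem_coe, mem_star] at he he'
  exact hdig _ _ e e' h1.ne (link_other he.2) (heq ▸ link_other he'.2)

lemma card_adj_le (s t : E → W) (U : Finset W) {w : W} (hw : w ∈ U) :
    (U.filter fun u => (toSimple s t).Adj w u).card ≤
      ((Finset.univ.filter fun e => s e ≠ t e ∧ s e ∈ U ∧ t e ∈ U).filter fun e => s e = w).card +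
      ((Finset.univ.filter fun e => s e ≠ t e ∧ s e ∈ U ∧ t e ∈ U).filter
        fun e => t e = w).card := by
  set D := Finset.univ.filter fun e => s e ≠ t e ∧ s e ∈ U ∧ t e ∈ U
  calc _ ≤ ((D.filter fun e => s e = w).image t ∪ (D.filter fun e => t e = w).image s).card := by
        refine Finset.card_le_card fun u hu => ?_
        obtain ⟨huU, hne, e, he⟩ := Finset.mem_filter.1 hu
        simp only [Finset.mem_union, Finset.mem_image, Finset.mem_filter, D, Finset.mem_univ,
          true_and]
        rcases he with ⟨rfl, rfl⟩ | ⟨rfl, rfl⟩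
        · exact Or.inl ⟨e, ⟨⟨hne, hw, huU⟩, rfl⟩, rfl⟩
        · exact Or.inr ⟨e, ⟨⟨hne.symm, huU, hw⟩, rfl⟩, rfl⟩
    _ ≤ _ := (Finset.card_union_le _ _).trans
        (Nat.add_le_add Finset.card_image_le Finset.card_image_le)

/-- In an irreducible graph with the structure of the Petersen graph there is a near flow. -/
lemma FlowOrPetersen.of_equiv {s t : E → W} {X : Finset W}
    (hdig : ∀ a b e₁ e₂, a ≠ b → Link s t e₁ a b → Link s t e₂ a b → e₁ = e₂)
    (φ : PV ≃ W) (hadj : ∀ p q, (toSimple s t).Adj (φ p) (φ q) ↔ p.Adj q)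
    (hX : ∀ p, φ p ∈ X ↔ ∃ i, p = .x i) : FlowOrPetersen s t X := by
  have hlink : ∀ e p q, Link (φ.symm ∘ s) (φ.symm ∘ t) e p q ↔ Link s t e (φ p) (φ q) := by
    intro e p q
    simp only [Link, Function.comp, Equiv.symm_apply_eq]
  have hadj' : ∀ e, s e ≠ t e → (φ.symm (s e)).Adj (φ.symm (t e)) := fun e he => by
    rw [← hadj, Equiv.apply_symm_apply, Equiv.apply_symm_apply]
    exact ⟨he, e, link_self s t e⟩
  have hedge : ∀ p q, p.Adj q → ∃! e, Link (φ.symm ∘ s) (φ.symm ∘ t) e p q := by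
    intro p q hpq
    obtain ⟨hne, e, he⟩ := (hadj p q).2 hpq
    exact ⟨e, (hlink e p q).2 he, fun e' he' => hdig _ _ _ _ hne ((hlink e' p q).1 he') he⟩
  obtain ⟨e₀, he₀, he₀'⟩ := hedge (.m 0) (.l 0) (by decide)
  have hzero : ∀ e, s e ≠ t e → PV.nearFlow (φ.symm (s e)) (φ.symm (t e)) = 0 → e = e₀ := by
    intro e he h0
    exact he₀' e (PV.nearFlow_eq_zero _ _ (hadj' e he) h0 |>.imp id fun h => ⟨h.1, h.2⟩)
  refine Or.inr ⟨φ.symm, e₀, fun e => PV.nearFlow (φ.symm (s e)) (φ.symm (t e)),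
    ⟨fun w w' hww' => ?_, hedge, fun e he => hadj' e (fun hc => he (by rw [hc])),
      fun w hw => ?_, fun i => ⟨φ (.x i), (hX _).2 ⟨i, rfl⟩, by simp⟩⟩,
    ⟨he₀, fun w => ?_, ?_, fun e he h0 => hzero e (fun hc => he (by rw [hc])) h0,
      fun e he h0 => ?_⟩⟩
  · rw [φ.symm.injective hww']; exact .refl
  · exact (hX _).1 (by simpa using hw)
  · have h1 := sum_bdry_cut s t (fun e => PV.nearFlow (φ.symm (s e)) (φ.symm (t e))) {w}
    rw [Finset.sum_singleton, ← star_eq_cut] at h1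
    rw [h1, ← PV.sum_nearFlow (φ.symm w)]
    refine Finset.sum_bij (fun e _ => φ.symm (other s t w e)) (fun e he => ?_)
      (fun e he e' he' heq => ?_) (fun q hq => ?_) (fun e he => ?_)
    · simp only [Finset.mem_filter, Finset.mem_univ, true_and]
      rw [← hadj]
      simpa using toSimple_adj_other he
    · exact other_injOn hdig w he he' (φ.symm.injective heq)
    · simp only [Finset.mem_filter, Finset.mem_univ, true_and] at hq
      rw [← hadj, Equiv.apply_symm_apply] at hq
      obtain ⟨hne, e, he⟩ := hq
      refine ⟨e, ?_, ?_⟩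
      · rw [mem_star]
        rcases he with ⟨h1, h2⟩ | ⟨h1, h2⟩
        · exact ⟨by rw [h1, h2]; exact hne, Or.inl h1⟩
        · exact ⟨by rw [h1, h2]; exact hne.symm, Or.inr h2⟩
      · rw [Equiv.symm_apply_eq]
        unfold other
        rcases he with ⟨h1, h2⟩ | ⟨h1, h2⟩
        · rw [if_pos h1, h2]
        · rw [if_neg (by rw [h1]; exact hne.symm), h1]
    · have hst := hadj' e (mem_star.1 he).1
      rcases link_other (mem_star.1 he).2 with ⟨h1, h2⟩ | ⟨h1, h2⟩
      · rw [← h1, h2, h1]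
      · rw [PV.nearFlow_comm _ _ hst, h1, h2]
  · rcases he₀ with ⟨h1, h2⟩ | ⟨h1, h2⟩ <;> simp only [Function.comp] at h1 h2 <;>
      simp only [h1, h2] <;> decide
  · rw [hzero e he h0]
    exact fun _ _ => rfl

variable [Fintype W]

lemma FlowOrPetersen.of_contract {s t : E → W} {X Q : Finset W} (h : Feedback s t X)
    {q : W} (hq : q ∈ Q) (hreach : ∀ w ∈ Q, Reach s t (fun e => s e ∈ Q ∧ t e ∈ Q) w q)
    {K : Finset E} (hK : ∀ e ∈ K, s e ≠ t e ∧ s e ∈ Q ∧ t e ∈ Q) (hcard : Q.card ≤ K.card + 1)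
    (hlift : Lifts s t (contr Q))
    (ih : Feedback (contr Q ∘ s) (contr Q ∘ t) (mapSet (contr Q) X) →
      FlowOrPetersen (contr Q ∘ s) (contr Q ∘ t) (mapSet (contr Q) X)) :
    FlowOrPetersen s t X := by
  refine FlowOrPetersen.of_lifts (fun w w' hww' => ?_) hlift
    (ih (h.contract ⟨q, hq⟩ (hcard.trans (Nat.succ_le_succ (Finset.card_le_card fun e he => ?_)))))
  · rcases contr_eq_iff.1 hww' with rfl | ⟨hw, hw'⟩
    · exact .refl
    · exact ((hreach w hw).trans (hreach w' hw').symm).mono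
        fun e he => contr_eq_iff.2 (Or.inr he)
  · simpa using hK e he

lemma card_star_le {s t : E → W}
    (hdig : ∀ a b e₁ e₂, a ≠ b → Link s t e₁ a b → Link s t e₂ a b → e₁ = e₂) (w : W) :
    (star s t w).card ≤
    (Finset.univ.filter fun u => (toSimple s t).Adj w u).card :=
  Finset.card_le_card_of_injOn (other s t w)
    (fun e he => by simpa using toSimple_adj_other he) (other_injOn hdig w)

/-- The degrees within `U` add up to at most twice the number of nonloop edges in `U`, as
`card_adj_le` shows vertex by vertex. -/
lemma Feedback.forest_simple {s t : E → W} {X : Finset W} (h : Feedback s t X) (U : Finset W)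
    (hU : U.Nonempty) (hdisj : Disjoint U X) :
    ∑ w ∈ U, (U.filter fun u => (toSimple s t).Adj w u).card + 2 ≤ 2 * U.card := by
  have hf := h.forest U hU hdisj
  have h1 := Finset.sum_le_sum fun w hw => card_adj_le s t U hw
  set D := Finset.univ.filter fun e => s e ≠ t e ∧ s e ∈ U ∧ t e ∈ U with hD
  have hs : D.card = ∑ w ∈ U, (D.filter fun e => s e = w).card :=
    Finset.card_eq_sum_card_fiberwise fun e he => (Finset.mem_filter.1 he).2.2.1
  have ht : D.card = ∑ w ∈ U, (D.filter fun e => t e = w).card :=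
    Finset.card_eq_sum_card_fiberwise fun e he => (Finset.mem_filter.1 he).2.2.2
  rw [Finset.sum_add_distrib, ← hs, ← ht] at h1
  omega

/-- Induction on the number of vertices: a digon, a triangle, a 4-circuit or an edge at a vertex of
degree two off `X` is contracted. What resists is irreducible. The vertex type changes under
contraction, so it is quantified inside the induction. -/
theorem Feedback.flowOrPetersen (n : ℕ) : ∀ {W : Type v} [Fintype W] [Nonempty W] (s t : E → W)
    (X : Finset W), Fintype.card W ≤ n → Feedback s t X → FlowOrPetersen s t X := by
  induction n with
  | zero =>
    intro W _ _ s t X hcard h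
    have := Fintype.card_pos (α := W)
    omega
  | succ n ih =>
    intro W _ _ s t X hcard h
    have ihQ : ∀ Q : Finset W, 2 ≤ Q.card →
        Feedback (contr Q ∘ s) (contr Q ∘ t) (mapSet (contr Q) X) →
        FlowOrPetersen (contr Q ∘ s) (contr Q ∘ t) (mapSet (contr Q) X) := by
      intro Q hQ h'
      refine ih _ _ _ ?_ h'
      rw [Fintype.card_option, Fintype.card_subtype_compl]
      have : Fintype.card {x // x ∈ Q} = Q.card := by simp
      have := Finset.card_le_univ Q
      omega
    -- On a single vertex all edges are loops, and the zero function has no zero to account for.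
    by_cases hsub : Subsingleton W
    · exact Or.inl ⟨0, fun v => bdry_zero s t v, fun e he => absurd (Subsingleton.elim _ _) he⟩
    have hst2 : ∀ w, 2 ≤ (star s t w).card := fun w => by
      rw [star_eq_cut]
      refine h.cut {w} ⟨w, by simp⟩ fun hc => hsub ⟨fun a b => ?_⟩
      have ha := Finset.eq_univ_iff_forall.1 hc a
      have hb := Finset.eq_univ_iff_forall.1 hc b
      rw [Finset.mem_singleton] at ha hb
      rw [ha, hb]
    by_cases hdig : ∀ a b e₁ e₂, a ≠ b → Link s t e₁ a b → Link s t e₂ a b → e₁ = e₂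
    swap
    · push Not at hdig
      obtain ⟨a, b, e₁, e₂, hab, h₁, h₂, hne⟩ := hdig
      have hm₁ := h₁.mem (Q := {a, b}) (by simp) (by simp)
      have hm₂ := h₂.mem (Q := {a, b}) (by simp) (by simp)
      refine FlowOrPetersen.of_contract h (Q := {a, b}) (q := a) (by simp) (fun w hw => ?_)
        (K := {e₁, e₂}) (fun e he => ?_) ?_ (Lifts.of_extends (K := {e₁, e₂}) (fun e he => ?_)
          (extends_digon hab hne h₁ h₂)) (ihQ _ (by rw [Finset.card_pair hab]))
      · simp only [Finset.mem_insert, Finset.mem_singleton] at hw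
        rcases hw with rfl | rfl
        · exact .refl
        · exact .of_link hm₁ h₁.symm
      · simp only [Finset.mem_insert, Finset.mem_singleton] at he
        rcases he with rfl | rfl
        · exact ⟨h₁.ne hab, hm₁⟩
        · exact ⟨h₂.ne hab, hm₂⟩
      · rw [Finset.card_pair hab, Finset.card_pair hne]; norm_num
      · simp only [Finset.mem_insert, Finset.mem_singleton] at he
        rcases he with rfl | rfl
        · exact hm₁
        · exact hm₂
    by_cases htri : ∀ a b c, (toSimple s t).Adj a b → (toSimple s t).Adj b c →
        ¬ (toSimple s t).Adj a c
    swap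
    · push Not at htri
      obtain ⟨a, b, c, ⟨hab, e₁, h₁⟩, ⟨hbc, e₂, h₂⟩, ⟨hac, e₃, h₃⟩⟩ := htri
      have h12 := h₁.edge_ne h₂ (by tauto)
      have h23 := h₂.edge_ne h₃ (by tauto)
      have h13 := h₁.edge_ne h₃ (by tauto)
      have hm₁ := h₁.mem (Q := {a, b, c}) (by simp) (by simp)
      have hm₂ := h₂.mem (Q := {a, b, c}) (by simp) (by simp)
      have hm₃ := h₃.mem (Q := {a, b, c}) (by simp) (by simp)
      have hK : ∀ e ∈ ({e₁, e₂, e₃} : Finset E),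
          s e ≠ t e ∧ s e ∈ ({a, b, c} : Finset W) ∧ t e ∈ ({a, b, c} : Finset W) := by
        intro e he
        simp only [Finset.mem_insert, Finset.mem_singleton] at he
        rcases he with rfl | rfl | rfl
        · exact ⟨h₁.ne hab, hm₁⟩
        · exact ⟨h₂.ne hbc, hm₂⟩
        · exact ⟨h₃.ne hac, hm₃⟩
      have hQc : ({a, b, c} : Finset W).card = 3 := by
        rw [Finset.card_insert_of_notMem (by simp [hab, hac]), Finset.card_pair hbc]
      have hKc : ({e₁, e₂, e₃} : Finset E).card = 3 := by
        rw [Finset.card_insert_of_notMem (by simp [h12, h13]), Finset.card_pair h23]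
      refine FlowOrPetersen.of_contract h (Q := {a, b, c}) (q := a) (by simp) (fun w hw => ?_) hK
        (by omega) (Lifts.of_extends (fun e he => (hK e he).2)
          (extends_triangle hab hbc hac h₁ h₂ h₃.symm h12 h23 h13)) (ihQ _ (by omega))
      simp only [Finset.mem_insert, Finset.mem_singleton] at hw
      rcases hw with rfl | rfl | rfl
      · exact .refl
      · exact .of_link hm₁ h₁.symm
      · exact .of_link hm₃ h₃.symm
    by_cases hquad : ∀ a b c d, a ≠ c → b ≠ d → (toSimple s t).Adj a b → (toSimple s t).Adj b c →
        (toSimple s t).Adj c d → ¬ (toSimple s t).Adj d a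
    swap
    · push Not at hquad
      obtain ⟨a, b, c, d, hac, hbd, ⟨hab, e₁, h₁⟩, ⟨hbc, e₂, h₂⟩, ⟨hcd, e₃, h₃⟩,
        ⟨hda, e₄, h₄⟩⟩ := hquad
      have h12 := h₁.edge_ne h₂ (by tauto)
      have h13 := h₁.edge_ne h₃ (by tauto)
      have h14 := h₁.edge_ne h₄ (by tauto)
      have h23 := h₂.edge_ne h₃ (by tauto)
      have h24 := h₂.edge_ne h₄ (by tauto)
      have h34 := h₃.edge_ne h₄ (by tauto)
      have hm₁ := h₁.mem (Q := {a, b, c, d}) (by simp) (by simp)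
      have hm₂ := h₂.mem (Q := {a, b, c, d}) (by simp) (by simp)
      have hm₃ := h₃.mem (Q := {a, b, c, d}) (by simp) (by simp)
      have hm₄ := h₄.mem (Q := {a, b, c, d}) (by simp) (by simp)
      have hK : ∀ e ∈ ({e₁, e₂, e₃, e₄} : Finset E),
          s e ≠ t e ∧ s e ∈ ({a, b, c, d} : Finset W) ∧ t e ∈ ({a, b, c, d} : Finset W) := by
        intro e he
        simp only [Finset.mem_insert, Finset.mem_singleton] at he
        rcases he with rfl | rfl | rfl | rfl
        · exact ⟨h₁.ne hab, hm₁⟩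
        · exact ⟨h₂.ne hbc, hm₂⟩
        · exact ⟨h₃.ne hcd, hm₃⟩
        · exact ⟨h₄.ne hda, hm₄⟩
      have hQc : ({a, b, c, d} : Finset W).card = 4 := by
        rw [Finset.card_insert_of_notMem (by simp [hab, hac, hda.symm]),
          Finset.card_insert_of_notMem (by simp [hbc, hbd]), Finset.card_pair hcd]
      have hKc : ({e₁, e₂, e₃, e₄} : Finset E).card = 4 := by
        rw [Finset.card_insert_of_notMem (by simp [h12, h13, h14]),
          Finset.card_insert_of_notMem (by simp [h23, h24]), Finset.card_pair h34]
      refine FlowOrPetersen.of_contract h (Q := {a, b, c, d}) (q := a) (by simp) (fun w hw => ?_)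
        hK (by omega) (Lifts.of_extends (fun e he => (hK e he).2)
          (extends_quad hab hac hda.symm hbc hbd hcd h₁ h₂ h₃ h₄)) (ihQ _ (by omega))
      simp only [Finset.mem_insert, Finset.mem_singleton] at hw
      rcases hw with rfl | rfl | rfl | rfl
      · exact .refl
      · exact .of_link hm₁ h₁.symm
      · exact (Reach.of_link (e := e₂) hm₂ h₂.symm).trans (.of_link hm₁ h₁.symm)
      · exact .of_link hm₄ h₄
    by_cases hdeg : ∀ w ∉ X, 3 ≤ (star s t w).card
    swap
    · push Not at hdeg
      obtain ⟨w, -, hw3⟩ := hdeg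
      obtain ⟨e₁, e₂, hne, hstar⟩ := Finset.card_eq_two.1
        (le_antisymm (Nat.lt_succ_iff.1 hw3) (hst2 w))
      have hm₁ : e₁ ∈ star s t w := by rw [hstar]; simp
      have hm₂ : e₂ ∈ star s t w := by rw [hstar]; simp
      have hadj₁ := toSimple_adj_other hm₁
      have hadj₂ := toSimple_adj_other hm₂
      have hl₁ := link_other (mem_star.1 hm₁).2
      have hl₂ := link_other (mem_star.1 hm₂).2
      have hyy : other s t w e₁ ≠ other s t w e₂ := fun hc =>
        hne (other_injOn hdig w hm₁ hm₂ hc)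
      have hmem := hl₁.mem (Q := {w, other s t w e₁}) (by simp) (by simp)
      refine FlowOrPetersen.of_contract h (Q := {w, other s t w e₁}) (q := w) (by simp)
        (fun u hu => ?_) (K := {e₁}) (fun e he => ?_) ?_
        (Lifts.of_degree_two hadj₁.ne hadj₂.ne hyy hl₁ hl₂ fun e he he' => ?_)
        (ihQ _ (by rw [Finset.card_pair hadj₁.ne]))
      · simp only [Finset.mem_insert, Finset.mem_singleton] at hu
        rcases hu with rfl | rfl
        · exact .refl
        · exact .of_link hmem hl₁.symm
      · rw [Finset.mem_singleton] at he
        subst he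
        exact ⟨hl₁.ne hadj₁.ne, hmem⟩
      · rw [Finset.card_pair hadj₁.ne]; simp
      · have : e ∈ star s t w := mem_star.2 ⟨he, he'⟩
        rw [hstar] at this
        simpa using this
    have hirr : Irreducible (toSimple s t) X :=
      ⟨h.card_le, htri, hquad, fun w hw => (hdeg w hw).trans (card_star_le hdig w),
        fun w => (hst2 w).trans (card_star_le hdig w), h.forest_simple⟩
    rcases Finset.eq_empty_or_nonempty Xᶜ with hX | hX
    · exfalso
      have hall : ∀ w, w ∈ X := fun w => by
        by_contra hw
        exact Finset.eq_empty_iff_forall_notMem.1 hX w (by simpa using hw)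
      obtain ⟨a⟩ := (inferInstance : Nonempty W)
      obtain ⟨b, hb, c, hc, hbc⟩ := Finset.one_lt_card.1 (hirr.two_le_degree a)
      obtain ⟨d, hd, d', hd', hdd⟩ := Finset.one_lt_card.1 (hirr.two_le_degree b)
      simp only [Finset.mem_filter, Finset.mem_univ, true_and] at hb hc hd hd'
      have hbc' : ¬ (toSimple s t).Adj b c := fun hc' => htri a b c hb hc' hc
      -- A second neighbour of `b` would be a fourth vertex, as triangles are excluded; but here all
      -- vertices lie in `X`.
      have key : ∀ d, (toSimple s t).Adj b d → d = a := by
        intro d hd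
        by_contra hda
        have h4 : ({a, b, c, d} : Finset W).card ≤ X.card :=
          Finset.card_le_card fun w _ => hall w
        have hdc : d ≠ c := by rintro rfl; exact hbc' hd
        rw [Finset.card_insert_of_notMem (by simp [hb.ne, hc.ne, Ne.symm hda]),
          Finset.card_insert_of_notMem (by simp [hbc, hd.ne]),
          Finset.card_pair hdc.symm] at h4
        have := h.card_le
        omega
      exact hdd ((key d hd).trans (key d' hd').symm)
    · obtain ⟨φ, hφ, hφX⟩ := hirr.exists_equiv hX
      exact FlowOrPetersen.of_equiv hdig φ hφ hφX

end

end EdgeEnds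

/-! ### Euler tours with prescribed changes of label -/

namespace EdgeEnds

noncomputable section

open scoped Classical

variable {V E : Type*}

/-- The parity vector of the single label `y`. -/
def dlt (y : K4) : K4 → ZMod 2 := Pi.single y 1

lemma dlt_add_self (y : K4) : dlt y + dlt y = 0 := ZModModule.add_self _

/-- The labels of the edges in `K`, as parity vectors. -/
def lab (K : Finset E) (g : E → K4) (e : E) : K4 → ZMod 2 := if e ∈ K then dlt (g e) else 0

/-- The indicator function of an edge set. -/
def ind (K : Finset E) (e : E) : ZMod 2 := if e ∈ K then 1 else 0

lemma lab_insert {K : Finset E} {e : E} (he : e ∉ K) (g : E → K4) (y : K4) :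
    lab (insert e K) (Function.update g e y) = lab K g + Pi.single e (dlt y) := by
  funext e'
  by_cases h : e' = e
  · subst h
    simp [lab, he]
  · simp [lab, h]

lemma ind_insert {K : Finset E} {e : E} (he : e ∉ K) :
    ind (insert e K) = ind K + Pi.single e 1 := by
  funext e'
  by_cases h : e' = e
  · subst h
    simp [ind, he]
  · simp [ind, h]

/-- The translation of parity vectors. -/
def shift (d : K4) : (K4 → ZMod 2) →+ (K4 → ZMod 2) where
  toFun f := fun w => f (w + d)
  map_zero' := rfl
  map_add' _ _ := rfl

lemma shift_dlt (d y : K4) : shift d (dlt y) = dlt (y + d) := by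
  funext w
  have : w + d = y ↔ w = y + d := by
    constructor
    · rintro rfl; rw [add_assoc, ZModModule.add_self, add_zero]
    · rintro rfl; rw [add_assoc, ZModModule.add_self, add_zero]
  simp [shift, dlt, Pi.single_apply, this]

variable [Fintype E]

/-- Labellings of the edges of a trail from `p` to `q` that visits the vertices in `N`. -/
def TrailGood (s t : E → V) (K : Finset E) (N : Finset V) (p q : V) : Prop :=
  ∀ b : V → K4, (∀ v ∉ N, b v = 0) → ∀ y₀, ∃ g : E → K4, ∀ v, ∃ y,
    bdry s t (lab K g) v + ((if v = p then dlt y₀ else 0) +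
      (if v = q then dlt (y₀ + ∑ u ∈ N, b u) else 0)) = dlt y + dlt (y + b v)

/-- Labellings of the edges of a closed trail that visits the vertices in `N`. -/
def ClosedGood (s t : E → V) (K : Finset E) (N : Finset V) : Prop :=
  ∀ b : V → K4, (∀ v ∉ N, b v = 0) → ∑ u ∈ N, b u = 0 → ∃ g : E → K4, ∀ v, ∃ y,
    bdry s t (lab K g) v = dlt y + dlt (y + b v)

lemma TrailGood.nil (s t : E → V) (p : V) : TrailGood s t ∅ {p} p p := by
  intro b hb y₀
  refine ⟨0, fun v => ?_⟩
  have h0 : lab (∅ : Finset E) (0 : E → K4) = 0 := by funext e; simp [lab]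
  rw [h0, bdry_zero, zero_add, Finset.sum_singleton]
  by_cases hv : v = p
  · subst hv
    exact ⟨y₀, by simp⟩
  · refine ⟨0, ?_⟩
    rw [hb v (by simpa using hv), add_zero, dlt_add_self, if_neg hv, if_neg hv, add_zero]

/-- The two extra terms in `TrailGood` are half-edges at the ends of the trail. The new edge takes
the label of the last half-edge. The change by `b r` is made when `r` is visited for the first time
and never again. -/
lemma TrailGood.cons {s t : E → V} {K : Finset E} {N : Finset V} {p q r : V} {e : E}
    (h : TrailGood s t K N p q) (he : e ∉ K) (hl : Link s t e q r) :
    TrailGood s t (insert e K) (insert r N) p r := by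
  intro b hb y₀
  by_cases hr : r ∈ N
  · rw [Finset.insert_eq_of_mem hr] at hb ⊢
    obtain ⟨g, hg⟩ := h b hb y₀
    refine ⟨Function.update g e (y₀ + ∑ u ∈ N, b u), fun v => ?_⟩
    obtain ⟨y, hy⟩ := hg v
    refine ⟨y, ?_⟩
    rw [← hy, lab_insert he, bdry_add, bdry_single hl]
    generalize dlt (y₀ + ∑ u ∈ N, b u) = z
    by_cases h2 : v = r
    · simp only [h2, if_true]
      rw [show ∀ a b c : K4 → ZMod 2, a + (b + z) + (c + z) = a + (c + b) + (z + z) from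
        fun a b c => by abel, ZModModule.add_self, add_zero]
    · simp only [h2, if_false, add_zero]
      abel
  · set b₀ : V → K4 := fun v => if v = r then 0 else b v with hb₀
    have hsum : ∑ u ∈ N, b₀ u = ∑ u ∈ N, b u :=
      Finset.sum_congr rfl fun u hu => by
        simp only [hb₀]; rw [if_neg]; rintro rfl; exact hr hu
    obtain ⟨g, hg⟩ := h b₀ (fun v hv => by
      by_cases hvr : v = r
      · simp [hb₀, hvr]
      · simp only [hb₀, if_neg hvr]; exact hb v (by simp [hvr, hv])) y₀
    rw [hsum] at hg
    refine ⟨Function.update g e (y₀ + ∑ u ∈ N, b u), fun v => ?_⟩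
    obtain ⟨y, hy⟩ := hg v
    rw [lab_insert he, bdry_add, bdry_single hl, Finset.sum_insert hr]
    by_cases hvr : v = r
    · subst hvr
      refine ⟨y₀ + ∑ u ∈ N, b u, ?_⟩
      simp only [hb₀, if_true, add_zero, dlt_add_self] at hy
      simp only [if_true]
      rw [add_comm (b v), ← add_assoc y₀]
      calc _ = (bdry s t (lab K g) v + ((if v = p then dlt y₀ else 0) +
            if v = q then dlt (y₀ + ∑ u ∈ N, b u) else 0)) + (dlt (y₀ + ∑ u ∈ N, b u) +
            dlt (y₀ + ∑ u ∈ N, b u + b v)) := by abel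
        _ = _ := by rw [hy, zero_add]
    · refine ⟨y, ?_⟩
      simp only [hb₀, if_neg hvr] at hy
      simp only [if_neg hvr, add_zero]
      rw [← hy]
      abel

/-- When the changes sum to zero, the two half-edges at `p` carry the same label and cancel. -/
lemma TrailGood.closed {s t : E → V} {K : Finset E} {N : Finset V} {p : V}
    (h : TrailGood s t K N p p) : ClosedGood s t K N := by
  intro b hb hsum
  obtain ⟨g, hg⟩ := h b hb 0
  refine ⟨g, fun v => ?_⟩
  obtain ⟨y, hy⟩ := hg v
  refine ⟨y, ?_⟩
  rw [← hy, hsum, add_zero, ZModModule.add_self, add_zero]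

lemma bdry_lab_shift (s t : E → V) (K : Finset E) (g : E → K4) (d : K4) (v : V) :
    bdry s t (lab K fun e => g e + d) v = shift d (bdry s t (lab K g) v) := by
  rw [← bdry_map]
  congr 1
  funext e
  unfold lab
  split_ifs
  · rw [shift_dlt]
  · rw [map_zero]

/-- The first tour makes the changes on `N₁` except at `x`, and the second makes those on `N₂ \ N₁`.
At `x` each tour gets the change that makes its own sum zero, namely `c` and `c + b x`. The labels
of the second tour are translated so that one of its two surviving labels at `x` cancels one of the
first tour. -/
lemma ClosedGood.union {s t : E → V} {K₁ K₂ : Finset E} {N₁ N₂ : Finset V}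
    (h₁ : ClosedGood s t K₁ N₁) (h₂ : ClosedGood s t K₂ N₂) (hK : Disjoint K₁ K₂) {x : V}
    (hx₁ : x ∈ N₁) (hx₂ : x ∈ N₂) : ClosedGood s t (K₁ ∪ K₂) (N₁ ∪ N₂) := by
  intro b hb hsum
  set c : K4 := ∑ u ∈ N₁.erase x, b u with hc
  set b₁ : V → K4 := fun v => if v = x then c else if v ∈ N₁ then b v else 0 with hb₁
  set b₂ : V → K4 := fun v => if v = x then c + b x else if v ∈ N₁ then 0 else b v with hb₂
  have hs₁ : ∑ u ∈ N₁, b₁ u = 0 := by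
    rw [← Finset.add_sum_erase _ _ hx₁]
    have : ∑ u ∈ N₁.erase x, b₁ u = c := Finset.sum_congr rfl fun u hu => by
      rw [Finset.mem_erase] at hu
      simp [hb₁, hu.1, hu.2]
    rw [this]
    simp [hb₁, ZModModule.add_self]
  have hs₂ : ∑ u ∈ N₂, b₂ u = 0 := by
    rw [← Finset.add_sum_erase _ _ hx₂]
    have h1 : ∑ u ∈ N₂.erase x, b₂ u = ∑ u ∈ N₂ \ N₁, b u := by
      have hsub : N₂ \ N₁ ⊆ N₂.erase x := fun u hu => by
        rw [Finset.mem_sdiff] at hu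
        exact Finset.mem_erase.2 ⟨fun hux => hu.2 (hux ▸ hx₁), hu.1⟩
      rw [← Finset.sum_subset hsub]
      · refine Finset.sum_congr rfl fun u hu => ?_
        have hux := (Finset.mem_erase.1 (hsub hu)).1
        simp [hb₂, hux, (Finset.mem_sdiff.1 hu).2]
      · intro u hu hu'
        rw [Finset.mem_erase] at hu
        have : u ∈ N₁ := by
          by_contra hcon
          exact hu' (Finset.mem_sdiff.2 ⟨hu.2, hcon⟩)
        simp [hb₂, hu.1, this]
    rw [h1]
    have h2 : ∑ u ∈ N₁ ∪ N₂, b u = ∑ u ∈ N₁, b u + ∑ u ∈ N₂ \ N₁, b u := by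
      rw [← Finset.sum_union Finset.disjoint_sdiff, Finset.union_sdiff_self_eq_union]
    rw [hsum, ← Finset.add_sum_erase _ _ hx₁] at h2
    simp only [hb₂, if_true]
    rw [h2, add_comm c]
  obtain ⟨g₁, hg₁⟩ := h₁ b₁ (fun v hv => by
    have : v ≠ x := by rintro rfl; exact hv hx₁
    simp [hb₁, this, hv]) hs₁
  obtain ⟨g₂, hg₂⟩ := h₂ b₂ (fun v hv => by
    have : v ≠ x := by rintro rfl; exact hv hx₂
    simp only [hb₂, if_neg this]
    split_ifs with h
    · rfl
    · exact hb v (by simp [h, hv])) hs₂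
  obtain ⟨y₁, hy₁⟩ := hg₁ x
  obtain ⟨y₂, hy₂⟩ := hg₂ x
  set d : K4 := y₂ + (y₁ + c) with hd
  refine ⟨fun e => if e ∈ K₁ then g₁ e else g₂ e + d, fun v => ?_⟩
  have hlab : lab (K₁ ∪ K₂) (fun e => if e ∈ K₁ then g₁ e else g₂ e + d) =
      lab K₁ g₁ + lab K₂ fun e => g₂ e + d := by
    funext e
    by_cases he₁ : e ∈ K₁
    · have : e ∉ K₂ := Finset.disjoint_left.1 hK he₁
      simp [lab, he₁, this]
    · simp [lab, he₁]
  rw [hlab, bdry_add, bdry_lab_shift]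
  by_cases hvx : v = x
  · subst hvx
    refine ⟨y₁, ?_⟩
    rw [hy₁, hy₂, map_add, shift_dlt, shift_dlt]
    have e1 : y₂ + d = y₁ + c := by rw [hd, ← add_assoc, ZModModule.add_self, zero_add]
    have e2 : y₂ + b₂ v + d = y₁ + b v := by
      rw [add_right_comm, e1]
      simp only [hb₂, if_true]
      rw [add_assoc, ← add_assoc c, ZModModule.add_self, zero_add]
    rw [e1, e2]
    simp only [hb₁, if_true]
    rw [add_assoc, ← add_assoc (dlt (y₁ + c)), dlt_add_self, zero_add]
  · obtain ⟨z₁, hz₁⟩ := hg₁ v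
    obtain ⟨z₂, hz₂⟩ := hg₂ v
    rw [hz₁, hz₂]
    by_cases hv₁ : v ∈ N₁
    · refine ⟨z₁, ?_⟩
      have e1 : b₁ v = b v := by simp [hb₁, hvx, hv₁]
      have e2 : b₂ v = 0 := by simp [hb₂, hvx, hv₁]
      rw [e1, e2, add_zero, dlt_add_self, map_zero, add_zero]
    · refine ⟨z₂ + d, ?_⟩
      have e1 : b₁ v = 0 := by simp [hb₁, hvx, hv₁]
      have e2 : b₂ v = b v := by simp [hb₂, hvx, hv₁]
      rw [e1, e2, add_zero, dlt_add_self, zero_add, map_add, shift_dlt, shift_dlt,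
        add_right_comm]

lemma exists_mem_of_bdry_ind_ne_zero {s t : E → V} {K : Finset E} {v : V}
    (h : bdry s t (ind K) v ≠ 0) : ∃ e ∈ K, s e = v ∨ t e = v := by
  by_contra! hcon
  refine h (Finset.sum_eq_zero fun e _ => ?_)
  by_cases he : e ∈ K
  · rw [if_neg (hcon e he).1, if_neg (hcon e he).2, add_zero]
  · simp [ind, he]

lemma bdry_ind_sdiff (s t : E → V) {K D : Finset E} (h : K ⊆ D) (v : V) :
    bdry s t (ind (D \ K)) v = bdry s t (ind D) v + bdry s t (ind K) v := by
  rw [← bdry_add]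
  congr 1
  funext e
  by_cases h1 : e ∈ K
  · simp [ind, h1, h h1, ZModModule.add_self]
  · simp [ind, h1]

lemma bdry_ind_union (s t : E → V) {K D : Finset E} (h : Disjoint K D) (v : V) :
    bdry s t (ind (K ∪ D)) v = bdry s t (ind K) v + bdry s t (ind D) v := by
  rw [← bdry_add]
  congr 1
  funext e
  by_cases h1 : e ∈ K
  · simp [ind, h1, Finset.disjoint_left.1 h h1]
  · simp [ind, h1]

/-- In an even edge set there is a closed trail through every vertex that is not isolated. -/
lemma exists_closed_trail {s t : E → V} {D : Finset E} (hD : ∀ v, bdry s t (ind D) v = 0) {x : V}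
    {e₀ : E} (he₀ : e₀ ∈ D) (hx : s e₀ = x ∨ t e₀ = x) :
    ∃ K ⊆ D, K.Nonempty ∧ ∃ N : Finset V, x ∈ N ∧ ClosedGood s t K N ∧
      (∀ v, bdry s t (ind K) v = 0) ∧ (∀ e ∈ K, s e ∈ N ∧ t e ∈ N) ∧
      ∀ v ∈ N, Reach s t (· ∈ D) x v := by
  let P : Finset E → V → Prop := fun K q => K ⊆ D ∧ ∃ N : Finset V, TrailGood s t K N x q ∧
    (∀ v, bdry s t (ind K) v = (if v = x then 1 else 0) + (if v = q then 1 else 0)) ∧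
    x ∈ N ∧ q ∈ N ∧ (∀ e ∈ K, s e ∈ N ∧ t e ∈ N) ∧ ∀ v ∈ N, Reach s t (· ∈ D) x v
  have h0 : P ∅ x := by
    refine ⟨by simp, {x}, TrailGood.nil s t x, fun v => ?_, by simp, by simp, by simp, ?_⟩
    · rw [ZModModule.add_self]
      have : ind (∅ : Finset E) = 0 := by funext e; simp [ind]
      rw [this, bdry_zero]
    · intro v hv
      rw [Finset.mem_singleton] at hv
      subst hv
      exact .refl
  -- A trail of maximal length from `x` uses all edges of `D` at its end. If it ended elsewhere than
  -- at `x`, parity would provide an unused edge there.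
  obtain ⟨K, hK, hmax⟩ := Finset.exists_max_image
    (Finset.univ.filter fun K : Finset E => ∃ q, P K q) Finset.card ⟨∅, by simpa using ⟨x, h0⟩⟩
  obtain ⟨q, hKD, N, hT, hb, hxN, hqN, hends, hreach⟩ := (Finset.mem_filter.1 hK).2
  have hext : ∀ e ∈ D, (s e = q ∨ t e = q) → e ∈ K := by
    intro e heD heq
    by_contra heK
    have hl := link_other heq
    set r := other s t q e
    have hP : P (insert e K) r := by
      refine ⟨Finset.insert_subset heD hKD, insert r N, hT.cons heK hl, fun v => ?_,
        by simp [hxN], by simp, fun e' he' => ?_, fun v hv => ?_⟩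
      · rw [ind_insert heK, bdry_add, hb, bdry_single hl]
        generalize (if v = x then (1 : ZMod 2) else 0) = i
        generalize (if v = q then (1 : ZMod 2) else 0) = j
        generalize (if v = r then (1 : ZMod 2) else 0) = k
        rw [add_assoc, ← add_assoc j, ZModModule.add_self, zero_add]
      · rcases Finset.mem_insert.1 he' with rfl | he'
        · exact hl.mem (by simp [hqN]) (by simp)
        · exact ⟨Finset.mem_insert_of_mem (hends e' he').1,
            Finset.mem_insert_of_mem (hends e' he').2⟩
      · rcases Finset.mem_insert.1 hv with rfl | hv
        · exact (hreach q hqN).trans (.of_link heD hl)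
        · exact hreach v hv
    have := hmax (insert e K) (by simpa using ⟨r, hP⟩)
    rw [Finset.card_insert_of_notMem heK] at this
    omega
  have hqx : q = x := by
    by_contra hne
    have h1 : bdry s t (ind (D \ K)) q ≠ 0 := by
      rw [bdry_ind_sdiff s t hKD, hD, hb, if_neg hne, if_pos rfl]
      decide
    obtain ⟨e, he, hel⟩ := exists_mem_of_bdry_ind_ne_zero h1
    rw [Finset.mem_sdiff] at he
    exact he.2 (hext e he.1 hel)
  subst hqx
  exact ⟨K, hKD, ⟨e₀, hext e₀ he₀ hx⟩, N, hxN, hT.closed,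
    fun v => by rw [hb, ZModModule.add_self], hends, hreach⟩

variable [Fintype V]

/-- A maximal closed trail through `p` exhausts the component. An unused edge at a visited vertex
lies on a closed trail in the even remainder, and that trail could be spliced in. -/
lemma closedGood_component {s t : E → V} {C : Finset E} (hC : ∀ v, bdry s t (ind C) v = 0)
    (p : V) : ClosedGood s t (C.filter fun e => Reach s t (· ∈ C) p (s e))
      (Finset.univ.filter fun v => Reach s t (· ∈ C) p v) := by
  let P : Finset E → Prop := fun K => K ⊆ C ∧ ∃ N : Finset V, ClosedGood s t K N ∧ p ∈ N ∧
    (∀ v, bdry s t (ind K) v = 0) ∧ (∀ e ∈ K, s e ∈ N ∧ t e ∈ N) ∧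
    ∀ v ∈ N, Reach s t (· ∈ C) p v
  have h0 : P ∅ := by
    refine ⟨by simp, {p}, (TrailGood.nil s t p).closed, by simp, fun v => ?_, by simp, ?_⟩
    · have : ind (∅ : Finset E) = 0 := by funext e; simp [ind]
      rw [this, bdry_zero]
    · intro v hv
      rw [Finset.mem_singleton] at hv
      subst hv
      exact .refl
  obtain ⟨K, hK, hmax⟩ := Finset.exists_max_image
    (Finset.univ.filter P) Finset.card ⟨∅, by simpa using h0⟩
  obtain ⟨hKC, N, hg, hpN, hev, hends, hreach⟩ := (Finset.mem_filter.1 hK).2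
  have hall : ∀ e ∈ C, ∀ x ∈ N, (s e = x ∨ t e = x) → e ∈ K := by
    intro e heC x hxN hx
    by_contra heK
    obtain ⟨K₂, hK₂, hne, N₂, hxN₂, hg₂, hev₂, hends₂, hreach₂⟩ :=
      exists_closed_trail (D := C \ K) (s := s) (t := t)
        (fun v => by rw [bdry_ind_sdiff s t hKC, hC, hev, add_zero])
        (Finset.mem_sdiff.2 ⟨heC, heK⟩) hx
    have hdisj : Disjoint K K₂ :=
      Finset.disjoint_of_subset_right hK₂ Finset.disjoint_sdiff
    have hP : P (K ∪ K₂) := by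
      refine ⟨Finset.union_subset hKC (hK₂.trans Finset.sdiff_subset), N ∪ N₂,
        hg.union hg₂ hdisj hxN hxN₂, Finset.mem_union_left _ hpN,
        fun v => by rw [bdry_ind_union s t hdisj, hev, hev₂, add_zero], fun e' he' => ?_,
        fun v hv => ?_⟩
      · rcases Finset.mem_union.1 he' with he' | he'
        · exact ⟨Finset.mem_union_left _ (hends e' he').1,
            Finset.mem_union_left _ (hends e' he').2⟩
        · exact ⟨Finset.mem_union_right _ (hends₂ e' he').1,
            Finset.mem_union_right _ (hends₂ e' he').2⟩
      · rcases Finset.mem_union.1 hv with hv | hv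
        · exact hreach v hv
        · exact (hreach x hxN).trans ((hreach₂ v hv).mono fun e he =>
            (Finset.mem_sdiff.1 he).1)
    have := hmax (K ∪ K₂) (by simpa using hP)
    rw [Finset.card_union_of_disjoint hdisj] at this
    have := Finset.card_pos.2 hne
    omega
  have hN : N = Finset.univ.filter fun v => Reach s t (· ∈ C) p v := by
    ext v
    simp only [Finset.mem_filter, Finset.mem_univ, true_and]
    refine ⟨hreach v, fun hv => ?_⟩
    refine (Reach.mem_of_closed (A := (N : Set V)) (fun e he => ?_) hv).1 hpN
    exact ⟨fun h => (hends e (hall e he _ h (Or.inl rfl))).2,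
      fun h => (hends e (hall e he _ h (Or.inr rfl))).1⟩
  have hKeq : K = C.filter fun e => Reach s t (· ∈ C) p (s e) := by
    ext e
    rw [Finset.mem_filter]
    constructor
    · exact fun he => ⟨hKC he, hreach _ (hends e he).1⟩
    · rintro ⟨heC, hr⟩
      exact hall e heC (s e) (by rw [hN]; simpa using hr) (Or.inl rfl)
  rw [← hN, ← hKeq]
  exact hg

/-- Labellings of an even edge set with prescribed boundary: along an Eulerian tour of each
component the label changes exactly once at each vertex. -/
theorem exists_euler_labelling {s t : E → V} {C : Finset E}
    (hC : ∀ v, bdry s t (ind C) v = 0) (b : V → K4)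
    (hb : ∀ p, ∑ v with Reach s t (· ∈ C) p v, b v = 0) :
    ∃ g : E → K4, ∀ v, ∃ y, bdry s t (lab C g) v = dlt y + dlt (y + b v) := by
  have key : ∀ p, ∃ g : E → K4, ∀ v, Reach s t (· ∈ C) p v → ∃ y,
      bdry s t (lab (C.filter fun e => Reach s t (· ∈ C) p (s e)) g) v =
        dlt y + dlt (y + b v) := by
    intro p
    obtain ⟨g, hg⟩ := closedGood_component hC p
      (fun v => if Reach s t (· ∈ C) p v then b v else 0) (fun v hv => by
        rw [if_neg]; simpa using hv) (by
        rw [← hb p]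
        refine Finset.sum_congr rfl fun v hv => ?_
        rw [if_pos]; simpa using hv)
    refine ⟨g, fun v hv => ?_⟩
    obtain ⟨y, hy⟩ := hg v
    rw [if_pos hv] at hy
    exact ⟨y, hy⟩
  choose g hg using key
  -- A fixed representative of each component selects one labelling for all of its edges.
  let S : Setoid V := ⟨Reach s t (· ∈ C), fun _ => .refl, Reach.symm, Reach.trans⟩
  let rep : V → V := fun v => (Quotient.mk S v).out
  have hrep : ∀ v, Reach s t (· ∈ C) (rep v) v := fun v => Quotient.mk_out (s := S) v
  have hrep' : ∀ u v, Reach s t (· ∈ C) u v → rep u = rep v := fun u v h =>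
    congrArg Quotient.out (Quotient.sound (s := S) h)
  refine ⟨fun e => g (rep (s e)) e, fun v => ?_⟩
  obtain ⟨y, hy⟩ := hg (rep v) v (hrep v)
  refine ⟨y, ?_⟩
  rw [← hy]
  refine Finset.sum_congr rfl fun e _ => ?_
  have h1 : s e = v ∨ t e = v → lab C (fun e => g (rep (s e)) e) e =
      lab (C.filter fun e => Reach s t (· ∈ C) (rep v) (s e)) (g (rep v)) e := by
    intro h
    by_cases he : e ∈ C
    · have hr : Reach s t (· ∈ C) v (s e) := by
        rcases h with rfl | rfl
        · exact .refl
        · exact .of_link he (link_self s t e).symm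
      simp [lab, he, hrep' _ _ hr, hrep (s e)]
    · simp [lab, he]
  by_cases hs : s e = v
  · rw [h1 (Or.inl hs)]
  · by_cases ht : t e = v
    · rw [h1 (Or.inr ht)]
    · simp only [if_neg hs, if_neg ht]

end

end EdgeEnds

/-! ### From flows to covers with five or six members -/

namespace EdgeEnds

namespace K4

/-- Three nonzero elements with sum zero are distinct, so `c₁` and `c₂` form a basis and functionals
take arbitrary values there. The third value follows by additivity. -/
lemma exists_func_eq (c₁ c₂ c₃ : K4) (d₁ d₂ d₃ : ZMod 2) (h1 : c₁ ≠ 0) (h2 : c₂ ≠ 0)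
    (h3 : c₃ ≠ 0) (hc : c₁ + c₂ + c₃ = 0) (hd : d₁ + d₂ + d₃ = 0) :
    ∃ w, func w c₁ = d₁ ∧ func w c₂ = d₂ ∧ func w c₃ = d₃ := by
  have e1 : c₃ = c₁ + c₂ := (eq_of_add_eq_zero_two hc).symm
  have e2 : d₃ = d₁ + d₂ := (eq_of_add_eq_zero_two hd).symm
  subst e1 e2
  simp only [map_add]
  have : ∃ w, func w c₁ = d₁ ∧ func w c₂ = d₂ := by
    simp only [func_eq]
    clear hc hd
    revert h3 h2 h1; revert c₁ c₂ d₁ d₂; decide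
  obtain ⟨w, h, h'⟩ := this
  exact ⟨w, h, h', by rw [h, h']⟩

/-- The indicator function of `0`. -/
def isZero (x : K4) : ZMod 2 := if x = 0 then 1 else 0

/-- The indicator function of the complement of `0`. -/
def nonZero (x : K4) : ZMod 2 := if x = 0 then 0 else 1

/-- The indicator of `0` is the quadratic function `(1 + x.1) * (1 + x.2)`, so translation changes
it by an affine one. This is why translated labels still yield even sets. -/
lemma isZero_add (x w : K4) : isZero (x + w) = isZero x + (func w x + nonZero w) := by
  simp only [func_eq]; revert x w; decide

/-- The nonzero elements of the Klein four-group. -/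
def nz : Fin 3 → K4 := ![(1, 0), (0, 1), (1, 1)]

lemma card_five_cycle (x : K4) :
    (Finset.univ.filter fun i : Fin 5 =>
      (![1, isZero x, func (nz 0) x + isZero x + 1, func (nz 1) x + isZero x + 1,
        func (nz 2) x + isZero x + 1] : Fin 5 → ZMod 2) i = 1).card = 2 := by
  simp only [func_eq]; revert x; decide

lemma card_five_tree (x : K4) (hx : x ≠ 0) (c : ZMod 2) :
    (Finset.univ.filter fun i : Fin 5 =>
      (![0, c, func (nz 0) x + c + 0, func (nz 1) x + c + 0,
        func (nz 2) x + c + 0] : Fin 5 → ZMod 2) i = 1).card = 2 := by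
  simp only [func_eq]; revert x c; decide

lemma card_six_cycle (x : K4) (d : ZMod 2) (h : d = 1 → isZero x = 1) :
    (Finset.univ.filter fun i : Fin 6 =>
      (![1, isZero x + d, func (nz 0) x + isZero x + 1, func (nz 1) x + isZero x + 1,
        func (nz 2) x + isZero x + 1, d] : Fin 6 → ZMod 2) i = 1).card = 2 := by
  simp only [func_eq]; revert x d; decide

lemma card_six_tree (x : K4) (c d : ZMod 2) (h : x ≠ 0 → d = 1 → c = 1)
    (h' : x = 0 → c = 0 ∧ d = 1) :
    (Finset.univ.filter fun i : Fin 6 =>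
      (![0, c + d, func (nz 0) x + c + 0, func (nz 1) x + c + 0,
        func (nz 2) x + c + 0, d] : Fin 6 → ZMod 2) i = 1).card = 2 := by
  simp only [func_eq]; revert x c d; decide

end K4

noncomputable section

open scoped Classical

variable {V W E : Type*} [Fintype E]

/-- There are `k` even edge sets that cover every edge exactly twice, one of which is `C`. -/
def HasCover (s t : E → V) (C : Finset E) (k : ℕ) : Prop :=
  ∃ S : Fin k → E → ZMod 2, (∀ i, IsFlow s t (S i)) ∧ (∃ i, S i = ind C) ∧
    ∀ e, (Finset.univ.filter fun i => S i e = 1).card = 2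

lemma card_filter_inst {ι : Type*} [Fintype ι] {p : ι → Prop} {i₁ i₂ : DecidablePred p} {n : ℕ}
    (h : (@Finset.filter ι p i₁ Finset.univ).card = n) :
    (@Finset.filter ι p i₂ Finset.univ).card = n := by
  convert h

/-- The even edge set `C` and the graph formed by the other edges, which is connected on the
vertex set `N`. -/
structure TreeCycle (s t : E → V) (C : Finset E) (N : Finset V) : Prop where
  even : IsFlow s t (ind C)
  conn : ∀ a ∈ N, ∀ b ∈ N, Reach s t (· ∉ C) a b
  ends : ∀ e ∉ C, s e ∈ N ∧ t e ∈ N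

lemma bdry_congr_at {M : Type*} [AddCommMonoid M] {s t : E → V} {f g : E → M} {v : V}
    (h : ∀ e, s e = v ∨ t e = v → f e = g e) : bdry s t f v = bdry s t g v := by
  refine Finset.sum_congr rfl fun e _ => ?_
  by_cases hs : s e = v
  · rw [h e (Or.inl hs)]
  · by_cases ht : t e = v
    · rw [h e (Or.inr ht)]
    · simp [hs, ht]

/-- The zero set of `f` in `C`. -/
def zeroOn (C : Finset E) (f : E → K4) (e : E) : ZMod 2 := if e ∈ C then K4.isZero (f e) else 0

/-- The sum of the labels counted by a parity vector. -/
def total : (K4 → ZMod 2) →+ K4 where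
  toFun h := ∑ y, h y • y
  map_zero' := by simp
  map_add' a b := by simp [add_smul, Finset.sum_add_distrib]

lemma total_dlt (y : K4) : total (dlt y) = y := by
  change ∑ x, dlt y x • x = y
  rw [Finset.sum_eq_single y]
  · simp [dlt]
  · intro x _ hx; simp [dlt, hx]
  · simp

/-- A flow of the graph in which the components of `C` are contracted extends to `C`. -/
lemma TreeCycle.exists_flow [Fintype V] {s t : E → V} {C : Finset E} {N : Finset V} (h : TreeCycle s t C N)
    {π : V → W} (hπ : ∀ u v, π u = π v ↔ Reach s t (· ∈ C) u v) {f₀ : E → K4}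
    (hf₀ : IsFlow (π ∘ s) (π ∘ t) f₀) :
    ∃ f : E → K4, IsFlow s t f ∧ (∀ e ∉ C, f e = f₀ e) ∧ ∀ v ∉ N, bdry s t (zeroOn C f) v = 0 := by
  set f₁ : E → K4 := fun e => if e ∈ C then 0 else f₀ e with hf₁
  have hloop : ∀ e ∈ C, π (s e) = π (t e) := fun e he =>
    (hπ _ _).2 (.of_link he (link_self s t e))
  -- The change at each vertex is the boundary left by the edges outside `C`. On each component of
  -- `C` it sums to zero because `f₀` is a flow of the contraction.
  obtain ⟨g, hg⟩ := exists_euler_labelling (s := s) (t := t) (C := C) h.even (bdry s t f₁) (by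
    intro p
    have : bdry (π ∘ s) (π ∘ t) f₁ (π p) = 0 := by
      rw [← hf₀ (π p)]
      refine bdry_congr_nonloop (fun e he => ?_) _
      have : e ∉ C := fun h' => he (hloop e h')
      simp [hf₁, this]
    rw [bdry_comp] at this
    rw [← this]
    refine Finset.sum_congr (Finset.ext fun v => ?_) fun _ _ => rfl
    rw [mem_univ_filter, mem_univ_filter, ← hπ, eq_comm])
  set f₂ : E → K4 := fun e => total (lab C g e) with hf₂
  have hf2 : ∀ e, f₂ e = if e ∈ C then g e else 0 := fun e => by
    by_cases he : e ∈ C <;> simp [hf₂, lab, he, total_dlt]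
  refine ⟨f₁ + f₂, fun v => ?_, fun e he => by simp [hf₁, hf2, he], fun v hv => ?_⟩
  · obtain ⟨y, hy⟩ := hg v
    rw [bdry_add, hf₂, bdry_map, hy, map_add, total_dlt, total_dlt, ← add_assoc y,
      ZModModule.add_self, zero_add, ZModModule.add_self]
  · obtain ⟨y, hy⟩ := hg v
    have hb : bdry s t f₁ v = 0 := by
      refine Eq.trans (bdry_congr_at fun e he => ?_) (bdry_zero s t v)
      by_cases heC : e ∈ C
      · simp [hf₁, heC]
      · obtain ⟨h1, h2⟩ := h.ends e heC
        rcases he with rfl | rfl <;> contradiction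
    -- There is no change at `v`, so every label, in particular `0`, occurs an even number of times
    -- there.
    rw [hb, add_zero, dlt_add_self] at hy
    have : zeroOn C (f₁ + f₂) = fun e => Pi.evalAddMonoidHom (fun _ : K4 => ZMod 2) 0 (lab C g e) := by
      funext e
      by_cases he : e ∈ C
      · simp [zeroOn, hf₁, hf2, lab, he, dlt, K4.isZero, Pi.single_apply, eq_comm]
      · simp [zeroOn, lab, he]
    rw [this, bdry_map, hy]
    rfl

/-- The zero set of `f` in `C` extends to an even edge set. -/
lemma TreeCycle.exists_even [Fintype V] {s t : E → V} {C : Finset E} {N : Finset V} (h : TreeCycle s t C N)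
    {f : E → K4} (hf : ∀ v ∉ N, bdry s t (zeroOn C f) v = 0) :
    ∃ σ : E → ZMod 2, IsFlow s t σ ∧ ∀ e ∈ C, σ e = K4.isZero (f e) := by
  -- The odd vertices all lie in `N`, which is connected outside `C`, so they are paired up without
  -- touching `C`.
  obtain ⟨g, hg, hb⟩ := exists_bdry_eq h.conn (bdry s t (zeroOn C f)) hf (by
    rw [← sum_bdry_univ s t (zeroOn C f)]
    exact Finset.sum_subset (Finset.subset_univ _) fun v _ hv => hf v hv)
  refine ⟨zeroOn C f + g, fun v => ?_, fun e he => ?_⟩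
  · rw [bdry_add, hb, ZModModule.add_self]
  · simp [zeroOn, he, hg e (not_not.2 he)]

/-- A nonzero value has image `1` under exactly two of the three nonzero functionals. Off `C` two of
the last three sets contain the edge, or one of them together with `σ`. On `C`, where `C` itself
counts once, the other set is `σ` at a zero of `f` and exactly one of the last three elsewhere. -/
lemma TreeCycle.hasCover_five {s t : E → V} {C : Finset E} {N : Finset V} (h : TreeCycle s t C N)
    {f : E → K4} {σ : E → ZMod 2} (hf : IsFlow s t f) (hne : ∀ e ∉ C, f e ≠ 0)
    (hσ : IsFlow s t σ) (hz : ∀ e ∈ C, σ e = K4.isZero (f e)) : HasCover s t C 5 := by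
  have hw : ∀ w, IsFlow s t ((fun e => K4.func w (f e)) + σ + ind C) := fun w =>
    ((hf.map (K4.func w)).add hσ).add h.even
  refine ⟨![ind C, σ, (fun e => K4.func (K4.nz 0) (f e)) + σ + ind C,
    (fun e => K4.func (K4.nz 1) (f e)) + σ + ind C, (fun e => K4.func (K4.nz 2) (f e)) + σ + ind C],
    fun i => ?_, ⟨0, rfl⟩, fun e => ?_⟩
  · fin_cases i
    exacts [h.even, hσ, hw _, hw _, hw _]
  · have key : ∀ i : Fin 5, (![ind C, σ, (fun e => K4.func (K4.nz 0) (f e)) + σ + ind C,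
      (fun e => K4.func (K4.nz 1) (f e)) + σ + ind C,
      (fun e => K4.func (K4.nz 2) (f e)) + σ + ind C] : Fin 5 → E → ZMod 2) i e =
      (![ind C e, σ e, K4.func (K4.nz 0) (f e) + σ e + ind C e,
        K4.func (K4.nz 1) (f e) + σ e + ind C e,
        K4.func (K4.nz 2) (f e) + σ e + ind C e] : Fin 5 → ZMod 2) i := by
      intro i; fin_cases i <;> rfl
    simp only [key]
    by_cases he : e ∈ C
    · rw [hz e he, ind, if_pos he]
      exact card_filter_inst (K4.card_five_cycle (f e))
    · rw [ind, if_neg he]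
      exact card_filter_inst (K4.card_five_tree (f e) (hne e he) (σ e))

/-- Where `δ` lies in `σ`, the members `σ + δ` and `δ` together count like `σ` in the cover with
five members. At a zero of `f` outside `C` the three functionals give nothing, and `σ + δ` and `δ`
both contain the edge. -/
lemma TreeCycle.hasCover_six {s t : E → V} {C : Finset E} {N : Finset V} (h : TreeCycle s t C N)
    {f : E → K4} {σ δ : E → ZMod 2} (hf : IsFlow s t f) (hσ : IsFlow s t σ)
    (hz : ∀ e ∈ C, σ e = K4.isZero (f e)) (hδ : IsFlow s t δ)
    (hsub : ∀ e, f e ≠ 0 ∨ e ∈ C → δ e = 1 → σ e = 1)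
    (hR : ∀ e ∉ C, f e = 0 → σ e = 0 ∧ δ e = 1) : HasCover s t C 6 := by
  have hw : ∀ w, IsFlow s t ((fun e => K4.func w (f e)) + σ + ind C) := fun w =>
    ((hf.map (K4.func w)).add hσ).add h.even
  refine ⟨![ind C, σ + δ, (fun e => K4.func (K4.nz 0) (f e)) + σ + ind C,
    (fun e => K4.func (K4.nz 1) (f e)) + σ + ind C, (fun e => K4.func (K4.nz 2) (f e)) + σ + ind C,
    δ], fun i => ?_, ⟨0, rfl⟩, fun e => ?_⟩
  · fin_cases i
    exacts [h.even, hσ.add hδ, hw _, hw _, hw _, hδ]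
  · have key : ∀ i : Fin 6, (![ind C, σ + δ, (fun e => K4.func (K4.nz 0) (f e)) + σ + ind C,
      (fun e => K4.func (K4.nz 1) (f e)) + σ + ind C,
      (fun e => K4.func (K4.nz 2) (f e)) + σ + ind C, δ] : Fin 6 → E → ZMod 2) i e =
      (![ind C e, σ e + δ e, K4.func (K4.nz 0) (f e) + σ e + ind C e,
        K4.func (K4.nz 1) (f e) + σ e + ind C e,
        K4.func (K4.nz 2) (f e) + σ e + ind C e, δ e] : Fin 6 → ZMod 2) i := by
      intro i; fin_cases i <;> rfl
    simp only [key]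
    by_cases he : e ∈ C
    · have := hsub e (Or.inr he)
      rw [hz e he] at this
      rw [hz e he, ind, if_pos he]
      exact card_filter_inst (K4.card_six_cycle (f e) (δ e) this)
    · rw [ind, if_neg he]
      exact card_filter_inst (K4.card_six_tree (f e) (σ e) (δ e) (fun h' => hsub e (Or.inl h'))
        (hR e he))

/-- The empty set is added as a further member. -/
lemma HasCover.succ {s t : E → V} {C : Finset E} {k : ℕ} (h : HasCover s t C k) :
    HasCover s t C (k + 1) := by
  obtain ⟨S, h1, ⟨i, hi⟩, h2⟩ := h
  refine ⟨Fin.cons 0 S, Fin.cases (fun v => bdry_zero s t v) h1, ⟨i.succ, hi⟩, fun e => ?_⟩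
  rw [Fin.card_filter_univ_succ]
  simpa using h2 e

/-- A nowhere-zero flow of the contraction yields a cover with five members. -/
lemma TreeCycle.hasCover_of_flow [Fintype V] {s t : E → V} {C : Finset E} {N : Finset V}
    (h : TreeCycle s t C N) {π : V → W} (hπ : ∀ u v, π u = π v ↔ Reach s t (· ∈ C) u v)
    {f₀ : E → K4} (hf₀ : IsFlow (π ∘ s) (π ∘ t) f₀) (hne : ∀ e, π (s e) ≠ π (t e) → f₀ e ≠ 0) :
    HasCover s t C 5 := by
  -- Edges outside `C` that join vertices of one component of `C` are loops of the contraction and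
  -- get the nonzero value `(1, 0)`.
  obtain ⟨f, h1, h2, h3⟩ := h.exists_flow hπ
    (f₀ := fun e => if π (s e) = π (t e) then (1, 0) else f₀ e) (fun v => by
      rw [← hf₀ v]
      exact bdry_congr_nonloop (fun e he => if_neg he) v)
  obtain ⟨σ, h4, h5⟩ := h.exists_even h3
  refine h.hasCover_five h1 (fun e he => ?_) h4 h5
  rw [h2 e he]
  split_ifs with hl
  · decide
  · exact hne e hl

end

end EdgeEnds

/-! ### The fibers over the Petersen graph -/

namespace EdgeEnds

namespace PV

/-- The vertices `x i` of the Petersen graph. -/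
def IsX (p : PV) : Prop := ∃ i, p = x i

/-- The three neighbours of `p`. -/
def Nbrs (p q₁ q₂ q₃ : PV) : Prop :=
  q₁ ≠ q₂ ∧ q₁ ≠ q₃ ∧ q₂ ≠ q₃ ∧ ∀ q, p.Adj q ↔ q = q₁ ∨ q = q₂ ∨ q = q₃

lemma nbrs_x (i : Fin 3) : Nbrs (x i) (m i) (l (i + 1)) (l (i + 2)) := by
  unfold Nbrs; revert i; decide

lemma nbrs_l (i : Fin 3) : Nbrs (l i) (m i) (x (i + 1)) (x (i + 2)) := by
  unfold Nbrs; revert i; decide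

lemma nbrs_m (i : Fin 3) : Nbrs (m i) z (l i) (x i) := by
  unfold Nbrs; revert i; decide

lemma nbrs_z : Nbrs z (m 0) (m 1) (m 2) := by
  unfold Nbrs; decide

lemma Nbrs.adj {p q₁ q₂ q₃ : PV} (h : Nbrs p q₁ q₂ q₃) :
    p.Adj q₁ ∧ p.Adj q₂ ∧ p.Adj q₃ :=
  ⟨(h.2.2.2 _).2 (Or.inl rfl), (h.2.2.2 _).2 (Or.inr (Or.inl rfl)),
    (h.2.2.2 _).2 (Or.inr (Or.inr rfl))⟩

lemma exists_nbrs (p : PV) : ∃ q₁ q₂ q₃, Nbrs p q₁ q₂ q₃ := by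
  rcases p with _ | i | i | i
  exacts [⟨_, _, _, nbrs_z⟩, ⟨_, _, _, nbrs_m i⟩, ⟨_, _, _, nbrs_l i⟩, ⟨_, _, _, nbrs_x i⟩]

lemma not_adj_x (i j : Fin 3) : ¬ (x i).Adj (x j) := by revert i j; decide

lemma IsX.not_adj {p q : PV} (hp : p.IsX) (hq : q.IsX) : ¬ p.Adj q := by
  obtain ⟨i, rfl⟩ := hp
  obtain ⟨j, rfl⟩ := hq
  exact not_adj_x i j

lemma not_isX_z : ¬ z.IsX := by rintro ⟨i, h⟩; cases h
lemma not_isX_m (i : Fin 3) : ¬ (m i).IsX := by rintro ⟨i, h⟩; cases h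
lemma not_isX_l (i : Fin 3) : ¬ (l i).IsX := by rintro ⟨i, h⟩; cases h

/-- The function with value `ζ i` at `x i` that vanishes elsewhere. -/
def onX (ζ : Fin 3 → K4) : PV → K4
  | x i => ζ i
  | _ => 0

lemma onX_of_not {ζ : Fin 3 → K4} {p : PV} (h : ¬ p.IsX) : onX ζ p = 0 := by
  rcases p with _ | i | i | i
  · rfl
  · rfl
  · rfl
  · exact absurd ⟨i, rfl⟩ h

end PV

noncomputable section

open scoped Classical

variable {V W E : Type*}

/-- The fibers of `M` form the Petersen graph with the edges `pe p q`, and every edge of `C` lies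
within the fiber of some `x i`. -/
structure PetersenFibers (s t : E → V) (C : Finset E) (M : V → PV) (pe : PV → PV → E) : Prop where
  conn : ∀ v v', M v = M v' → Reach s t (fun e => M (s e) = M (t e)) v v'
  link : ∀ p q, p.Adj q → Link (M ∘ s) (M ∘ t) (pe p q) p q
  unique : ∀ e p q, p.Adj q → Link (M ∘ s) (M ∘ t) e p q → e = pe p q
  adj : ∀ e, M (s e) ≠ M (t e) → (M (s e)).Adj (M (t e))
  onX : ∀ e ∈ C, M (s e) = M (t e) ∧ (M (s e)).IsX

namespace PetersenFibers

variable {s t : E → V} {C : Finset E} {M : V → PV} {pe : PV → PV → E}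

lemma symm (hP : PetersenFibers s t C M pe) {p q : PV} (h : p.Adj q) : pe p q = pe q p :=
  hP.unique _ _ _ h.symm (hP.link p q h).symm

lemma inner_ne (hP : PetersenFibers s t C M pe) {p q : PV} (h : p.Adj q) :
    M (s (pe p q)) ≠ M (t (pe p q)) := by
  intro h'
  rcases hP.link p q h with ⟨h1, h2⟩ | ⟨h1, h2⟩
  · exact h.ne (h1.symm.trans (h'.trans h2))
  · exact h.ne (h2.symm.trans (h'.symm.trans h1))

lemma not_mem (hP : PetersenFibers s t C M pe) {p q : PV} (h : p.Adj q) : pe p q ∉ C :=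
  fun h' => hP.inner_ne h (hP.onX _ h').1

lemma exists_ends (hP : PetersenFibers s t C M pe) {p q : PV} (h : p.Adj q) :
    ∃ a b, Link s t (pe p q) a b ∧ M a = p ∧ M b = q := by
  rcases hP.link p q h with ⟨h1, h2⟩ | ⟨h1, h2⟩
  · exact ⟨_, _, Or.inl ⟨rfl, rfl⟩, h1, h2⟩
  · exact ⟨_, _, Or.inr ⟨rfl, rfl⟩, h2, h1⟩

lemma eq_of_pe_eq (hP : PetersenFibers s t C M pe) {p q q' : PV} (h : p.Adj q) (h' : p.Adj q')
    (he : pe p q = pe p q') : q = q' := by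
  have h1 := hP.link p q h
  have h2 := hP.link p q' h'
  rw [← he] at h2
  rcases h1 with ⟨h1, h3⟩ | ⟨h1, h3⟩ <;> rcases h2 with ⟨h2, h4⟩ | ⟨h2, h4⟩
  · exact h3.symm.trans h4
  · exact absurd (h2.symm.trans h1).symm h'.ne
  · exact absurd (h4.symm.trans h3).symm h'.ne
  · exact h1.symm.trans h2

lemma cross_iff (hP : PetersenFibers s t C M pe) {p q₁ q₂ q₃ : PV} (hN : p.Nbrs q₁ q₂ q₃)
    (e : E) : ¬ (M (s e) = p ↔ M (t e) = p) ↔ e = pe p q₁ ∨ e = pe p q₂ ∨ e = pe p q₃ := by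
  have key : ∀ q, p.Adj q → e = pe p q → ¬ (M (s e) = p ↔ M (t e) = p) := by
    rintro q hq rfl
    rcases hP.link p q hq with ⟨h1, h2⟩ | ⟨h1, h2⟩ <;> simp only [Function.comp] at h1 h2 <;>
      rw [h1, h2]
    · simpa using hq.ne.symm
    · simpa using hq.ne.symm
  obtain ⟨a1, a2, a3⟩ := hN.adj
  refine ⟨fun h => ?_, ?_⟩
  · have hne : M (s e) ≠ M (t e) := fun h' => h (by rw [h'])
    have hadj := hP.adj e hne
    by_cases hs : M (s e) = p
    · rw [hs] at hadj
      have := hP.unique e p _ hadj (Or.inl ⟨hs, rfl⟩)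
      rcases (hN.2.2.2 _).1 hadj with h' | h' | h' <;> rw [h'] at this <;> tauto
    · have ht : M (t e) = p := by tauto
      rw [ht] at hadj
      have := hP.unique e p _ hadj.symm (Or.inr ⟨rfl, ht⟩)
      rcases (hN.2.2.2 _).1 hadj.symm with h' | h' | h' <;> rw [h'] at this <;> tauto
  · rintro (h | h | h)
    exacts [key _ a1 h, key _ a2 h, key _ a3 h]

variable [Fintype E] [Fintype V]

/-- The three edges form the cut around the fiber of `p`. -/
lemma parity {B : Type*} [AddCommGroup B] [Module (ZMod 2) B] (hP : PetersenFibers s t C M pe)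
    {p q₁ q₂ q₃ : PV} (hN : p.Nbrs q₁ q₂ q₃)
    {g : E → B} (hg : IsFlow s t g) : g (pe p q₁) + g (pe p q₂) + g (pe p q₃) = 0 := by
  rw [← hg.cut (Finset.univ.filter fun v => M v = p)]
  have : (Finset.univ.filter fun e => ¬ (s e ∈ Finset.univ.filter (fun v => M v = p) ↔
      t e ∈ Finset.univ.filter (fun v => M v = p))) = {pe p q₁, pe p q₂, pe p q₃} := by
    ext e
    rw [mem_univ_filter, mem_univ_filter, mem_univ_filter, hP.cross_iff hN]
    simp
  obtain ⟨a1, a2, a3⟩ := hN.adj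
  rw [this, Finset.sum_insert, Finset.sum_insert, Finset.sum_singleton, add_assoc]
  · simpa using fun h => hN.2.2.1 (hP.eq_of_pe_eq a2 a3 h)
  · simp only [Finset.mem_insert, Finset.mem_singleton, not_or]
    exact ⟨fun h => hN.1 (hP.eq_of_pe_eq a1 a2 h), fun h => hN.2.1 (hP.eq_of_pe_eq a1 a3 h)⟩

end PetersenFibers

section
variable [Fintype E]

/-- An even set restricts to the vertex sets that are closed along its edges. -/
lemma IsFlow.restrict {s t : E → V} {σ : E → ZMod 2} (hσ : IsFlow s t σ) {A : Set V}
    (hA : ∀ e, σ e = 1 → (s e ∈ A ↔ t e ∈ A)) :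
    IsFlow s t fun e => if s e ∈ A then σ e else 0 := by
  have h01 : ∀ c : ZMod 2, c = 0 ∨ c = 1 := by decide
  intro v
  by_cases hv : v ∈ A
  · refine (bdry_congr_at fun e he => ?_).trans (hσ v)
    rcases h01 (σ e) with h0 | h1
    · simp [h0]
    · rw [if_pos]
      rcases he with rfl | rfl
      exacts [hv, (hA e h1).2 hv]
  · refine (bdry_congr_at fun e he => ?_).trans (bdry_zero s t v)
    rcases h01 (σ e) with h0 | h1
    · simp [h0]
    · rw [if_neg]; · rfl
      rcases he with rfl | rfl
      exacts [hv, fun h => hv ((hA e h1).1 h)]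

end

namespace PetersenFibers

variable {s t : E → V} {C : Finset E} {M : V → PV} {pe : PV → PV → E}

section
variable [Fintype E] [Fintype V]

/-- The part of `σ` in `A` is even by itself, so it contains both or none of the two edges of `σ`
that leave the fiber. This carries `A` through a fiber whose inside is unknown. -/
lemma step (hP : PetersenFibers s t C M pe) {p q₁ q₂ q₃ : PV} (hN : p.Nbrs q₁ q₂ q₃)
    {σ : E → ZMod 2} (hσ : IsFlow s t σ) {A : Set V}
    (hA : ∀ e, σ e = 1 → (s e ∈ A ↔ t e ∈ A)) (h : (σ (pe p q₁) = 1 ∧ σ (pe p q₂) = 1 ∧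
      σ (pe p q₃) = 0 ∧ s (pe p q₁) ∈ A) ) : s (pe p q₂) ∈ A := by
  have := hP.parity hN (hσ.restrict hA)
  obtain ⟨h1, h2, h3, h4⟩ := h
  simp only [h1, h2, h3, h4] at this
  by_contra hc
  simp [hc] at this

end

/-- The vertices outside of the fibers of the `x i` are connected by edges outside of these. -/
lemma conn_off (hP : PetersenFibers s t C M pe) {v v' : V} (hv : ¬ (M v).IsX)
    (hv' : ¬ (M v').IsX) :
    Reach s t (fun e => ¬ (M (s e)).IsX ∧ ¬ (M (t e)).IsX) v v' := by
  set R : E → Prop := fun e => ¬ (M (s e)).IsX ∧ ¬ (M (t e)).IsX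
  have h1 : ∀ u u', ¬ (M u).IsX → M u = M u' → Reach s t R u u' := by
    intro u u' hu huu'
    have := (hP.conn u u' huu').mem_of_closed (A := {w | M w = M u → Reach s t R u w}) (by
      intro e he
      have : M (s e) = M u → R e := fun h => by
        refine ⟨by rwa [h], by rwa [← he, h]⟩
      simp only [Set.mem_ofPred_eq, ← he]
      exact ⟨fun h h' => (h h').trans (.of_link (this h') (link_self s t e)),
        fun h h' => (h h').trans (.of_link (this h') (link_self s t e).symm)⟩)
    exact this.1 (fun _ => .refl) huu'.symm
  have h2 : ∀ u p, ¬ (M u).IsX → ¬ p.IsX → (M u).Adj p → ∃ u', M u' = p ∧ Reach s t R u u' := by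
    intro u p hu hp hadj
    obtain ⟨a, b, hl, ha, hb⟩ := hP.exists_ends hadj
    refine ⟨b, hb, (h1 u a hu ha.symm).trans (.of_link ?_ hl)⟩
    rcases hl with ⟨rfl, rfl⟩ | ⟨rfl, rfl⟩
    · exact ⟨by rwa [ha], by rwa [hb]⟩
    · exact ⟨by rwa [hb], by rwa [ha]⟩
  -- The seven other Petersen vertices are joined to `z` by the paths `l i`, `m i`, `z`, which avoid
  -- all `x i`.
  have h3 : ∀ u, ¬ (M u).IsX → ∃ u', M u' = .z ∧ Reach s t R u u' := by
    have hm : ∀ u i, M u = .m i → ∃ u', M u' = .z ∧ Reach s t R u u' := by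
      intro u i hi
      exact h2 u .z (by rw [hi]; exact PV.not_isX_m i) PV.not_isX_z
        (by rw [hi]; exact (PV.nbrs_m i).adj.1)
    intro u hu
    rcases hMu : M u with _ | i | i | i
    · exact ⟨u, hMu, .refl⟩
    · exact hm u i hMu
    · obtain ⟨w, hw, hw'⟩ := h2 u (.m i) hu (PV.not_isX_m i)
        (by rw [hMu]; exact (PV.nbrs_l i).adj.1)
      obtain ⟨w', h, h'⟩ := hm w i hw
      exact ⟨w', h, hw'.trans h'⟩
    · exact absurd ⟨i, hMu⟩ hu
  obtain ⟨u, hu, hur⟩ := h3 v hv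
  obtain ⟨u', hu', hur'⟩ := h3 v' hv'
  exact hur.trans ((h1 u u' (by rw [hu]; exact PV.not_isX_z) (hu.trans hu'.symm)).trans hur'.symm)

variable [Fintype E] [Fintype V]

/-- The even set `σ` can be changed, together with the flow `f` on `C`, so as to meet the edges at
the `x i` in any prescribed way. -/
lemma exists_modification (hP : PetersenFibers s t C M pe) (hC : IsFlow s t (ind C))
    {f : E → K4} (hf : IsFlow s t f) (hne : ∀ i q, (PV.x i).Adj q → f (pe (.x i) q) ≠ 0)
    {σ : E → ZMod 2} (hσ : IsFlow s t σ) (hz : ∀ e ∈ C, σ e = K4.isZero (f e))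
    (a b c : Fin 3 → ZMod 2) (habc : ∀ i, a i + b i + c i = 0) :
    ∃ (f' : E → K4) (σ' : E → ZMod 2), IsFlow s t f' ∧ IsFlow s t σ' ∧ (∀ e ∉ C, f' e = f e) ∧
      (∀ e ∈ C, σ' e = K4.isZero (f' e)) ∧ ∀ i, σ' (pe (.x i) (.m i)) = a i ∧
        σ' (pe (.x i) (.l (i + 1))) = b i ∧ σ' (pe (.x i) (.l (i + 2))) = c i := by
  have hζ : ∀ i, ∃ w, K4.func w (f (pe (.x i) (.m i))) = a i + σ (pe (.x i) (.m i)) ∧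
      K4.func w (f (pe (.x i) (.l (i + 1)))) = b i + σ (pe (.x i) (.l (i + 1))) ∧
      K4.func w (f (pe (.x i) (.l (i + 2)))) = c i + σ (pe (.x i) (.l (i + 2))) := by
    intro i
    obtain ⟨h1, h2, h3⟩ := (PV.nbrs_x i).adj
    refine K4.exists_func_eq _ _ _ _ _ _ (hne i _ h1) (hne i _ h2) (hne i _ h3)
      (hP.parity (PV.nbrs_x i) hf) ?_
    have := hP.parity (PV.nbrs_x i) hσ
    linear_combination habc i + this
  choose ζ hζ using hζ
  -- The edges with an end over `x i` get `ζ i`. No two `x i` are adjacent, so the sum on an edge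
  -- between fibers has at most one nonzero term.
  set θ : E → K4 := fun e => if M (s e) = M (t e) then PV.onX ζ (M (s e)) else
    PV.onX ζ (M (s e)) + PV.onX ζ (M (t e)) with hθ
  have hθ_at : ∀ v e, (M v).IsX → (s e = v ∨ t e = v) → θ e = PV.onX ζ (M v) := by
    intro v e hv he
    by_cases hin : M (s e) = M (t e)
    · rw [hθ]
      simp only [if_pos hin]
      rcases he with rfl | rfl
      exacts [rfl, by rw [hin]]
    · have hadj := hP.adj e hin
      rw [hθ]
      simp only [if_neg hin]
      rcases he with rfl | rfl
      · rw [PV.onX_of_not (p := M (t e)) fun h => hv.not_adj h hadj, add_zero]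
      · rw [PV.onX_of_not (p := M (s e)) fun h => h.not_adj hv hadj, zero_add]
  -- On `C` this is the change of the zero set predicted by `K4.isZero_add`. Around a vertex over `x
  -- i` the translation is constant, so `D` is a sum of even sets there.
  set D : E → ZMod 2 := fun e => K4.func (θ e) (f e) + K4.nonZero (θ e) * ind C e with hD
  have hDX : ∀ v, (M v).IsX → bdry s t D v = 0 := by
    intro v hv
    have h1 : bdry s t D v = bdry s t ((fun e => K4.func (PV.onX ζ (M v)) (f e)) +
        fun e => AddMonoidHom.mulLeft (K4.nonZero (PV.onX ζ (M v))) (ind C e)) v := by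
      refine bdry_congr_at fun e he => ?_
      simp [hD, hθ_at v e hv he]
    rw [h1, bdry_add, bdry_map, bdry_map, hf v, hC v, map_zero, map_zero, add_zero]
  -- All odd vertices of `D` lie off the fibers of the `x i`. They are paired up there, so neither
  -- `C` nor the Petersen edges at the `x i` are touched.
  obtain ⟨J, hJ, hJb⟩ := exists_bdry_eq (s := s) (t := t)
    (A := Finset.univ.filter fun v => ¬ (M v).IsX)
    (fun v hv v' hv' => hP.conn_off (by simpa using hv) (by simpa using hv'))
    (bdry s t D) (fun v hv => hDX v (by rw [mem_univ_filter, not_not] at hv; exact hv)) (by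
      rw [← sum_bdry_univ s t D]
      refine Finset.sum_subset (Finset.subset_univ _) fun v _ hv => hDX v ?_
      rw [mem_univ_filter, not_not] at hv; exact hv)
  refine ⟨fun e => f e + ind C e • PV.onX ζ (M (s e)), σ + (D + J), fun v => ?_, hσ.add fun v => ?_,
    fun e he => by simp [ind, he], fun e he => ?_, fun i => ?_⟩
  · have h1 : bdry s t (fun e => f e + ind C e • PV.onX ζ (M (s e))) v =
        bdry s t (f + fun e => ind C e • PV.onX ζ (M v)) v := by
      refine bdry_congr_at fun e he => ?_
      by_cases heC : e ∈ C
      · rcases he with rfl | rfl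
        · rfl
        · simp [(hP.onX e heC).1]
      · simp [ind, heC]
    rw [h1, bdry_add, bdry_smul, hf v, hC v, zero_smul, add_zero]
  · rw [bdry_add, hJb, ZModModule.add_self]
  · obtain ⟨h1, h2⟩ := hP.onX e he
    have hJ0 : J e = 0 := hJ e fun h => h.1 h2
    simp only [Pi.add_apply, hJ0, hD, hz e he, hθ_at (s e) e h2 (Or.inl rfl)]
    simp only [ind, if_pos he, one_smul, mul_one, add_zero, K4.isZero_add]
  · have key : ∀ q d, (PV.x i).Adj q → K4.func (ζ i) (f (pe (.x i) q)) = d + σ (pe (.x i) q) →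
        (σ + (D + J)) (pe (.x i) q) = d := by
      intro q d hq hd
      obtain ⟨u, w, hl, hu, hw⟩ := hP.exists_ends hq
      have hX : (M u).IsX := ⟨i, hu⟩
      have hJ0 : J (pe (.x i) q) = 0 := by
        refine hJ _ fun h => ?_
        rcases hl with ⟨h1, h2⟩ | ⟨h1, h2⟩
        · exact h.1 (by rwa [h1])
        · exact h.2 (by rwa [h2])
      have hθ' : θ (pe (.x i) q) = ζ i := by
        rw [hθ_at u _ hX (by rcases hl with h | h; exacts [Or.inl h.1, Or.inr h.2]), hu]
        rfl
      simp only [Pi.add_apply, hJ0, hD, hθ', hd, ind, if_neg (hP.not_mem hq), mul_zero, add_zero]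
      rw [add_comm d, ← add_assoc, ZModModule.add_self, zero_add]
    obtain ⟨h1, h2, h3⟩ := (PV.nbrs_x i).adj
    exact ⟨key _ _ h1 (hζ i).1, key _ _ h2 (hζ i).2.1, key _ _ h3 (hζ i).2.2⟩

end PetersenFibers

end

end EdgeEnds

/-! ### Series edges within fibers and the cover with six members -/

namespace EdgeEnds

noncomputable section

open scoped Classical

variable {V W E : Type*} [Fintype E]

/-- A connected set of `n` vertices spans at least `n - 1` edges. -/
lemma Reach.card_le {s t : E → W} {R : E → Prop} {a : W} {A : Finset W}
    (hA : ∀ b, b ∈ A ↔ Reach s t R a b) :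
    A.card ≤ (Finset.univ.filter fun e => R e ∧ s e ≠ t e ∧ s e ∈ A ∧ t e ∈ A).card + 1 := by
  have key : ∀ n, n + 1 ≤ A.card → ∃ B ⊆ A, a ∈ B ∧ B.card = n + 1 ∧
      n ≤ (Finset.univ.filter fun e => R e ∧ s e ≠ t e ∧ s e ∈ B ∧ t e ∈ B).card := by
    intro n
    induction n with
    | zero =>
      intro _
      exact ⟨{a}, by simpa using (hA a).2 .refl, by simp, by simp, Nat.zero_le _⟩
    | succ n ih =>
      intro hn
      obtain ⟨B, hBA, haB, hB, hle⟩ := ih (by omega)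
      have hex : ∃ e u, R e ∧ Link s t e u (if s e = u then t e else s e) ∧ u ∈ B ∧
          (if s e = u then t e else s e) ∉ B := by
        by_contra! hcon
        have hcl : ∀ e, R e → (s e ∈ (B : Set W) ↔ t e ∈ (B : Set W)) := by
          intro e he
          constructor
          · intro h
            have := hcon e (s e) he (by simp [Link]) h
            simpa using this
          · intro h
            have := hcon e (t e) he (by by_cases hst : s e = t e <;> simp [Link, hst]) h
            by_cases hst : s e = t e
            · rw [hst]; exact h
            · simpa [hst] using this
        have : A ⊆ B := fun b hb => (((hA b).1 hb).mem_of_closed hcl).1 haB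
        have := Finset.card_le_card this
        omega
      obtain ⟨e, u, he, hl, hu, hw⟩ := hex
      set w := if s e = u then t e else s e
      have hwA : w ∈ A := (hA w).2 (((hA u).1 (hBA hu)).trans (.of_link he hl))
      have hne : s e ≠ t e := by
        rintro h
        rcases hl with ⟨h1, h2⟩ | ⟨h1, h2⟩
        · exact hw (by rw [← h2, ← h, h1]; exact hu)
        · exact hw (by rw [← h1, h, h2]; exact hu)
      refine ⟨insert w B, ?_, by simp [haB], by rw [Finset.card_insert_of_notMem hw, hB], ?_⟩
      · intro b hb
        rcases Finset.mem_insert.1 hb with rfl | hb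
        exacts [hwA, hBA hb]
      · have hsub : insert e (Finset.univ.filter fun e => R e ∧ s e ≠ t e ∧ s e ∈ B ∧ t e ∈ B) ⊆
            Finset.univ.filter fun e => R e ∧ s e ≠ t e ∧ s e ∈ insert w B ∧ t e ∈ insert w B := by
          intro e' he'
          rw [mem_univ_filter]
          rcases Finset.mem_insert.1 he' with rfl | he'
          · refine ⟨he, hne, ?_⟩
            rcases hl with ⟨h1, h2⟩ | ⟨h1, h2⟩
            · rw [h1, h2]; exact ⟨by simp [hu], by simp⟩
            · rw [h1, h2]; exact ⟨by simp, by simp [hu]⟩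
          · rw [mem_univ_filter] at he'
            exact ⟨he'.1, he'.2.1, by simp [he'.2.2.1], by simp [he'.2.2.2]⟩
        refine le_trans ?_ (Finset.card_le_card hsub)
        rw [Finset.card_insert_of_notMem]
        · omega
        · rw [mem_univ_filter]
          rintro ⟨-, -, h1, h2⟩
          rcases hl with ⟨-, h⟩ | ⟨h, -⟩
          · exact hw (h ▸ h2)
          · exact hw (h ▸ h1)
  rcases Nat.eq_zero_or_pos A.card with h0 | hpos
  · omega
  obtain ⟨B, hBA, -, hB, hle⟩ := key (A.card - 1) (by omega)
  have : B = A := Finset.eq_of_subset_of_card_le hBA (by omega)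
  subst this
  omega

/-- The two edges of a cut are in series. -/
lemma Series.of_cut {s t : E → W} {A : Finset W} {g h : E} (hgh : g ≠ h)
    (hA : ∀ e, ¬ (s e ∈ A ↔ t e ∈ A) ↔ e = g ∨ e = h) [Fintype W] : Series s t g h := by
  intro f hf
  have := hf.cut A
  have hset : (Finset.univ.filter fun e => ¬ (s e ∈ A ↔ t e ∈ A)) = {g, h} := by
    ext e
    rw [mem_univ_filter, hA]
    simp
  rw [hset, Finset.sum_pair hgh] at this
  exact eq_of_add_eq_zero_two this

lemma not_iff_of_imp {a b c d : Prop} (h1 : a → c) (h2 : b → d) (h3 : c → d → (a ↔ b)) :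
    ¬ (a ↔ b) ↔ ¬ (c ↔ d) ∧ (a ∨ b) := by
  by_cases ha : a <;> by_cases hb : b <;> by_cases hc : c <;> by_cases hd : d <;>
    simp [ha, hb, hc, hd] at h1 h2 h3 ⊢

lemma not_iff_diff_of_imp {a b c d : Prop} (h1 : a → c) (h2 : b → d) (h3 : c → d → (a ↔ b)) :
    ¬ (c ∧ ¬ a ↔ d ∧ ¬ b) ↔ ¬ (c ↔ d) ∧ ¬ (a ∨ b) := by
  by_cases ha : a <;> by_cases hb : b <;> by_cases hc : c <;> by_cases hd : d <;>
    simp [ha, hb, hc, hd] at h1 h2 h3 ⊢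

/-- In a part of the forest that is left by exactly three edges, every edge is in series with one
of the three. -/
lemma Feedback.series [Fintype W] {s t : E → W} {X F : Finset W} (h : Feedback s t X)
    (hF : Disjoint F X) {e₁ e₂ e₃ : E} (hcross : ∀ e, ¬ (s e ∈ F ↔ t e ∈ F) ↔
      e = e₁ ∨ e = e₂ ∨ e = e₃) {g : E} (hg : s g ≠ t g) (hs : s g ∈ F) (ht : t g ∈ F) :
    Series s t g e₁ ∨ Series s t g e₂ ∨ Series s t g e₃ := by
  set R : E → Prop := fun e => e ≠ g ∧ s e ∈ F ∧ t e ∈ F with hR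
  set A : Finset W := Finset.univ.filter fun w => Reach s t R (s g) w with hAdef
  have hA : ∀ w, w ∈ A ↔ Reach s t R (s g) w := fun w => by rw [hAdef, mem_univ_filter]
  have hsA : s g ∈ A := (hA _).2 .refl
  have hAF : ∀ w ∈ A, w ∈ F := fun w hw =>
    (((hA w).1 hw).mem_of_closed (A := (F : Set W)) fun e he => by simp [he.2.1, he.2.2]).1 hs
  have hclosed : ∀ e, e ≠ g → s e ∈ F → t e ∈ F → (s e ∈ A ↔ t e ∈ A) := fun e h1 h2 h3 => by
    rw [hA, hA]
    exact ⟨fun h => h.trans (.of_link ⟨h1, h2, h3⟩ (link_self s t e)),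
      fun h => h.trans (.of_link ⟨h1, h2, h3⟩ (link_self s t e).symm)⟩
  -- The edge `g` is a bridge of the part of the forest on `F`: otherwise `A` would span `A.card -
  -- 1` edges and `g` in addition.
  have htA : t g ∉ A := by
    intro htA
    obtain ⟨K, hK, h1⟩ : ∃ K : Finset E, (∀ e, e ∈ K ↔ R e ∧ s e ≠ t e ∧ s e ∈ A ∧ t e ∈ A) ∧
        A.card ≤ K.card + 1 := ⟨_, fun e => mem_univ_filter, Reach.card_le hA⟩
    have h2 := h.forest A ⟨_, hsA⟩ (Finset.disjoint_left.2 fun w hw hX =>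
      Finset.disjoint_left.1 hF (hAF w hw) hX)
    have hsub : insert g K ⊆
        Finset.univ.filter fun e => s e ≠ t e ∧ s e ∈ A ∧ t e ∈ A := by
      intro e he
      rw [mem_univ_filter]
      rcases Finset.mem_insert.1 he with rfl | he
      · exact ⟨hg, hsA, htA⟩
      · exact ((hK e).1 he).2
    have h3 := Finset.card_le_card hsub
    rw [Finset.card_insert_of_notMem (fun h => ((hK g).1 h).1.1 rfl)] at h3
    omega
  have hgF : ∀ e, ¬ (s e ∈ F ↔ t e ∈ F) → e ≠ g := by
    rintro e he rfl
    exact he (by simp [hs, ht])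
  have hFu : ∀ B ⊆ F, B ≠ Finset.univ := by
    rintro B hB rfl
    exact (hcross e₁).2 (Or.inl rfl) (by simp [hB (Finset.mem_univ _)])
  have hc₁ : ∀ e, ¬ (s e ∈ A ↔ t e ∈ A) ↔
      e = g ∨ ¬ (s e ∈ F ↔ t e ∈ F) ∧ (s e ∈ A ∨ t e ∈ A) := by
    intro e
    by_cases heg : e = g
    · subst heg; simp [hsA, htA]
    · rw [not_iff_of_imp (hAF (s e)) (hAF (t e)) (hclosed e heg)]
      simp [heg]
  have hc₂ : ∀ e, ¬ (s e ∈ F \ A ↔ t e ∈ F \ A) ↔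
      e = g ∨ ¬ (s e ∈ F ↔ t e ∈ F) ∧ ¬ (s e ∈ A ∨ t e ∈ A) := by
    intro e
    rw [Finset.mem_sdiff, Finset.mem_sdiff]
    by_cases heg : e = g
    · subst heg; simp [hsA, htA, hs, ht]
    · rw [not_iff_diff_of_imp (hAF (s e)) (hAF (t e)) (hclosed e heg)]
      simp [heg]
  have split : ∀ P : E → Prop, (∀ e, e = g ∨ ¬ (s e ∈ F ↔ t e ∈ F) ∧ P e ↔
      e = g ∨ e = e₁ ∧ P e₁ ∨ e = e₂ ∧ P e₂ ∨ e = e₃ ∧ P e₃) := by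
    intro P e
    rw [hcross]
    refine or_congr Iff.rfl ⟨?_, ?_⟩
    · rintro ⟨rfl | rfl | rfl, h⟩
      exacts [Or.inl ⟨rfl, h⟩, Or.inr (Or.inl ⟨rfl, h⟩), Or.inr (Or.inr ⟨rfl, h⟩)]
    · rintro (⟨rfl, h⟩ | ⟨rfl, h⟩ | ⟨rfl, h⟩)
      exacts [⟨Or.inl rfl, h⟩, ⟨Or.inr (Or.inl rfl), h⟩, ⟨Or.inr (Or.inr rfl), h⟩]
  simp only [split fun e => s e ∈ A ∨ t e ∈ A] at hc₁
  simp only [split fun e => ¬ (s e ∈ A ∨ t e ∈ A)] at hc₂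
  have n1 := (hgF e₁ ((hcross _).2 (Or.inl rfl))).symm
  have n2 := (hgF e₂ ((hcross _).2 (Or.inr (Or.inl rfl)))).symm
  have n3 := (hgF e₃ ((hcross _).2 (Or.inr (Or.inr rfl)))).symm
  have hone : ∀ B : Finset W, B.Nonempty → B ⊆ F →
      (∀ e, ¬ (s e ∈ B ↔ t e ∈ B) ↔ e = g) → False := by
    intro B hB hBF hBc
    have h1 := h.cut B hB (hFu B hBF)
    have h2 : (Finset.univ.filter fun e => ¬ (s e ∈ B ↔ t e ∈ B)) = {g} := by
      ext e
      rw [mem_univ_filter, hBc]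
      simp
    rw [h2] at h1
    simp at h1
  -- Each of the three leaving edges belongs to one side of `g`. A side with none would make `g` a
  -- bridge of the whole graph, so one side has exactly one, which forms a cut of two edges with
  -- `g`.
  by_cases c1 : s e₁ ∈ A ∨ t e₁ ∈ A <;> by_cases c2 : s e₂ ∈ A ∨ t e₂ ∈ A <;>
    by_cases c3 : s e₃ ∈ A ∨ t e₃ ∈ A <;>
    simp only [c1, c2, c3, not_true, not_false_iff, and_true, and_false, or_false, false_or]
      at hc₁ hc₂
  · exact (hone _ ⟨t g, Finset.mem_sdiff.2 ⟨ht, htA⟩⟩ Finset.sdiff_subset hc₂).elim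
  · exact Or.inr (Or.inr (.of_cut n3 hc₂))
  · exact Or.inr (Or.inl (.of_cut n2 hc₂))
  · exact Or.inl (.of_cut n1 hc₁)
  · exact Or.inl (.of_cut n1 hc₂)
  · exact Or.inr (Or.inl (.of_cut n2 hc₁))
  · exact Or.inr (Or.inr (.of_cut n3 hc₁))
  · exact (hone _ ⟨s g, hsA⟩ hAF hc₁).elim

section Six
variable [Fintype V] {s t : E → V} {C : Finset E} {N : Finset V} {M : V → PV} {pe : PV → PV → E}

/-- A flow that vanishes only on edges in series with the edge between the fibers of `m 0` and
`l 0` yields a cover with six members. -/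
lemma PetersenFibers.hasCover_six (hP : PetersenFibers s t C M pe) (h : TreeCycle s t C N)
    {f : E → K4} {σ : E → ZMod 2} (hf : IsFlow s t f) (hσ : IsFlow s t σ)
    (hz : ∀ e ∈ C, σ e = K4.isZero (f e)) (hf0 : f (pe (.m 0) (.l 0)) = 0)
    (hR : ∀ e ∉ C, f e = 0 → Series s t e (pe (.m 0) (.l 0)))
    (hne : ∀ i q, (PV.x i).Adj q → f (pe (.x i) q) ≠ 0)
    (hser : ∀ g, s g ≠ t g → M (s g) = M (t g) → ¬ (M (s g)).IsX →
      ∃ q, (M (s g)).Adj q ∧ Series s t g (pe (M (s g)) q)) : HasCover s t C 6 := by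
  -- With these values `σ'` meets the Petersen edges in the 8-circuit `m 0, x 0, l 1, x 2, l 0, x 1,
  -- m 1, z`, and the edge between `m 0` and `l 0` is a chord.
  obtain ⟨f', σ', hf', hσ', hff', hz', hx⟩ := hP.exists_modification h.even hf hne hσ hz
    ![1, 1, 0] ![1, 0, 1] ![0, 1, 1] (by decide)
  obtain ⟨x0m, x0l1, x0l2⟩ := hx 0
  obtain ⟨x1m, x1l2, x1l0⟩ := hx 1
  obtain ⟨x2m, x2l0, x2l1⟩ := hx 2
  have N0 := PV.nbrs_x 0
  have N2 := PV.nbrs_x 2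
  have L0 := PV.nbrs_l 0
  have L1 := PV.nbrs_l 1
  have M0 := PV.nbrs_m 0
  simp only [zero_add, show (1 : Fin 3) + 1 = 2 from rfl, show (1 : Fin 3) + 2 = 0 from rfl,
    show (2 : Fin 3) + 1 = 0 from rfl, show (2 : Fin 3) + 2 = 1 from rfl] at *
  replace x0m : σ' (pe (.x 0) (.m 0)) = 1 := x0m
  replace x0l1 : σ' (pe (.x 0) (.l 1)) = 1 := x0l1
  replace x0l2 : σ' (pe (.x 0) (.l 2)) = 0 := x0l2
  replace x1l0 : σ' (pe (.x 1) (.l 0)) = 1 := x1l0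
  replace x2m : σ' (pe (.x 2) (.m 2)) = 0 := x2m
  replace x2l0 : σ' (pe (.x 2) (.l 0)) = 1 := x2l0
  replace x2l1 : σ' (pe (.x 2) (.l 1)) = 1 := x2l1
  rw [← hP.symm M0.adj.2.2] at x0m
  rw [← hP.symm L1.adj.2.2] at x0l1
  rw [← hP.symm L0.adj.2.1] at x1l0
  rw [← hP.symm L0.adj.2.2] at x2l0
  rw [← hP.symm L1.adj.2.1] at x2l1
  have he0 : σ' (pe (.m 0) (.l 0)) = 0 := by
    have := hP.parity L0 hσ'
    rw [x1l0, x2l0, add_assoc, ZModModule.add_self, add_zero] at this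
    rw [hP.symm M0.adj.2.1, this]
  have hl1 : σ' (pe (.l 1) (.m 1)) = 0 := by
    have := hP.parity L1 hσ'
    rwa [x2l1, x0l1, add_assoc, ZModModule.add_self, add_zero] at this
  have hm0 : σ' (pe (.m 0) .z) = 1 := by
    have := hP.parity M0 hσ'
    rw [he0, x0m, add_zero] at this
    exact eq_of_add_eq_zero_two this
  obtain ⟨a, b, hab, ha, hb⟩ := hP.exists_ends M0.adj.2.1
  set e₀ := pe (.m 0) (.l 0) with he₀
  have he₀C : e₀ ∉ C := hP.not_mem M0.adj.2.1
  have hf0' : f' e₀ = 0 := by rw [hff' e₀ he₀C, hf0]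
  have hR' : ∀ e ∉ C, f' e = 0 → Series s t e e₀ := fun e he h0 => hR e he (by rwa [← hff' e he])
  -- These are the edges that `δ` may use besides `e₀`. A path of them between the ends of `e₀`
  -- closes up to the required even set.
  set Q : E → Prop := fun e => e ≠ e₀ ∧ (σ' e = 1 ∨ e ∉ C ∧ f' e = 0) with hQ
  by_cases hreach : Reach s t Q a b
  · obtain ⟨g, hg, hgb⟩ := hreach.exists_join
    have hδ : IsFlow s t (g + Pi.single e₀ 1) := fun v => by
      rw [bdry_add, hgb, bdry_single hab, ZModModule.add_self]
    have hδ0 : (g + Pi.single e₀ (1 : ZMod 2) : E → ZMod 2) e₀ = 1 := by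
      simp [hg e₀ fun h => h.1 rfl]
    refine h.hasCover_six hf' hσ' hz' hδ (fun e he h1 => ?_) fun e he h0 => ?_
    · have hee : e ≠ e₀ := by
        rintro rfl
        exact he.elim (fun h => h hf0') he₀C
      have hQe : Q e := by
        by_contra hQe
        simp [hg e hQe, hee] at h1
      rcases hQe.2 with h2 | ⟨h2, h3⟩
      · exact h2
      · exact (he.elim (fun h => h h3) h2).elim
    · have := hR' e he h0
      exact ⟨(this σ' hσ').trans he0, (this _ hδ).trans hδ0⟩
  -- Otherwise follow the set `A` reached from `a` along the arc `m 0, x 0, l 1, x 2, l 0`; it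
  -- arrives at `b` after all.
  exfalso
  set A : Set V := {v | Reach s t Q a v} with hAdef
  have hAQ : ∀ e, Q e → (s e ∈ A ↔ t e ∈ A) := fun e he =>
    ⟨fun h => Reach.trans h (.of_link he (link_self s t e)),
      fun h => Reach.trans h (.of_link he (link_self s t e).symm)⟩
  have hA : ∀ e, σ' e = 1 → (s e ∈ A ↔ t e ∈ A) := fun e he =>
    hAQ e ⟨by rintro rfl; rw [he0] at he; exact zero_ne_one he, Or.inl he⟩
  -- A nonloop edge within the fiber is in series with one of the three leaving edges. If each of
  -- these is `e₀` or in `σ'`, the edge is a zero of `f'` off `C` or lies in `σ'`, so `A` contains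
  -- all or nothing of the fiber.
  have hfib : ∀ p : PV, ¬ p.IsX → (∀ q, p.Adj q → pe p q = e₀ ∨ σ' (pe p q) = 1) →
      ∀ v v', M v = p → M v' = p → v ∈ A → v' ∈ A := by
    intro p hp hpe v v' hv hv' hvA
    refine ((hP.conn v v' (hv.trans hv'.symm)).mem_of_closed (A := {w | M w = p → w ∈ A})
      fun e he => ?_).1 (fun _ => hvA) hv'
    by_cases hep : M (s e) = p
    · have : s e ∈ A ↔ t e ∈ A := by
        by_cases hl : s e = t e
        · rw [hl]
        obtain ⟨q, hq, hs⟩ := hser e hl he (by rwa [hep])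
        rw [hep] at hq hs
        have hee : e ≠ e₀ := by
          rintro rfl
          exact hP.inner_ne M0.adj.2.1 he
        refine hAQ e ⟨hee, ?_⟩
        rcases hpe q hq with h' | h'
        · refine Or.inr ⟨fun hC => hp ?_, ?_⟩
          · rw [← hep]; exact (hP.onX e hC).2
          · rw [h'] at hs
            rw [hs.eq_K4 hf', hf0']
        · exact Or.inl ((hs σ' hσ').trans h')
      simpa [Set.mem_ofPred_eq, ← he, hep] using this
    · simp [Set.mem_ofPred_eq, ← he, hep]
  have hend : ∀ p q, p.Adj q → σ' (pe p q) = 1 → ∃ u, M u = p ∧ (u ∈ A ↔ s (pe p q) ∈ A) := by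
    intro p q hpq h1
    obtain ⟨u, w, hl, hu, hw⟩ := hP.exists_ends hpq
    refine ⟨u, hu, ?_⟩
    rcases hl with ⟨rfl, -⟩ | ⟨-, rfl⟩
    · rfl
    · exact (hA _ h1).symm
  obtain ⟨u, hu, hu'⟩ := hend _ _ M0.adj.2.2 x0m
  have s1 : s (pe (.m 0) (.x 0)) ∈ A := by
    refine hu'.1 (hfib (.m 0) (PV.not_isX_m 0) (fun q hq => ?_) a u ha hu .refl)
    rcases (M0.2.2.2 q).1 hq with rfl | rfl | rfl
    exacts [Or.inr hm0, Or.inl rfl, Or.inr x0m]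
  have s2 : s (pe (.l 1) (.x 0)) ∈ A := by
    rw [hP.symm M0.adj.2.2] at s1 x0m
    rw [hP.symm L1.adj.2.2] at x0l1 ⊢
    exact hP.step N0 hσ' hA ⟨x0m, x0l1, x0l2, s1⟩
  have L1' : PV.Nbrs (.l 1) (.x 0) (.x 2) (.m 1) := by unfold PV.Nbrs; decide
  have N2' : PV.Nbrs (.x 2) (.l 1) (.l 0) (.m 2) := by unfold PV.Nbrs; decide
  have s3 : s (pe (.l 1) (.x 2)) ∈ A := hP.step L1' hσ' hA ⟨x0l1, x2l1, hl1, s2⟩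
  have s4 : s (pe (.l 0) (.x 2)) ∈ A := by
    rw [hP.symm L1.adj.2.1] at s3 x2l1
    rw [hP.symm L0.adj.2.2] at x2l0 ⊢
    exact hP.step N2' hσ' hA ⟨x2l1, x2l0, x2m, s3⟩
  obtain ⟨w, hw, hw'⟩ := hend _ _ L0.adj.2.2 x2l0
  refine hreach (hfib (.l 0) (PV.not_isX_l 0) (fun q hq => ?_) w b hw hb (hw'.2 s4))
  rcases (L0.2.2.2 q).1 hq with rfl | rfl | rfl
  exacts [Or.inl (hP.symm M0.adj.2.1).symm, Or.inr x1l0, Or.inr x2l0]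

end Six

/-- A contraction to the Petersen graph with a near flow yields a cover with six members. -/
lemma TreeCycle.hasCover_of_petersen [Fintype V] [Fintype W] {s t : E → V} {C : Finset E}
    {N : Finset V} (h : TreeCycle s t C N) {π : V → W}
    (hπ : ∀ u v, π u = π v ↔ Reach s t (· ∈ C) u v) {X : Finset W} (hX : ∀ e ∈ C, π (s e) ∈ X)
    (hfb : Feedback (π ∘ s) (π ∘ t) X) {m : W → PV} {e₀ : E} {f₀ : E → K4}
    (hm : PetersenContraction (π ∘ s) (π ∘ t) X m) (hf₀ : IsNearFlow (π ∘ s) (π ∘ t) m e₀ f₀) :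
    HasCover s t C 6 := by
  have hpe : ∀ p q, ∃ e, p.Adj q → Link (m ∘ π ∘ s) (m ∘ π ∘ t) e p q ∧
      ∀ e', Link (m ∘ π ∘ s) (m ∘ π ∘ t) e' p q → e' = e := by
    intro p q
    by_cases hpq : p.Adj q
    · obtain ⟨e, h1, h2⟩ := hm.edge p q hpq
      exact ⟨e, fun _ => ⟨h1, h2⟩⟩
    · exact ⟨e₀, fun h => absurd h hpq⟩
  choose pe hpe using hpe
  have hloop : ∀ e ∈ C, π (s e) = π (t e) := fun e he =>
    (hπ _ _).2 (.of_link he (link_self s t e))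
  have hP : PetersenFibers s t C (m ∘ π) pe := by
    refine ⟨fun v v' hv => ?_, fun p q hpq => (hpe p q hpq).1, fun e p q hpq => (hpe p q hpq).2 e,
      hm.adj, fun e he => ⟨congrArg m (hloop e he), hm.mapX _ (hX e he)⟩⟩
    refine Reach.lift (μ := π) (fun u u' hu => ?_) (hm.conn _ _ hv) v' rfl
    exact ((hπ u u').1 hu).mono fun e he => congrArg m (hloop e he)
  have hm0 := (PV.nbrs_m 0).adj.2.1
  have he₀ : e₀ = pe (.m 0) (.l 0) := hP.unique _ _ _ hm0 hf₀.link
  subst he₀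
  have hnl : ∀ p q, p.Adj q → π (s (pe p q)) ≠ π (t (pe p q)) := fun p q hpq h' =>
    hP.inner_ne hpq (congrArg m h')
  obtain ⟨f, h1, h2, h3⟩ := h.exists_flow hπ
    (f₀ := fun e => if π (s e) = π (t e) then (1, 0) else f₀ e) (fun v => by
      rw [← hf₀.flow v]
      exact bdry_congr_nonloop (fun e he => if_neg he) v)
  obtain ⟨σ, h4, h5⟩ := h.exists_even h3
  have hfpe : ∀ p q, p.Adj q → f (pe p q) = f₀ (pe p q) := fun p q hpq => by
    rw [h2 _ (hP.not_mem hpq), if_neg (hnl p q hpq)]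
  refine hP.hasCover_six h h1 h4 h5 ((hfpe _ _ hm0).trans hf₀.zero) (fun e he h0 => ?_)
    (fun i q hq h0 => ?_) fun g hg hin hgX => ?_
  · rw [h2 e he] at h0
    split_ifs at h0 with hl
    · exact absurd h0 (by decide)
    · exact (hf₀.series e hl h0).comap
  · rw [hfpe _ _ hq] at h0
    have := hf₀.eq_of_zero _ (hP.inner_ne hq) h0
    have hl := hP.link _ _ hq
    rw [this] at hl
    rcases hl with ⟨h6, h7⟩ | ⟨h6, h7⟩ <;> rcases hf₀.link with ⟨h8, h9⟩ | ⟨h8, h9⟩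
    · exact absurd (h6.symm.trans h8) (by simp)
    · exact absurd (h6.symm.trans h8) (by simp)
    · exact absurd (h7.symm.trans h9) (by simp)
    · exact absurd (h7.symm.trans h9) (by simp)
  · obtain ⟨q₁, q₂, q₃, hN⟩ := PV.exists_nbrs (m (π (s g)))
    -- If `π` identified the ends of the nonloop `g`, an edge of `C` would be at `s g`, and the
    -- fiber would be that of some `x i`.
    have hg' : π (s g) ≠ π (t g) := by
      intro hgg
      have hr := (hπ _ _).1 hgg
      rcases Relation.ReflTransGen.cases_head hr with h' | ⟨c, ⟨e, he, hl⟩, -⟩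
      · exact hg h'
      · refine hgX (hm.mapX _ ?_)
        rcases hl with ⟨h6, -⟩ | ⟨-, h6⟩
        · rw [← h6]; exact hX e he
        · rw [← h6, ← hloop e he]; exact hX e he
    have hdis : Disjoint (Finset.univ.filter fun w => m w = m (π (s g))) X := by
      refine Finset.disjoint_left.2 fun w hw hwX => hgX ?_
      rw [mem_univ_filter] at hw
      obtain ⟨i, hi⟩ := hm.mapX w hwX
      exact ⟨i, hw.symm.trans hi⟩
    have := hfb.series hdis (fun e => by
      rw [mem_univ_filter, mem_univ_filter]
      exact hP.cross_iff hN e) hg' (by rw [mem_univ_filter]; rfl)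
      (by rw [mem_univ_filter]; exact hin.symm)
    rcases this with h' | h' | h'
    · exact ⟨q₁, hN.adj.1, h'.comap⟩
    · exact ⟨q₂, hN.adj.2.1, h'.comap⟩
    · exact ⟨q₃, hN.adj.2.2, h'.comap⟩

end

end EdgeEnds

/-! ### Circuits in graphs with as many edges as vertices -/

namespace EdgeEnds

noncomputable section

open scoped Classical

variable {V E : Type*} [Fintype E]

/-- The indicator function of an edge set, with natural numbers as values. -/
def indN (K : Finset E) (e : E) : ℕ := if e ∈ K then 1 else 0

lemma sum_bdry_indN {s t : E → V} {K : Finset E} {U : Finset V}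
    (hK : ∀ e ∈ K, s e ∈ U ∧ t e ∈ U) : ∑ v ∈ U, bdry s t (indN K) v = 2 * K.card := by
  rw [sum_bdry, Finset.card_eq_sum_ones, Finset.mul_sum, ← Finset.sum_subset (Finset.subset_univ K)]
  · refine Finset.sum_congr rfl fun e he => ?_
    simp [indN, he, (hK e he).1, (hK e he).2]
  · intro e _ he
    simp [indN, he]

lemma card_le_bdry_indN (s t : E → V) (K : Finset E) (v : V) :
    (K.filter fun e => s e = v ∨ t e = v).card ≤ bdry s t (indN K) v := by
  rw [Finset.card_eq_sum_ones, bdry]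
  refine (Finset.sum_le_sum fun e he => ?_).trans
    (Finset.sum_le_sum_of_subset (Finset.subset_univ _))
  obtain ⟨h1, h2 | h2⟩ := Finset.mem_filter.1 he <;> simp [indN, h1, h2]

/-- A graph with at least as many edges as vertices contains a connected 2-regular graph. -/
lemma exists_two_regular {s t : E → V} (n : ℕ) : ∀ (U : Finset V) (K : Finset E),
    U.card + K.card ≤ n → U.Nonempty → (∀ e ∈ K, s e ∈ U ∧ t e ∈ U) → U.card ≤ K.card →
    ∃ (U' : Finset V) (K' : Finset E), K' ⊆ K ∧ U'.Nonempty ∧ (∀ e ∈ K', s e ∈ U' ∧ t e ∈ U') ∧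
      (∀ v ∈ U', bdry s t (indN K') v = 2) ∧ ∀ a ∈ U', ∀ b ∈ U', Reach s t (· ∈ K') a b := by
  induction n with
  | zero =>
    intro U K hn hU
    have := hU.card_pos
    omega
  | succ n ih =>
    intro U K hn hU hK hcard
    have ih' : ∀ (U₁ : Finset V) (K₁ : Finset E), U₁.card + K₁.card ≤ n → U₁.Nonempty →
        (∀ e ∈ K₁, s e ∈ U₁ ∧ t e ∈ U₁) → U₁.card ≤ K₁.card → K₁ ⊆ K →
        ∃ (U' : Finset V) (K' : Finset E), K' ⊆ K ∧ U'.Nonempty ∧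
          (∀ e ∈ K', s e ∈ U' ∧ t e ∈ U') ∧ (∀ v ∈ U', bdry s t (indN K') v = 2) ∧
          ∀ a ∈ U', ∀ b ∈ U', Reach s t (· ∈ K') a b := by
      intro U₁ K₁ h1 h2 h3 h4 h5
      obtain ⟨U', K', h, h'⟩ := ih U₁ K₁ h1 h2 h3 h4
      exact ⟨U', K', h.trans h5, h'⟩
    have hUpos := hU.card_pos
    obtain ⟨e₁, he₁⟩ : K.Nonempty := Finset.card_pos.1 (by omega)
    rcases hcard.lt_or_eq with hlt | heq
    · have := Finset.card_erase_of_mem he₁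
      exact ih' U (K.erase e₁) (by omega) hU (fun e he => hK e (Finset.mem_of_mem_erase he))
        (by omega) (Finset.erase_subset _ _)
    -- Now there are equally many edges and vertices. A vertex of degree at most one is removed with
    -- its edge; if there is none, the average degree two forces all degrees to be two.
    by_cases hdeg : ∃ v ∈ U, bdry s t (indN K) v ≤ 1
    · obtain ⟨v, hv, hdv⟩ := hdeg
      have h1 := card_le_bdry_indN s t K v
      have h2 := Finset.card_filter_add_card_filter_not (s := K) (fun e => s e = v ∨ t e = v)
      have h3 := Finset.card_erase_of_mem hv
      refine ih' (U.erase v) (K.filter fun e => ¬ (s e = v ∨ t e = v)) (by omega) ?_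
        (fun e he => ?_) (by omega) (Finset.filter_subset _ _)
      · rw [Finset.nonempty_iff_ne_empty]
        intro h0
        have hUv : ∀ u ∈ U, u = v := fun u hu => by
          by_contra hne
          exact Finset.notMem_empty u (h0 ▸ Finset.mem_erase.2 ⟨hne, hu⟩)
        have hle : (if s e₁ = v then indN K e₁ else 0) + (if t e₁ = v then indN K e₁ else 0) ≤
            bdry s t (indN K) v :=
          Finset.single_le_sum (f := fun e => (if s e = v then indN K e else 0) +
            (if t e = v then indN K e else 0)) (fun _ _ => Nat.zero_le _) (Finset.mem_univ e₁)
        rw [if_pos (hUv _ (hK e₁ he₁).1), if_pos (hUv _ (hK e₁ he₁).2),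
          show indN K e₁ = 1 by simp [indN, he₁]] at hle
        omega
      · obtain ⟨h4, h5⟩ := Finset.mem_filter.1 he
        rw [not_or] at h5
        exact ⟨Finset.mem_erase.2 ⟨h5.1, (hK e h4).1⟩, Finset.mem_erase.2 ⟨h5.2, (hK e h4).2⟩⟩
    push Not at hdeg
    have htwo : ∀ v ∈ U, bdry s t (indN K) v = 2 := by
      intro v hv
      by_contra hne
      have h1 : ∑ u ∈ U, 2 < ∑ u ∈ U, bdry s t (indN K) u :=
        Finset.sum_lt_sum (fun u hu => hdeg u hu) ⟨v, hv, lt_of_le_of_ne (hdeg v hv) (Ne.symm hne)⟩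
      rw [sum_bdry_indN hK, Finset.sum_const, smul_eq_mul] at h1
      omega
    by_cases hconn : ∀ a ∈ U, ∀ b ∈ U, Reach s t (· ∈ K) a b
    · exact ⟨U, K, Finset.Subset.refl _, hU, hK, htwo, hconn⟩
    push Not at hconn
    obtain ⟨a, ha, b, hb, hab⟩ := hconn
    have hcl : ∀ e ∈ K, (Reach s t (· ∈ K) a (s e) ↔ Reach s t (· ∈ K) a (t e)) := fun e he =>
      ⟨fun h => h.trans (.of_link he (link_self s t e)),
        fun h => h.trans (.of_link he (link_self s t e).symm)⟩
    have h1 := Finset.card_filter_add_card_filter_not (s := U) (fun u => Reach s t (· ∈ K) a u)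
    have h2 := Finset.card_filter_add_card_filter_not (s := K)
      (fun e => Reach s t (· ∈ K) a (s e))
    have h3 : (U.filter fun u => Reach s t (· ∈ K) a u).Nonempty :=
      ⟨a, Finset.mem_filter.2 ⟨ha, .refl⟩⟩
    have h4 : (U.filter fun u => ¬ Reach s t (· ∈ K) a u).Nonempty :=
      ⟨b, Finset.mem_filter.2 ⟨hb, hab⟩⟩
    have h5 := h3.card_pos
    have h6 := h4.card_pos
    -- One of the two parts still has at least as many edges as vertices.
    by_cases hle : (U.filter fun u => Reach s t (· ∈ K) a u).card ≤
        (K.filter fun e => Reach s t (· ∈ K) a (s e)).card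
    · refine ih' _ _ (by omega) h3 (fun e he => ?_) hle (Finset.filter_subset _ _)
      obtain ⟨h7, h8⟩ := Finset.mem_filter.1 he
      exact ⟨Finset.mem_filter.2 ⟨(hK e h7).1, h8⟩,
        Finset.mem_filter.2 ⟨(hK e h7).2, (hcl e h7).1 h8⟩⟩
    · refine ih' _ (K.filter fun e => ¬ Reach s t (· ∈ K) a (s e)) (by omega) h4 (fun e he => ?_)
        (by omega) (Finset.filter_subset _ _)
      obtain ⟨h7, h8⟩ := Finset.mem_filter.1 he
      exact ⟨Finset.mem_filter.2 ⟨(hK e h7).1, h8⟩,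
        Finset.mem_filter.2 ⟨(hK e h7).2, fun h => h8 ((hcl e h7).2 h)⟩⟩

end

end EdgeEnds

/-! ### Translation between `Graph` and maps of ends -/

namespace Graph

noncomputable section

open scoped Classical

open EdgeEnds

variable {α : Type u} {β : Type v} (G H : Graph α β)

/-- An end of the edge `e`. -/
def fstEnd (e : E(G)) : V(G) :=
  ⟨(G.exists_isLink_of_mem_edgeSet e.2).choose,
    (G.exists_isLink_of_mem_edgeSet e.2).choose_spec.choose_spec.left_mem⟩

/-- The other end of the edge `e`. -/
def sndEnd (e : E(G)) : V(G) :=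
  ⟨(G.exists_isLink_of_mem_edgeSet e.2).choose_spec.choose,
    (G.exists_isLink_of_mem_edgeSet e.2).choose_spec.choose_spec.right_mem⟩

lemma isLink_ends (e : E(G)) : G.IsLink e (G.fstEnd e) (G.sndEnd e) :=
  (G.exists_isLink_of_mem_edgeSet e.2).choose_spec.choose_spec

variable {G H}

lemma link_iff {e : E(G)} {a b : V(G)} :
    Link G.fstEnd G.sndEnd e a b ↔ G.IsLink e a b := by
  rw [(G.isLink_ends e).isLink_iff, Link]
  simp only [Subtype.ext_iff]

lemma isLink_iff_of_le (h : H ≤ G) {e : E(G)} {a b : V(G)} :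
    H.IsLink e a b ↔ (e : β) ∈ E(H) ∧ Link G.fstEnd G.sndEnd e a b := by
  rw [link_iff]
  exact ⟨fun h' => ⟨h'.edge_mem, h'.mono h⟩, fun h' => (IsSubgraph.isLink_iff h h'.1).2 h'.2⟩

/-- Reachability in a subgraph. -/
lemma mem_component_iff (h : H ≤ G) {a b : V(G)} :
    (b : α) ∈ H.component a ↔ Reach G.fstEnd G.sndEnd (fun e => (e : β) ∈ E(H)) a b := by
  constructor
  · intro hab
    have : ∀ x, Relation.ReflTransGen H.Adj a x → ∃ hx : x ∈ V(G),
        Reach G.fstEnd G.sndEnd (fun e => (e : β) ∈ E(H)) a ⟨x, hx⟩ := by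
      intro x hx
      induction hx with
      | refl => exact ⟨a.2, .refl⟩
      | tail _ hbc ih =>
        obtain ⟨e, he⟩ := hbc
        obtain ⟨hb, hr⟩ := ih
        have he' := he.mono h
        refine ⟨he'.right_mem, hr.trans (.of_link (e := ⟨e, he'.edge_mem⟩) he.edge_mem ?_)⟩
        exact link_iff.2 he'
    exact (this _ hab).2
  · intro hab
    have : ∀ x, Reach G.fstEnd G.sndEnd (fun e => (e : β) ∈ E(H)) a x →
        Relation.ReflTransGen H.Adj a x := by
      intro x hx
      induction hx with
      | refl => exact .refl
      | tail _ hbc ih =>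
        obtain ⟨e, he, hl⟩ := hbc
        exact ih.tail ⟨e, (isLink_iff_of_le h).2 ⟨he, hl⟩⟩
    exact this _ hab

variable [Fintype E(G)]

/-- The edges of a subgraph. -/
def edgeFin (G H : Graph α β) [Fintype E(G)] : Finset E(G) :=
  Finset.univ.filter fun e => (e : β) ∈ E(H)

lemma mem_edgeFin {e : E(G)} : e ∈ edgeFin G H ↔ (e : β) ∈ E(H) := by simp [edgeFin]

lemma ncard_eq_sum {P : β → Prop} (hP : ∀ e, P e → e ∈ E(G)) :
    {e | P e}.ncard = ∑ e : E(G), if P e then 1 else 0 := by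
  have : {e | P e} = (Subtype.val : E(G) → β) '' (Finset.univ.filter fun e : E(G) => P e) := by
    ext e
    simp only [Set.mem_ofPred_eq, Set.mem_image, Finset.coe_filter, Finset.mem_univ, true_and]
    exact ⟨fun h => ⟨⟨e, hP e h⟩, h, rfl⟩, by rintro ⟨e, h, rfl⟩; exact h⟩
  rw [this, Set.ncard_image_of_injective _ Subtype.val_injective, Set.ncard_coe_finset,
    Finset.card_filter]

lemma degree_eq (h : H ≤ G) (v : V(G)) :
    H.degree v = bdry G.fstEnd G.sndEnd (indN (edgeFin G H)) v := by
  rw [degree, ncard_eq_sum (G := G) fun e he => (he.mono h).edge_mem,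
    ncard_eq_sum (G := G) fun e he => (he.mono h).edge_mem, Finset.mul_sum,
    ← Finset.sum_add_distrib]
  refine Finset.sum_congr rfl fun e _ => ?_
  have hloop : H.IsLoopAt e v ↔ (e : β) ∈ E(H) ∧ G.fstEnd e = v ∧ G.sndEnd e = v := by
    rw [IsLoopAt, isLink_iff_of_le h, Link, or_self]
  have hnon : H.IsNonloopAt e v ↔ (e : β) ∈ E(H) ∧
      ((G.fstEnd e = v ∧ G.sndEnd e ≠ v) ∨ (G.fstEnd e ≠ v ∧ G.sndEnd e = v)) := by
    constructor
    · rintro ⟨y, hy, hl⟩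
      have hy' := (hl.mono h).right_mem
      obtain ⟨h1, h2⟩ := (isLink_iff_of_le h (b := ⟨y, hy'⟩)).1 hl
      have hne : (⟨y, hy'⟩ : V(G)) ≠ v := fun h => hy (congrArg Subtype.val h)
      refine ⟨h1, ?_⟩
      rcases h2 with ⟨h2, h3⟩ | ⟨h2, h3⟩
      · exact Or.inl ⟨h2, h3 ▸ hne⟩
      · exact Or.inr ⟨h2 ▸ hne, h3⟩
    · rintro ⟨h1, ⟨h2, h3⟩ | ⟨h2, h3⟩⟩
      · exact ⟨G.sndEnd e, fun h' => h3 (Subtype.ext h'),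
          (isLink_iff_of_le h).2 ⟨h1, Or.inl ⟨h2, rfl⟩⟩⟩
      · exact ⟨G.fstEnd e, fun h' => h2 (Subtype.ext h'),
          (isLink_iff_of_le h).2 ⟨h1, Or.inr ⟨rfl, h3⟩⟩⟩
  rw [if_congr hloop rfl rfl, if_congr hnon rfl rfl]
  simp only [indN, mem_edgeFin]
  by_cases h1 : (e : β) ∈ E(H) <;> by_cases h2 : G.fstEnd e = v <;>
    by_cases h3 : G.sndEnd e = v <;> simp [h1, h2, h3]

lemma even_degree_iff (h : H ≤ G) (v : V(G)) :
    Even (H.degree v) ↔ bdry G.fstEnd G.sndEnd (ind (edgeFin G H)) v = 0 := by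
  have : (ind (edgeFin G H) : E(G) → ZMod 2) =
      fun e => Nat.castAddMonoidHom (ZMod 2) (indN (edgeFin G H) e) := by
    funext e
    by_cases he : e ∈ edgeFin G H <;> simp [ind, indN, he]
  rw [this, bdry_map, ← degree_eq h, ← ZMod.natCast_eq_zero_iff_even]
  rfl

/-- A subgraph of a tree has fewer edges than vertices. -/
lemma IsTree.card_lt {T : Graph α β} (hT : T.IsTree) (h : T ≤ G) {U : Finset V(G)}
    {K : Finset E(G)} (hU : U.Nonempty) (hKT : ∀ e ∈ K, (e : β) ∈ E(T))
    (hK : ∀ e ∈ K, G.fstEnd e ∈ U ∧ G.sndEnd e ∈ U) : K.card + 1 ≤ U.card := by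
  by_contra hcon
  obtain ⟨U', K', hK'K, ⟨u, hu⟩, hK', hdeg, hconn⟩ :=
    exists_two_regular _ U K le_rfl hU hK (by omega)
  let D : Graph α β :=
    { vertexSet := Subtype.val '' (U' : Set V(G))
      edgeSet := Subtype.val '' (K' : Set E(G))
      IsLink := fun e x y => T.IsLink e x y ∧ e ∈ Subtype.val '' (K' : Set E(G))
      isLink_symm := fun e _ => ⟨fun x y hxy => ⟨hxy.1.symm, hxy.2⟩⟩
      eq_or_eq_of_isLink_of_isLink := fun e x y z w h h' => h.1.left_eq_or_eq h'.1
      edge_mem_iff_exists_isLink := fun e => by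
        constructor
        · rintro ⟨e, he, rfl⟩
          obtain ⟨x, y, hxy⟩ := T.exists_isLink_of_mem_edgeSet (hKT e (hK'K he))
          exact ⟨x, y, hxy, e, he, rfl⟩
        · rintro ⟨x, y, -, he⟩
          exact he
      left_mem_of_isLink := fun e x y hxy => by
        obtain ⟨hl, e, he, rfl⟩ := hxy
        have h1 := hl.mono h
        obtain ⟨h2, h3⟩ := hK' e he
        rcases (link_iff (a := ⟨x, h1.left_mem⟩) (b := ⟨y, h1.right_mem⟩)).2 h1 with
          ⟨h4, -⟩ | ⟨-, h4⟩
        · exact ⟨_, h2, congrArg Subtype.val h4⟩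
        · exact ⟨_, h3, congrArg Subtype.val h4⟩ }
  have hDE : ∀ e : E(G), (e : β) ∈ E(D) ↔ e ∈ K' := fun e => by
    change (e : β) ∈ Subtype.val '' (K' : Set E(G)) ↔ _
    simp
  -- A vertex of `D` belongs to `T` because its degree is two, so that an edge of `K'` ends there.
  have hDT : D ≤ T := by
    refine ⟨?_, fun e x y hxy => hxy.1⟩
    rintro _ ⟨v, hv, rfl⟩
    have hne : bdry G.fstEnd G.sndEnd (indN K') v ≠ 0 := by rw [hdeg v hv]; decide
    obtain ⟨e, -, he⟩ := Finset.exists_ne_zero_of_sum_ne_zero hne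
    have heK : e ∈ K' := by
      by_contra h'
      simp [indN, h'] at he
    have hl : T.IsLink e (G.fstEnd e) (G.sndEnd e) :=
      (isLink_iff_of_le h).2 ⟨hKT e (hK'K heK), link_self _ _ e⟩
    by_cases h1 : G.fstEnd e = v
    · rw [← h1]; exact hl.left_mem
    · by_cases h2 : G.sndEnd e = v
      · rw [← h2]; exact hl.right_mem
      · simp [h1, h2] at he
  have hDG : D ≤ G := hDT.trans h
  have hfin : edgeFin G D = K' := by
    ext e
    rw [mem_edgeFin, hDE]
  refine hT.2 D hDT ⟨⟨⟨_, u, hu, rfl⟩, ?_⟩, ?_⟩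
  · rintro _ ⟨a, ha, rfl⟩ _ ⟨b, hb, rfl⟩
    rw [mem_component_iff hDG]
    exact (hconn a ha b hb).mono fun e he => (hDE e).2 he
  · rintro _ ⟨a, ha, rfl⟩
    rw [degree_eq hDG, hfin, hdeg a ha]

end

end Graph

/-! ### The two models of the Petersen graph -/

namespace EdgeEnds.PV

/-- The vertices of the Petersen graph as pairs. -/
def pair : PV → Finset (Fin 5)
  | z => {3, 4}
  | m i => ![{1, 2}, {0, 2}, {0, 1}] i
  | l i => ![{0, 3}, {1, 3}, {2, 3}] i
  | x i => ![{0, 4}, {1, 4}, {2, 4}] i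

lemma card_pair (p : PV) : p.pair.card = 2 := by revert p; decide

lemma pair_injective {p q : PV} (h : p.pair = q.pair) : p = q := by revert p q; decide

lemma exists_pair (s : Finset (Fin 5)) (h : s.card = 2) : ∃ p : PV, p.pair = s := by
  revert s; decide

lemma disjoint_pair (p q : PV) : Disjoint p.pair q.pair ↔ p.Adj q := by revert p q; decide

/-- The two models of the Petersen graph have the same vertices. -/
noncomputable def pairEquiv : PV ≃ {s : Finset (Fin 5) // s.card = 2} :=
  Equiv.ofBijective (fun p => ⟨p.pair, p.card_pair⟩)
    ⟨fun _ _ h => pair_injective (congrArg Subtype.val h), fun s =>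
      (exists_pair s.1 s.2).imp fun _ h => Subtype.ext h⟩

lemma adj_pairEquiv (p q : PV) :
    Graph.petersenSimple.Adj (pairEquiv p) (pairEquiv q) ↔ p.Adj q := disjoint_pair p q

lemma exists_adj (p : PV) : ∃ q, p.Adj q := by revert p; decide

end EdgeEnds.PV

/-! ### Contraction to the Petersen graph, and the proof of the theorem -/

namespace Graph

noncomputable section

open scoped Classical

open EdgeEnds

variable {α : Type u} {β : Type v} {G C T : Graph α β}

lemma component_subset (h : C ≤ G) {x : α} (hx : x ∈ V(G)) : C.component x ⊆ V(G) := by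
  intro y hy
  rcases Relation.ReflTransGen.cases_tail hy with h' | ⟨_, -, _, h'⟩
  · rwa [h']
  · exact (h'.mono h).right_mem

/-- The fiber of `p`, as a set of vertices. -/
def fiber (M : V(G) → PV) (p : PV) : Set α := {x | ∃ h : x ∈ V(G), M ⟨x, h⟩ = p}

/-- The edges within the fibers. -/
def fiberEdges (M : V(G) → PV) : Set β :=
  {e | ∃ h : e ∈ E(G), M (G.fstEnd ⟨e, h⟩) = M (G.sndEnd ⟨e, h⟩)}

/-- A map with connected fibers onto the Petersen graph is a contraction. -/
lemma isContractibleTo_petersen {M : V(G) → PV}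
    (hconn : ∀ v v', M v = M v' →
      Reach G.fstEnd G.sndEnd (fun e => M (G.fstEnd e) = M (G.sndEnd e)) v v')
    (hedge : ∀ p q, p.Adj q → ∃! e, Link (M ∘ G.fstEnd) (M ∘ G.sndEnd) e p q)
    (hadj : ∀ e, M (G.fstEnd e) ≠ M (G.sndEnd e) → (M (G.fstEnd e)).Adj (M (G.sndEnd e))) :
    G.IsContractibleTo petersen := by
  have hsurj : ∀ p, ∃ v, M v = p := by
    intro p
    obtain ⟨q, hq⟩ := p.exists_adj
    obtain ⟨e, ⟨h, -⟩ | ⟨-, h⟩, -⟩ := hedge p q hq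
    exacts [⟨_, h⟩, ⟨_, h⟩]
  have hmemF : ∀ e : E(G), (e : β) ∈ fiberEdges M ↔ M (G.fstEnd e) = M (G.sndEnd e) :=
    fun e => ⟨fun ⟨_, h⟩ => h, fun h => ⟨e.2, h⟩⟩
  have hcomp : ∀ v : V(G), (G.restrict (fiberEdges M)).component v = fiber M (M v) := by
    intro v
    have hE : ∀ e : E(G), (e : β) ∈ E(G.restrict (fiberEdges M)) ↔
        M (G.fstEnd e) = M (G.sndEnd e) := fun e => by
      rw [← hmemF]
      simp
    ext x
    constructor
    · intro hx
      have hxG := component_subset restrict_le v.2 hx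
      refine ⟨hxG, ?_⟩
      have := (mem_component_iff restrict_le (b := ⟨x, hxG⟩)).1 hx
      exact (this.mem_of_closed (A := {u | M u = M v}) fun e he => by
        rw [Set.mem_ofPred_eq, Set.mem_ofPred_eq, (hE e).1 he]).1 rfl
    · rintro ⟨hxG, hx⟩
      exact (mem_component_iff restrict_le (b := ⟨x, hxG⟩)).2
        ((hconn _ _ hx.symm).mono fun e he => (hE e).2 he)
  have hinj : ∀ p q, fiber M p = fiber M q → p = q := by
    intro p q h
    obtain ⟨v, rfl⟩ := hsurj p
    have : (v : α) ∈ fiber M q := h ▸ ⟨v.2, rfl⟩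
    obtain ⟨_, h'⟩ := this
    exact h'
  refine ⟨fiberEdges M, fun e he => he.1, ?_⟩
  have hV : ∀ S, S ∈ V(G.contract (fiberEdges M)) ↔ ∃ p, fiber M p = S := by
    intro S
    constructor
    · rintro ⟨x, hx, rfl⟩
      exact ⟨_, (hcomp ⟨x, hx⟩).symm⟩
    · rintro ⟨p, rfl⟩
      obtain ⟨v, rfl⟩ := hsurj p
      exact ⟨v, v.2, hcomp v⟩
  have hE : ∀ e, e ∈ E(G.contract (fiberEdges M)) ↔
      ∃ h : e ∈ E(G), M (G.fstEnd ⟨e, h⟩) ≠ M (G.sndEnd ⟨e, h⟩) := by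
    intro e
    change e ∈ E(G.deleteEdges (fiberEdges M)) ↔ _
    rw [edgeSet_deleteEdges]
    exact ⟨fun h => ⟨h.1, fun h' => h.2 ⟨h.1, h'⟩⟩, fun ⟨h, h'⟩ => ⟨h, fun ⟨_, h''⟩ => h' h''⟩⟩
  let χ : PV ≃ V(G.contract (fiberEdges M)) :=
    Equiv.ofBijective (fun p => ⟨fiber M p, (hV _).2 ⟨p, rfl⟩⟩)
      ⟨fun p q h => hinj p q (congrArg Subtype.val h), fun S =>
        ((hV _).1 S.2).imp fun p hp => Subtype.ext hp⟩
  let E' : E(G.contract (fiberEdges M)) → E(G) := fun e => ⟨e, ((hE e).1 e.2).choose⟩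
  have hE' : ∀ e, M (G.fstEnd (E' e)) ≠ M (G.sndEnd (E' e)) := fun e => ((hE e).1 e.2).choose_spec
  let ψ : E(G.contract (fiberEdges M)) → E(petersen) := fun e =>
    ⟨s(PV.pairEquiv (M (G.fstEnd (E' e))), PV.pairEquiv (M (G.sndEnd (E' e)))),
      (PV.adj_pairEquiv _ _).2 (hadj _ (hE' e))⟩
  have hψ : ∀ e p q, (ψ e : Sym2 _) = s(PV.pairEquiv p, PV.pairEquiv q) ↔
      Link (M ∘ G.fstEnd) (M ∘ G.sndEnd) (E' e) p q := by
    intro e p q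
    simp only [ψ, Sym2.eq_iff, Link, Function.comp, EmbeddingLike.apply_eq_iff_eq]
  have hψb : Function.Bijective ψ := by
    constructor
    · intro e e' h
      have h1 := (hψ e _ _).1 rfl
      have h2 := (hψ e' (M (G.fstEnd (E' e))) (M (G.sndEnd (E' e)))).1
        (by rw [← h])
      have := (hedge _ _ (hadj _ (hE' e))).unique h1 h2
      exact Subtype.ext (congrArg (Subtype.val : E(G) → β) this)
    · rintro ⟨q, hq⟩
      induction q with
      | h a b =>
        obtain ⟨a, rfl⟩ := PV.pairEquiv.surjective a
        obtain ⟨b, rfl⟩ := PV.pairEquiv.surjective b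
        have hab := (PV.adj_pairEquiv a b).1 hq
        obtain ⟨e, he, -⟩ := hedge a b hab
        have hne : M (G.fstEnd e) ≠ M (G.sndEnd e) := by
          intro h'
          rcases he with ⟨h1, h2⟩ | ⟨h1, h2⟩ <;> simp only [Function.comp] at h1 h2
          · exact hab.ne (h1.symm.trans (h'.trans h2))
          · exact hab.ne (h2.symm.trans (h'.symm.trans h1))
        exact ⟨⟨e, (hE e).2 ⟨e.2, hne⟩⟩, Subtype.ext ((hψ _ _ _).2 he)⟩
  refine ⟨χ.symm.trans (PV.pairEquiv.trans (Equiv.Set.univ _).symm), Equiv.ofBijective ψ hψb,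
    fun e S S' => ?_⟩
  obtain ⟨p, rfl⟩ := χ.surjective S
  obtain ⟨q, rfl⟩ := χ.surjective S'
  have h1 : (G.contract (fiberEdges M)).IsLink e (χ p) (χ q) ↔
      Link (M ∘ G.fstEnd) (M ∘ G.sndEnd) (E' e) p q := by
    constructor
    · rintro ⟨x, y, hxy, hx, hy⟩
      have hl : G.IsLink e x y := hxy.mono deleteEdges_le
      have hx' := hinj _ _ ((hcomp ⟨x, hl.left_mem⟩).symm.trans hx)
      have hy' := hinj _ _ ((hcomp ⟨y, hl.right_mem⟩).symm.trans hy)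
      have hl' := (link_iff (e := E' e) (a := ⟨x, hl.left_mem⟩) (b := ⟨y, hl.right_mem⟩)).2 hl
      rcases hl' with ⟨h1, h2⟩ | ⟨h1, h2⟩
      · exact Or.inl ⟨by simp only [Function.comp, h1, hx'], by simp only [Function.comp, h2, hy']⟩
      · exact Or.inr ⟨by simp only [Function.comp, h1, hy'], by simp only [Function.comp, h2, hx']⟩
    · have hd : ∀ a b : V(G), Link G.fstEnd G.sndEnd (E' e) a b →
          (G.deleteEdges (fiberEdges M)).IsLink e a b := fun a b hab =>
        (isLink_iff_of_le deleteEdges_le).2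
          ⟨show ((E' e : E(G)) : β) ∈ E(G.deleteEdges (fiberEdges M)) from e.2, hab⟩
      rintro (⟨rfl, rfl⟩ | ⟨rfl, rfl⟩)
      · exact ⟨_, _, hd _ _ (Or.inl ⟨rfl, rfl⟩), hcomp _, hcomp _⟩
      · exact ⟨_, _, hd _ _ (Or.inr ⟨rfl, rfl⟩), hcomp _, hcomp _⟩
  rw [h1, ← hψ e p q]
  change _ ↔ (ψ e).1 = _ ∧ (ψ e).1 ∈ petersenSimple.edgeSet
  simp only [Equiv.trans_apply, Equiv.symm_apply_apply]
  exact (and_iff_left (ψ e).2).symm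

/-- The components of `C`, where all vertices of `G` outside of `C` are isolated. -/
def componentSetoid (G C : Graph α β) : Setoid V(G) :=
  ⟨Reach G.fstEnd G.sndEnd fun e => (e : β) ∈ E(C), fun _ => .refl, Reach.symm, Reach.trans⟩

/-- Classes of the quotient correspond injectively to sets `C.component a`. The bound gives both
`X.card ≤ 3` and, in the Petersen case, at least three components. -/
lemma card_image_le_numComponents [Fintype V(G)] (hle : C ≤ G) :
    ((Finset.univ.filter fun v : V(G) => (v : α) ∈ V(C)).image
      (Quotient.mk (componentSetoid G C))).card ≤ C.numComponents := by
  have hκ : ∀ a b : V(G), (componentSetoid G C) a b → C.component a = C.component b := by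
    intro a b hab
    ext x
    exact ⟨fun h => ((mem_component_iff hle).2 (Reach.symm hab)).trans h,
      fun h => ((mem_component_iff hle).2 hab).trans h⟩
  let κ : Quotient (componentSetoid G C) → Set α :=
    Quotient.lift (fun v : V(G) => C.component v) hκ
  have hinj : Function.Injective κ := by
    intro p q
    induction p using Quotient.inductionOn with
    | _ a =>
    induction q using Quotient.inductionOn with
    | _ b =>
    intro h
    have hb : (b : α) ∈ C.component a := by
      have : C.component a = C.component b := h
      rw [this]; exact .refl
    exact Quotient.sound ((mem_component_iff hle).1 hb)
  rw [numComponents, ← Set.ncard_coe_finset, ← Set.ncard_image_of_injective _ hinj]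
  apply le_of_eq
  congr 1
  ext S
  simp only [Finset.coe_image, Finset.coe_filter, Finset.mem_univ, true_and, Set.mem_image,
    Set.mem_ofPred_eq]
  constructor
  · rintro ⟨_, ⟨v, hv, rfl⟩, rfl⟩
    exact ⟨v, hv, rfl⟩
  · rintro ⟨x, hx, rfl⟩
    exact ⟨_, ⟨⟨x, IsSubgraph.vertexSet_mono hle hx⟩, hx, rfl⟩, rfl⟩

variable [Fintype E(G)]

/-- Even edge sets are the edge sets of spanning cycles. -/
lemma hasCDCContaining_of_hasCover (hle : C ≤ G) (hC : C.IsCycle) {k : ℕ}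
    (h : HasCover G.fstEnd G.sndEnd (edgeFin G C) k) : G.HasCDCContaining k C := by
  obtain ⟨S, hS, ⟨i₀, hi₀⟩, hcov⟩ := h
  -- The member with index `i₀` has to be `C` as a graph, with its own vertex set. The others are
  -- taken as spanning subgraphs.
  let D : Fin k → Graph α β := fun i =>
    if i = i₀ then C else G.restrict {e | ∃ h : e ∈ E(G), S i ⟨e, h⟩ = 1}
  have hDle : ∀ i, D i ≤ G := fun i => by
    by_cases hi : i = i₀
    · simp only [D, if_pos hi]; exact hle
    · simp only [D, if_neg hi]; exact restrict_le
  have hDE : ∀ i (e : E(G)), (e : β) ∈ E(D i) ↔ S i e = 1 := fun i e => by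
    by_cases hi : i = i₀
    · subst hi
      simp only [D, if_true, hi₀, ind, mem_edgeFin]
      by_cases he : (e : β) ∈ E(C) <;> simp [he]
    · simp [D, if_neg hi]
  refine ⟨D, ⟨hDle, fun i => ?_, fun e he => ?_⟩, i₀, if_pos rfl⟩
  · by_cases hi : i = i₀
    · simp only [D, if_pos hi]; exact hC
    · intro x hx
      have hind : ind (edgeFin G (D i)) = S i := by
        funext e
        have h01 : ∀ c : ZMod 2, c ≠ 1 → c = 0 := by decide
        by_cases h1 : S i e = 1
        · rw [ind, if_pos (mem_edgeFin.2 ((hDE i e).2 h1)), h1]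
        · rw [ind, if_neg fun h => h1 ((hDE i e).1 (mem_edgeFin.1 h)), h01 _ h1]
      refine (even_degree_iff (hDle i) ⟨x, IsSubgraph.vertexSet_mono (hDle i) hx⟩).2 ?_
      rw [hind]
      exact hS i _
  · rw [← hcov ⟨e, he⟩, ← Set.ncard_coe_finset]
    congr 1
    ext i
    simpa using hDE i ⟨e, he⟩

lemma treeCycle [Fintype V(G)] (hT : T.IsTree) (hC : C.IsCycle) (hdec : G.IsDecomposition T C) :
    TreeCycle G.fstEnd G.sndEnd (edgeFin G C) (Finset.univ.filter fun v => (v : α) ∈ V(T)) := by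
  have hTE : ∀ e : E(G), e ∉ edgeFin G C ↔ (e : β) ∈ E(T) := by
    intro e
    rw [mem_edgeFin]
    constructor
    · intro h
      have : (e : β) ∈ E(T) ∪ E(C) := by rw [hdec.cover]; exact e.2
      exact this.resolve_right h
    · exact fun h h' => Set.disjoint_left.1 hdec.disjoint h h'
  refine ⟨fun v => ?_, fun a ha b hb => ?_, fun e he => ?_⟩
  · by_cases hv : (v : α) ∈ V(C)
    · exact (even_degree_iff hdec.right_le v).1 (hC v hv)
    · refine (bdry_congr_at fun e he => ?_).trans (bdry_zero _ _ v)
      rw [ind, if_neg]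
      · rfl
      · intro heC
        have hl : C.IsLink e (G.fstEnd e) (G.sndEnd e) :=
          (isLink_iff_of_le hdec.right_le).2 ⟨mem_edgeFin.1 heC, link_self _ _ e⟩
        rcases he with rfl | rfl
        · exact hv hl.left_mem
        · exact hv hl.right_mem
  · rw [mem_univ_filter] at ha hb
    exact ((mem_component_iff hdec.left_le).1 (hT.1.2 _ ha _ hb)).mono fun e he => (hTE e).2 he
  · have hl : T.IsLink e (G.fstEnd e) (G.sndEnd e) :=
      (isLink_iff_of_le hdec.left_le).2 ⟨(hTE e).1 he, link_self _ _ e⟩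
    rw [mem_univ_filter, mem_univ_filter]
    exact ⟨hl.left_mem, hl.right_mem⟩

/-- Every cut of a 2-edge-connected graph has at least two edges. -/
lemma IsTwoEdgeConnected.two_le_cut (hG : G.IsTwoEdgeConnected) {A : Set V(G)} {a b : V(G)}
    (ha : a ∈ A) (hb : b ∉ A) :
    2 ≤ (Finset.univ.filter fun e => ¬ (G.fstEnd e ∈ A ↔ G.sndEnd e ∈ A)).card := by
  by_contra hcon
  have hsub : ∀ H ≤ G, H.IsConnected → V(H) = V(G) →
      ∃ e : E(G), (e : β) ∈ E(H) ∧ ¬ (G.fstEnd e ∈ A ↔ G.sndEnd e ∈ A) := by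
    intro H hH hc hV
    by_contra! hno
    have hr := (mem_component_iff hH).1 (hc.2 a (by rw [hV]; exact a.2) b (by rw [hV]; exact b.2))
    exact hb ((hr.mem_of_closed hno).1 ha)
  obtain ⟨e, -, he⟩ := hsub G le_rfl hG.1 rfl
  obtain ⟨e', he', hc'⟩ := hsub (G.deleteEdges {(e : β)}) deleteEdges_le (hG.2 e e.2) rfl
  have hne : e ≠ e' := by
    rintro rfl
    rw [edgeSet_deleteEdges] at he'
    exact he'.2 rfl
  have : ({e, e'} : Finset E(G)) ⊆
      Finset.univ.filter fun e => ¬ (G.fstEnd e ∈ A ↔ G.sndEnd e ∈ A) := by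
    intro f hf
    rw [mem_univ_filter]
    rcases Finset.mem_insert.1 hf with rfl | hf
    · exact he
    · rw [Finset.mem_singleton.1 hf]; exact hc'
  have := Finset.card_le_card this
  rw [Finset.card_pair hne] at this
  omega

variable [Fintype V(G)]

/-- In a graph that decomposes into a tree and a cycle with at most three components, the
contraction of the components of the cycle leaves a graph with a small feedback vertex set. -/
lemma feedback (hG : G.IsTwoEdgeConnected) (hT : T.IsTree) (hdec : G.IsDecomposition T C)
    (hk : C.numComponents ≤ 3) :
    Feedback (Quotient.mk (componentSetoid G C) ∘ G.fstEnd)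
      (Quotient.mk (componentSetoid G C) ∘ G.sndEnd)
      ((Finset.univ.filter fun v : V(G) => (v : α) ∈ V(C)).image
        (Quotient.mk (componentSetoid G C))) := by
  refine ⟨(card_image_le_numComponents hdec.right_le).trans hk, fun A hA hAu => ?_,
    fun U hU hUX => ?_⟩
  · obtain ⟨p, hp⟩ := hA
    obtain ⟨q, hq⟩ : ∃ q, q ∉ A := by
      by_contra! h
      exact hAu (Finset.eq_univ_iff_forall.2 h)
    induction p using Quotient.inductionOn with
    | _ a =>
    induction q using Quotient.inductionOn with
    | _ b =>
    refine (hG.two_le_cut (A := {v | Quotient.mk (componentSetoid G C) v ∈ A}) (a := a) (b := b)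
      hp hq).trans (le_of_eq ?_)
    congr 1
    ext e
    rw [mem_univ_filter, mem_univ_filter]
    rfl
  · have hV : ∀ v : V(G), Quotient.mk (componentSetoid G C) v ∈ U → (v : α) ∉ V(C) :=
      fun v hv hvC => Finset.disjoint_left.1 hUX hv
        (Finset.mem_image_of_mem _ (mem_univ_filter.2 hvC))
    have hends : ∀ e : E(G), (e : β) ∈ E(C) → (G.fstEnd e : α) ∈ V(C) ∧ (G.sndEnd e : α) ∈ V(C) :=
      fun e he => by
        have hl : C.IsLink e (G.fstEnd e) (G.sndEnd e) :=
          (isLink_iff_of_le hdec.right_le).2 ⟨he, link_self _ _ e⟩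
        exact ⟨hl.left_mem, hl.right_mem⟩
    -- A vertex off `C` forms a class by itself, so the quotient is injective off `X` and the edges
    -- there form a subgraph of the tree.
    have hinj : ∀ a b : V(G), Quotient.mk (componentSetoid G C) a ∈ U →
        Quotient.mk (componentSetoid G C) a = Quotient.mk (componentSetoid G C) b → a = b := by
      intro a b ha hab
      have hr : Reach G.fstEnd G.sndEnd (fun e => (e : β) ∈ E(C)) a b := Quotient.exact hab
      rcases Relation.ReflTransGen.cases_head hr with h | ⟨c, ⟨e, he, hl⟩, -⟩
      · exact h
      · refine absurd ?_ (hV a ha)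
        rcases hl with ⟨rfl, -⟩ | ⟨-, rfl⟩
        exacts [(hends e he).1, (hends e he).2]
    obtain ⟨U', hU'⟩ : ∃ U' : Finset V(G), ∀ v, v ∈ U' ↔
        Quotient.mk (componentSetoid G C) v ∈ U :=
      ⟨Finset.univ.filter fun v => Quotient.mk (componentSetoid G C) v ∈ U,
        fun _ => mem_univ_filter⟩
    have hcard : U'.card ≤ U.card :=
      Finset.card_le_card_of_injOn (Quotient.mk (componentSetoid G C))
        (fun v hv => (hU' v).1 hv)
        fun a ha b _ hab => hinj a b ((hU' a).1 ha) hab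
    refine le_trans (hT.card_lt hdec.left_le (U := U') ?_ (fun e he => ?_) fun e he => ?_) hcard
    · obtain ⟨p, hp⟩ := hU
      induction p using Quotient.inductionOn with
      | _ a => exact ⟨a, (hU' a).2 hp⟩
    · rw [mem_univ_filter] at he
      have : (e : β) ∈ E(T) ∪ E(C) := by rw [hdec.cover]; exact e.2
      exact this.resolve_right fun h => hV _ he.2.1 (hends e h).1
    · rw [mem_univ_filter] at he
      exact ⟨(hU' _).2 he.2.1, (hU' _).2 he.2.2⟩

/-- The two cases of the theorem. -/
lemma exists_cover (hG : G.IsTwoEdgeConnected) (hT : T.IsTree) (hC : C.IsCycle)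
    (hdec : G.IsDecomposition T C) (hk : C.numComponents ≤ 3) :
    HasCover G.fstEnd G.sndEnd (edgeFin G C) 5 ∨
      3 ≤ C.numComponents ∧ G.IsContractibleTo petersen ∧
        HasCover G.fstEnd G.sndEnd (edgeFin G C) 6 := by
  have htc := treeCycle hT hC hdec
  have hfb := feedback hG hT hdec hk
  have hπ : ∀ u v : V(G), Quotient.mk (componentSetoid G C) u =
      Quotient.mk (componentSetoid G C) v ↔
        Reach G.fstEnd G.sndEnd (· ∈ edgeFin G C) u v := by
    intro u v
    simp only [mem_edgeFin]
    exact Quotient.eq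
  have hX : ∀ e ∈ edgeFin G C, Quotient.mk (componentSetoid G C) (G.fstEnd e) ∈
      (Finset.univ.filter fun v : V(G) => (v : α) ∈ V(C)).image
        (Quotient.mk (componentSetoid G C)) := by
    intro e he
    have hl : C.IsLink e (G.fstEnd e) (G.sndEnd e) :=
      (isLink_iff_of_le hdec.right_le).2 ⟨mem_edgeFin.1 he, link_self _ _ e⟩
    exact Finset.mem_image_of_mem _ (mem_univ_filter.2 hl.left_mem)
  obtain ⟨x, hx⟩ := hG.1.1
  have : Nonempty (Quotient (componentSetoid G C)) := ⟨Quotient.mk _ ⟨x, hx⟩⟩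
  rcases Feedback.flowOrPetersen _ _ _ _ le_rfl hfb with ⟨f, hf, hne⟩ | ⟨m, e₀, f, hm, hf⟩
  · exact Or.inl (htc.hasCover_of_flow hπ hf hne)
  · refine Or.inr ⟨?_, ?_, htc.hasCover_of_petersen hπ hX hfb hm hf⟩
    -- Each of the three Petersen vertices `x i` is hit by a component of `C`.
    · refine le_trans ?_ (card_image_le_numComponents hdec.right_le)
      choose w hw hmw using hm.hitX
      calc 3 = (Finset.univ : Finset (Fin 3)).card := by simp
        _ ≤ _ := Finset.card_le_card_of_injOn w (fun i _ => hw i) fun i _ j _ hij => by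
          have := (hmw i).symm.trans ((congrArg m hij).trans (hmw j))
          exact PV.x.inj this
    · refine isContractibleTo_petersen (M := m ∘ Quotient.mk (componentSetoid G C))
        (fun v v' hv => ?_) hm.edge hm.adj
      refine Reach.lift (μ := Quotient.mk (componentSetoid G C)) (fun u u' hu => ?_)
        (hm.conn _ _ hv) v' rfl
      exact ((hπ u u').1 hu).mono fun e he =>
        congrArg m ((hπ _ _).2 (.of_link he (link_self _ _ e)))

end

end Graph

theorem theorem3p4 {α : Type u} {β : Type v} (G T C : Graph α β)
    (hV : V(G).Finite) (hE : E(G).Finite) (hG : G.IsTwoEdgeConnected)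
    (hT : T.IsTree) (hC : C.IsCycle) (hdec : G.IsDecomposition T C)
    (hk : C.numComponents ≤ 3) :
    (∃ n : ℕ, G.HasCDCContaining n C) ∧
    (C.numComponents ≤ 2 → G.HasCDCContaining 5 C) ∧
    (C.numComponents = 3 →
      (¬ G.IsContractibleTo Graph.petersen → G.HasCDCContaining 5 C) ∧
      (G.IsContractibleTo Graph.petersen → G.HasCDCContaining 6 C)) := by
  have := hV.fintype
  have := hE.fintype
  have hcdc : ∀ k, EdgeEnds.HasCover G.fstEnd G.sndEnd (Graph.edgeFin G C) k →
      G.HasCDCContaining k C := fun k =>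
    Graph.hasCDCContaining_of_hasCover hdec.right_le hC
  rcases Graph.exists_cover hG hT hC hdec hk with h5 | ⟨h3, hP, h6⟩
  -- A graph contractible to the Petersen graph may still have a cover with five members; the empty
  -- cycle makes it six.
  · exact ⟨⟨5, hcdc 5 h5⟩, fun _ => hcdc 5 h5, fun _ => ⟨fun _ => hcdc 5 h5,
      fun _ => hcdc 6 h5.succ⟩⟩
  · exact ⟨⟨6, hcdc 6 h6⟩, fun h => absurd h3 (by omega), fun _ => ⟨fun h => absurd hP h,
      fun _ => hcdc 6 h6⟩⟩
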